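/- **Conventions.** Let $W$ be a vector space over $\mathbb C$, let $\mathcal E(W)=\mathrm{Hom}(W,W((x)))\subset(\mathrm{End}\,W)[[x,x^{-1}]]$, and let $1_W\in\mathcal E(W)$ be the constant series given by the identity operator. For $\alpha\in\mathbb C^\times$ and $a(x)\in\mathcal E(W)$ put $R_\alpha a(x)=a(\alpha x)$. Let $\Gamma$ be a subgroup of $\mathbb C^\times$. A subset $S\subset\mathcal E(W)$ is *quasi-local* if for all $a(x),b(x)\in S$ there is a nonzero polynomial $p(x_1,x_2)$ with $p(x_1,x_2)a(x_1)b(x_2)=p(x_1,x_2)b(x_2)a(x_1)$. It is *$\Gamma$-local* if for all $a(x),b(x)\in S$ such a relation holds with $p=(x_1-\alpha_1x_2)\cdots(x_1-\alpha_rx_2)$ for some $\alpha_1,\dots,\alpha_r\in\Gamma$. For a quasi-local pair $a(x),b(x)$, with $p$ as above, define $$Y_{\mathcal E}(a(x),x_0)b(x)=\iota_{x,x_0}\!\left(\frac1{p(x+x_0,x)}\right)\bigl(p(x_1,x)a(x_1)b(x)\bigr)\big|_{x_1=x+x_0}=\sum_{n\in\mathbb Z}a(x)_nb(x)\,x_0^{-n-1},$$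 where $\iota_{x,x_0}(1/p(x+x_0,x))$ is the inverse of $p(x+x_0,x)$ in $\mathbb C((x))((x_0))$ and powers of $x+x_0$ are expanded in nonnegative powers of $x_0$; this does not depend on $p$. A quasi-local subspace $U$ of $\mathcal E(W)$ is *closed* if $a(x)_nb(x)\in U$ for all $a(x),b(x)\in U$ and $n\in\mathbb Z$. A *vertex algebra* is a $\mathbb C$-vector space $V$ with a vector $\mathbf 1\in V$ and a linear map $Y:V\to\mathrm{Hom}(V,V((x)))$ such that $Y(\mathbf 1,x)=1_V$, $Y(v,x)\mathbf 1\in v+xV[[x]]$, and the Jacobi identity $$x_0^{-1}\delta\!\left(\tfrac{x_1-x_2}{x_0}\right)Y(u,x_1)Y(v,x_2)-x_0^{-1}\delta\!\left(\tfrac{x_2-x_1}{-x_0}\right)Y(v,x_2)Y(u,x_1)=x_2^{-1}\delta\!\left(\tfrac{x_1-x_0}{x_2}\right)Y(Y(u,x_0)v,x_2)$$ holds for all $u,v\in V$. For a group $G$, a *$G$-vertex algebra* is a vertex algebra $V$ with group homomorphisms $R:G\to GL(V)$ and $\phi:G\to\mathbb C^\times$ such that $R_g\mathbf 1=\mathbf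 1$ and $R_gY(v,x)R_g^{-1}=Y(R_gv,\phi(g)^{-1}x)$ for $g\in G$, $v\in V$. A *quasimodule* for it is a vector space $W$ with a linear map $Y_W:V\to\mathcal E(W)$ such that: $Y_W(\mathbf 1,x)=1_W$; for all $u,v\in V$ there is a nonzero polynomial $p(x_1,x_2)$ such that $$x_0^{-1}\delta\!\left(\tfrac{x_1-x_2}{x_0}\right)p(x_1,x_2)Y_W(u,x_1)Y_W(v,x_2)-x_0^{-1}\delta\!\left(\tfrac{x_2-x_1}{-x_0}\right)p(x_1,x_2)Y_W(v,x_2)Y_W(u,x_1)$$ $$=x_2^{-1}\delta\!\left(\tfrac{x_1-x_0}{x_2}\right)p(x_1,x_2)Y_W(Y(u,x_0)v,x_2);$$ $Y_W(R_gv,x)=Y_W(v,\phi(g)x)$ for $g\in G$, $v\in V$; and $\{Y_W(v,x)\mid v\in V\}$ is $\phi(G)$-local. **Theorem.** Let $W$ be a vector space over $\mathbb C$ and let $\Gamma$ be a subgroup of $\mathbb C^\times$. 1. For any $\Gamma$-local subset $S$ of $\mathcal E(W)$ there exist closed $\Gamma$-local subspaces $K$ of $\mathcal E(W)$ such that $\{1_W\}\cup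 S\subset K$ and $R_\alpha a(x)\in K$ for all $\alpha\in\Gamma$, $a(x)\in K$; among these there is a smallest one, denoted $\langle S\rangle_\Gamma$. 2. Let $V$ be any closed $\Gamma$-local subspace of $\mathcal E(W)$ such that $1_W\in V$ and $R_\alpha a(x)\in V$ for all $\alpha\in\Gamma$, $a(x)\in V$. Then $(V,1_W,Y_{\mathcal E})$, with the action $\alpha\mapsto R_\alpha$ of $\Gamma$ and with $\phi$ the inclusion $\Gamma\subset\mathbb C^\times$, is a $\Gamma$-vertex algebra, and $W$ is a quasimodule for it with $Y_W(a(x),x_0)=a(x_0)$ for $a(x)\in V$. -/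

import Mathlib

namespace GammaVA

open HVertexOperator

noncomputable section

/-! For a complex vector space `W`, the space `Hom(W, W((x)))` is Mathlib's `VertexOperator ℂ W`.
For `a : VertexOperator ℂ W`, `coeff a n : Module.End ℂ W` is the coefficient of `x ^ n` in `a(x)`,
and `VertexOperator.ncoeff a n` is the coefficient of `x ^ (-n - 1)`. -/

section Fields

variable {W : Type*} [AddCommGroup W] [Module ℂ W]

lemma exists_coeff_eq_zero (a : VertexOperator ℂ W) (w : W) :
    ∃ N : ℤ, ∀ n < N, coeff a n w = 0 :=
  ⟨_, fun _ hn => VertexOperator.coeff_eq_zero_of_lt_order a _ w hn⟩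

lemma bddBelow_of_forall_lt {M : Type*} [Zero M] {f : ℤ → M} (h : ∃ N : ℤ, ∀ n < N, f n = 0) :
    BddBelow (Function.support f) := by
  obtain ⟨N, hN⟩ := h
  refine ⟨N, fun n hn => ?_⟩
  by_contra hlt
  exact hn (hN n (not_le.mp hlt))

/-- The identity operator `1_W`, regarded as the constant series in `Hom(W, W((x)))`. -/
def idField (W : Type*) [AddCommGroup W] [Module ℂ W] : VertexOperator ℂ W :=
  VertexOperator.of_coeff (fun n => if n = 0 then LinearMap.id else 0) fun w =>
    bddBelow_of_forall_lt ⟨0, fun n hn => by simp [hn.ne]⟩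

/-- The substitution `R_α a(x) = a(α x)` for a nonzero complex number `α`. -/
def rescale (α : ℂˣ) (a : VertexOperator ℂ W) : VertexOperator ℂ W :=
  VertexOperator.of_coeff (fun n => ((α ^ n : ℂˣ) : ℂ) • coeff a n) fun w => by
    obtain ⟨N, hN⟩ := exists_coeff_eq_zero a w
    exact bddBelow_of_forall_lt ⟨N, fun n hn => by simp only [LinearMap.smul_apply, hN n hn, smul_zero]⟩

/-- Multiplication of a formal series `∑ F m n x₁ ^ m x₂ ^ n` (infinite in all directions) by a
polynomial `p(x₁, x₂)`; the variable `X 0` is `x₁` and `X 1` is `x₂`. -/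
def polyMul {M : Type*} [AddCommGroup M] [Module ℂ M] (p : MvPolynomial (Fin 2) ℂ)
    (F : ℤ → ℤ → M) : ℤ → ℤ → M :=
  fun m n => ∑ s ∈ p.support, p.coeff s • F (m - s 0) (n - s 1)

/-- The formal series `a(x₁) b(x₂)` with coefficients in `End W`. -/
def prodAB (a b : VertexOperator ℂ W) : ℤ → ℤ → Module.End ℂ W :=
  fun m n => coeff a m * coeff b n

/-- The formal series `b(x₂) a(x₁)` with coefficients in `End W`; the first index is still the
exponent of `x₁`. -/
def prodBA (a b : VertexOperator ℂ W) : ℤ → ℤ → Module.End ℂ W :=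
  fun m n => coeff b n * coeff a m

/-- `p(x₁, x₂) a(x₁) b(x₂) = p(x₁, x₂) b(x₂) a(x₁)`. -/
def CommuteUpTo (p : MvPolynomial (Fin 2) ℂ) (a b : VertexOperator ℂ W) : Prop :=
  polyMul p (prodAB a b) = polyMul p (prodBA a b)

/-- The pair `a(x)`, `b(x)` is quasi-local. -/
def QuasiLocalPair (a b : VertexOperator ℂ W) : Prop :=
  ∃ p : MvPolynomial (Fin 2) ℂ, p ≠ 0 ∧ CommuteUpTo p a b

/-- A set of fields is quasi-local if all its pairs are. -/
def QuasiLocal (S : Set (VertexOperator ℂ W)) : Prop :=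
  ∀ a ∈ S, ∀ b ∈ S, QuasiLocalPair a b

/-- The polynomial `(x₁ - α₁ x₂) ⋯ (x₁ - α_r x₂)`. -/
def linearProduct (l : List ℂˣ) : MvPolynomial (Fin 2) ℂ :=
  (l.map fun α => MvPolynomial.X 0 - MvPolynomial.C (α : ℂ) * MvPolynomial.X 1).prod

/-- The pair `a(x)`, `b(x)` is `Γ`-local, for a subgroup `Γ` of `ℂˣ`. -/
def GammaLocalPair (Γ : Subgroup ℂˣ) (a b : VertexOperator ℂ W) : Prop :=
  ∃ l : List ℂˣ, (∀ α ∈ l, α ∈ Γ) ∧ CommuteUpTo (linearProduct l) a b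

/-- A set of fields is `Γ`-local if all its pairs are. -/
def GammaLocal (Γ : Subgroup ℂˣ) (S : Set (VertexOperator ℂ W)) : Prop :=
  ∀ a ∈ S, ∀ b ∈ S, GammaLocalPair Γ a b

/-! ### The operation `Y_ℰ` -/

/-- The space `Hom(W, W((x₁, x₂)))` inside `(End W)[[x₁^±1, x₂^±1]]`: on every vector, the
exponents of `x₁` and of `x₂` are bounded below. -/
def laurentTwo (W : Type*) [AddCommGroup W] [Module ℂ W] :
    Submodule ℂ (ℤ → ℤ → Module.End ℂ W) where
  carrier := {F | ∀ w, ∃ N : ℤ, ∀ m n : ℤ, (m < N ∨ n < N) → F m n w = 0}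
  zero_mem' w := ⟨0, fun _ _ _ => rfl⟩
  add_mem' {F G} hF hG w := by
    obtain ⟨N, hN⟩ := hF w
    obtain ⟨N', hN'⟩ := hG w
    refine ⟨min N N', fun m n h => ?_⟩
    simp only [Pi.add_apply, LinearMap.add_apply]
    rw [hN m n (by omega), hN' m n (by omega), add_zero]
  smul_mem' c F hF w := by
    obtain ⟨N, hN⟩ := hF w
    refine ⟨N, fun m n h => ?_⟩
    simp only [Pi.smul_apply, LinearMap.smul_apply]
    rw [hN m n h, smul_zero]

lemma CommuteUpTo.mem_laurentTwo {p : MvPolynomial (Fin 2) ℂ} {a b : VertexOperator ℂ W}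
    (h : CommuteUpTo p a b) : polyMul p (prodAB a b) ∈ laurentTwo W := by
  intro w
  obtain ⟨M, hM⟩ := exists_coeff_eq_zero a w
  obtain ⟨N, hN⟩ := exists_coeff_eq_zero b w
  refine ⟨min M N, fun m n hmn => ?_⟩
  rcases hmn with hm | hn
  · rw [h]
    simp only [polyMul, prodBA, LinearMap.sum_apply, LinearMap.smul_apply, Module.End.mul_apply]
    refine Finset.sum_eq_zero fun s _ => ?_
    rw [hM _ (by omega), map_zero, smul_zero]
  · simp only [polyMul, prodAB, LinearMap.sum_apply, LinearMap.smul_apply, Module.End.mul_apply]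
    refine Finset.sum_eq_zero fun s _ => ?_
    rw [hN _ (by omega), map_zero, smul_zero]

lemma polyMul_mem_laurentTwo (p : MvPolynomial (Fin 2) ℂ) {F : ℤ → ℤ → Module.End ℂ W}
    (h : F ∈ laurentTwo W) : polyMul p F ∈ laurentTwo W := by
  intro w
  obtain ⟨N, hN⟩ := h w
  refine ⟨N, fun m n hmn => ?_⟩
  simp only [polyMul, LinearMap.sum_apply, LinearMap.smul_apply]
  refine Finset.sum_eq_zero fun s _ => ?_
  rw [hN _ _ (by omega), smul_zero]

lemma substCoeff_finite (F : laurentTwo W) (k : ℕ) (l : ℤ) (w : W) :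
    (Function.support fun m : ℤ => (Ring.choose m k : ℤ) • F.1 m (l + k - m) w).Finite := by
  obtain ⟨N, hN⟩ := F.2 w
  refine (Set.finite_Icc N (l + k - N)).subset fun m hm => ?_
  by_contra hlt
  refine hm ?_
  have : m < N ∨ l + k - m < N := by
    simp only [Set.mem_Icc, not_and_or, not_le] at hlt
    omega
  simp only [hN _ _ this, smul_zero]

/-- The coefficient of `x₀ ^ k x ^ l` in `F(x + x₀, x)`, where
`(x + x₀) ^ m = ∑_{k ≥ 0} (m choose k) x ^ (m - k) x₀ ^ k` for every integer `m`. -/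
def substCoeff (F : laurentTwo W) (k : ℕ) (l : ℤ) : Module.End ℂ W where
  toFun w := ∑ᶠ m : ℤ, (Ring.choose m k : ℤ) • F.1 m (l + k - m) w
  map_add' w w' := by
    rw [← finsum_add_distrib (substCoeff_finite F k l w) (substCoeff_finite F k l w')]
    simp only [map_add, smul_add]
  map_smul' c w := by
    simp only [map_smul, RingHom.id_apply, smul_finsum]
    simp only [smul_comm c]

/-- The coefficient of `x₀ ^ k` in `F(x + x₀, x)`, an element of `Hom(W, W((x)))`. -/
def substField (F : laurentTwo W) (k : ℕ) : VertexOperator ℂ W :=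
  VertexOperator.of_coeff (substCoeff F k) fun w => by
    obtain ⟨N, hN⟩ := F.2 w
    refine bddBelow_of_forall_lt ⟨2 * N - k, fun l hl => ?_⟩
    refine (finsum_congr fun m => ?_).trans finsum_zero
    rw [hN _ _ (by omega), smul_zero]

/-- The field `ℂ((x))((x₀))`. -/
def IteratedLaurent : Type := HahnSeries ℤ (LaurentSeries ℂ)

instance : Field IteratedLaurent := inferInstanceAs (Field (HahnSeries ℤ (LaurentSeries ℂ)))

/-- The element `f(x) x₀ ^ i` of `ℂ((x))((x₀))`. -/
def IteratedLaurent.single (i : ℤ) (f : LaurentSeries ℂ) : IteratedLaurent :=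
  (HahnSeries.single i f : HahnSeries ℤ (LaurentSeries ℂ))

/-- The embedding of the complex numbers into `ℂ((x))((x₀))`. -/
def IteratedLaurent.const : ℂ →+* IteratedLaurent :=
  (HahnSeries.C : LaurentSeries ℂ →+* HahnSeries ℤ (LaurentSeries ℂ)).comp HahnSeries.C

/-- The space of formal Laurent series in `x₀` with coefficients in `Hom(W, W((x)))`. The latter
is a vector space over `ℂ((x))`, so that such series form a vector space over the field
`ℂ((x))((x₀))`. -/
def FieldSeries (W : Type*) [AddCommGroup W] [Module ℂ W] : Type _ :=
  HahnModule ℤ (LaurentSeries ℂ) (VertexOperator ℂ W)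

instance : AddCommGroup (FieldSeries W) :=
  inferInstanceAs (AddCommGroup (HahnModule ℤ (LaurentSeries ℂ) (VertexOperator ℂ W)))

instance : Module IteratedLaurent (FieldSeries W) :=
  inferInstanceAs (Module (HahnSeries ℤ (LaurentSeries ℂ))
    (HahnModule ℤ (LaurentSeries ℂ) (VertexOperator ℂ W)))

/-- The coefficient of `x₀ ^ k`. -/
def FieldSeries.coeff (G : FieldSeries W) (k : ℤ) : VertexOperator ℂ W :=
  ((HahnModule.of (LaurentSeries ℂ)).symm G).coeff k

/-- The series `F(x + x₀, x)`. -/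
def subst (F : laurentTwo W) : FieldSeries W :=
  HahnModule.of (LaurentSeries ℂ) (HahnSeries.ofSuppBddBelow
    (fun k : ℤ => if 0 ≤ k then substField F k.toNat else 0)
    (bddBelow_of_forall_lt ⟨0, fun k hk => if_neg (by omega)⟩))

/-- `p(x + x₀, x)` as an element of the field `ℂ((x))((x₀))`. The inverse of this element in that
field is `ι_{x,x₀}(1 / p(x + x₀, x))`. -/
def shiftPoly (p : MvPolynomial (Fin 2) ℂ) : IteratedLaurent :=
  MvPolynomial.eval₂Hom IteratedLaurent.const
    ![IteratedLaurent.single 0 (HahnSeries.single 1 1) + IteratedLaurent.single 1 1,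
      IteratedLaurent.single 0 (HahnSeries.single 1 1)] p

/-- `ι_{x,x₀}(1 / p(x + x₀, x)) (p(x₁, x) a(x₁) b(x))|_{x₁ = x + x₀}`. -/
def YEWith (p : MvPolynomial (Fin 2) ℂ) (a b : VertexOperator ℂ W) (h : CommuteUpTo p a b) :
    FieldSeries W :=
  (shiftPoly p)⁻¹ • subst ⟨polyMul p (prodAB a b), h.mem_laurentTwo⟩

/-! #### Independence of the choice of `p` -/

lemma polyMul_eq_sum {M : Type*} [AddCommGroup M] [Module ℂ M] (p : MvPolynomial (Fin 2) ℂ)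
    (F : ℤ → ℤ → M) (t : Finset (Fin 2 →₀ ℕ)) (ht : p.support ⊆ t) (m n : ℤ) :
    polyMul p F m n = ∑ s ∈ t, p.coeff s • F (m - s 0) (n - s 1) := by
  refine Finset.sum_subset ht fun s _ hs => ?_
  rw [MvPolynomial.notMem_support_iff.mp hs, zero_smul]

lemma polyMul_add_left {M : Type*} [AddCommGroup M] [Module ℂ M] (p q : MvPolynomial (Fin 2) ℂ)
    (F : ℤ → ℤ → M) : polyMul (p + q) F = polyMul p F + polyMul q F := by
  classical
  funext m n
  simp only [Pi.add_apply]
  rw [polyMul_eq_sum (p + q) F _ MvPolynomial.support_add,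
    polyMul_eq_sum p F _ (Finset.subset_union_left (s₂ := q.support)),
    polyMul_eq_sum q F _ (Finset.subset_union_right (s₁ := p.support)), ← Finset.sum_add_distrib]
  simp only [MvPolynomial.coeff_add, add_smul]

lemma polyMul_monomial {M : Type*} [AddCommGroup M] [Module ℂ M] (s : Fin 2 →₀ ℕ) (c : ℂ)
    (F : ℤ → ℤ → M) (m n : ℤ) :
    polyMul (MvPolynomial.monomial s c) F m n = c • F (m - s 0) (n - s 1) := by
  classical
  rw [polyMul_eq_sum _ F {s} MvPolynomial.support_monomial_subset]
  simp

lemma polyMul_mul {M : Type*} [AddCommGroup M] [Module ℂ M] (p q : MvPolynomial (Fin 2) ℂ)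
    (F : ℤ → ℤ → M) : polyMul (p * q) F = polyMul p (polyMul q F) := by
  induction p using MvPolynomial.induction_on' with
  | add p₁ p₂ h₁ h₂ => rw [add_mul, polyMul_add_left, polyMul_add_left, h₁, h₂]
  | monomial s c =>
    induction q using MvPolynomial.induction_on' with
    | add q₁ q₂ h₁ h₂ =>
      rw [mul_add, polyMul_add_left, polyMul_add_left, h₁, h₂]
      funext m n
      simp only [Pi.add_apply, polyMul_monomial, smul_add]
    | monomial t d =>
      funext m n
      simp only [MvPolynomial.monomial_mul, polyMul_monomial, Finsupp.add_apply, Nat.cast_add,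
        mul_smul]
      congr 3 <;> ring_nf

lemma coeff_substField (F : laurentTwo W) (k : ℕ) (l : ℤ) :
    coeff (substField F k) l = substCoeff F k l := rfl

lemma coeff_subst (F : laurentTwo W) (k : ℤ) :
    (subst F).coeff k =
      if 0 ≤ k then substField F k.toNat else 0 := rfl

lemma coeff_single_smul (c : ℂ) (i l : ℤ) (a : VertexOperator ℂ W) :
    coeff ((HahnSeries.single i c : LaurentSeries ℂ) • a) l = c • coeff a (l - i) := by
  ext w
  have := HahnModule.coeff_single_smul_vadd (r := c) (x := a w) (a := l - i) (b := i)
  rw [vadd_eq_add, add_sub_cancel] at this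
  exact this

lemma FieldSeries.ext {G H : FieldSeries W} (h : ∀ k, G.coeff k = H.coeff k) : G = H :=
  HahnModule.ext _ _ (funext h)

lemma FieldSeries.coeff_add (G H : FieldSeries W) (k : ℤ) :
    (G + H).coeff k = G.coeff k + H.coeff k := rfl

lemma FieldSeries.coeff_single_smul (f : LaurentSeries ℂ) (i k : ℤ) (G : FieldSeries W) :
    (IteratedLaurent.single i f • G).coeff k =
      f • G.coeff (k - i) := by
  have := HahnModule.coeff_single_smul_vadd (r := f) (a := k - i) (b := i)
    (x := (G : HahnModule ℤ (LaurentSeries ℂ) (VertexOperator ℂ W)))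
  rw [vadd_eq_add, add_sub_cancel] at this
  exact this

/-- The product of `p` with an element of `Hom(W, W((x₁, x₂)))`. -/
def polyAct (p : MvPolynomial (Fin 2) ℂ) (F : laurentTwo W) : laurentTwo W :=
  ⟨polyMul p F.1, polyMul_mem_laurentTwo p F.2⟩

lemma subst_add (F G : laurentTwo W) : subst (F + G) = subst F + subst G := by
  have key : ∀ k : ℕ, substField (F + G) k = substField F k + substField G k := by
    intro k
    refine HVertexOperator.coeff_inj ?_
    funext l
    rw [map_add, Pi.add_apply, coeff_substField, coeff_substField, coeff_substField]
    ext w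
    rw [LinearMap.add_apply]
    refine Eq.trans ?_
      (finsum_add_distrib (substCoeff_finite F k l w) (substCoeff_finite G k l w))
    refine finsum_congr fun m => ?_
    rw [← smul_add]
    rfl
  refine FieldSeries.ext fun k => ?_
  rw [FieldSeries.coeff_add, coeff_subst, coeff_subst, coeff_subst]
  split_ifs
  · exact key _
  · rw [add_zero]

lemma subst_C (c : ℂ) (F : laurentTwo W) :
    subst (polyAct (MvPolynomial.C c) F) = shiftPoly (MvPolynomial.C c) • subst F := by
  have hC : shiftPoly (MvPolynomial.C c) =
      IteratedLaurent.single 0 (HahnSeries.single 0 c) := by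
    rw [shiftPoly, MvPolynomial.coe_eval₂Hom, MvPolynomial.eval₂_C]
    rfl
  rw [hC]
  refine FieldSeries.ext fun k => ?_
  rw [FieldSeries.coeff_single_smul, coeff_subst, coeff_subst, sub_zero]
  split_ifs
  · refine HVertexOperator.coeff_inj ?_
    funext l
    rw [coeff_single_smul, sub_zero, coeff_substField, coeff_substField]
    ext w
    rw [LinearMap.smul_apply]
    refine Eq.trans ?_ (smul_finsum c _).symm
    refine finsum_congr fun m => ?_
    rw [smul_comm c]
    congr 1
    change polyMul (MvPolynomial.monomial 0 c) F.1 _ _ w = _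
    rw [polyMul_monomial]
    simp
  · rw [smul_zero]

lemma polyAct_X_zero (F : laurentTwo W) (m n : ℤ) :
    (polyAct (MvPolynomial.X 0) F).1 m n = F.1 (m - 1) n := by
  change polyMul (MvPolynomial.monomial (Finsupp.single 0 1) 1) F.1 m n = _
  rw [polyMul_monomial]
  simp

lemma polyAct_X_one (F : laurentTwo W) (m n : ℤ) :
    (polyAct (MvPolynomial.X 1) F).1 m n = F.1 m (n - 1) := by
  change polyMul (MvPolynomial.monomial (Finsupp.single 1 1) 1) F.1 m n = _
  rw [polyMul_monomial]
  simp

lemma subst_X_one (F : laurentTwo W) :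
    subst (polyAct (MvPolynomial.X 1) F) =
      (IteratedLaurent.single 0 (HahnSeries.single 1 1)) • subst F := by
  refine FieldSeries.ext fun k => ?_
  rw [FieldSeries.coeff_single_smul, coeff_subst, coeff_subst, sub_zero]
  split_ifs
  · refine HVertexOperator.coeff_inj ?_
    funext l
    rw [coeff_single_smul, one_smul, coeff_substField, coeff_substField]
    ext w
    refine finsum_congr fun m => ?_
    rw [polyAct_X_one]
    congr 3
    ring_nf
  · rw [smul_zero]

lemma subst_X_zero (F : laurentTwo W) :
    subst (polyAct (MvPolynomial.X 0) F) =
      (IteratedLaurent.single 0 (HahnSeries.single 1 1) +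
        IteratedLaurent.single 1 1) • subst F := by
  rw [add_smul]
  refine FieldSeries.ext fun k => ?_
  rw [FieldSeries.coeff_add, FieldSeries.coeff_single_smul, FieldSeries.coeff_single_smul,
    one_smul, sub_zero, coeff_subst, coeff_subst, coeff_subst]
  have reindex : ∀ (k : ℕ) (l : ℤ) (w : W), substCoeff (polyAct (MvPolynomial.X 0) F) k l w =
      ∑ᶠ m : ℤ, (Ring.choose (m + 1) k : ℤ) • F.1 m (l - 1 + k - m) w := by
    intro k l w
    refine Eq.trans (finsum_comp_equiv (Equiv.addRight (1 : ℤ))).symm (finsum_congr fun m => ?_)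
    rw [polyAct_X_zero]
    simp only [Equiv.coe_addRight, add_sub_cancel_right]
    congr 3
    ring_nf
  rcases lt_trichotomy k 0 with hk | hk | hk
  · rw [if_neg (by omega), if_neg (by omega), smul_zero, zero_add,
      if_neg (by omega)]
  · subst hk
    rw [if_pos le_rfl, if_pos le_rfl, if_neg (by omega), add_zero]
    refine HVertexOperator.coeff_inj ?_
    funext l
    rw [coeff_single_smul, one_smul, coeff_substField, coeff_substField]
    ext w
    rw [reindex]
    refine finsum_congr fun m => ?_
    simp
  · obtain ⟨k, rfl⟩ : ∃ r : ℕ, k = r + 1 := ⟨(k - 1).toNat, by omega⟩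
    rw [if_pos (by omega), if_pos (by omega), if_pos (by omega)]
    have h1 : ((k : ℤ) + 1).toNat = k + 1 := by omega
    have h2 : ((k : ℤ) + 1 - 1).toNat = k := by omega
    rw [h1, h2]
    refine HVertexOperator.coeff_inj ?_
    funext l
    rw [map_add, Pi.add_apply, coeff_single_smul, one_smul, coeff_substField, coeff_substField,
      coeff_substField]
    ext w
    rw [reindex, LinearMap.add_apply]
    refine Eq.trans ?_ (finsum_add_distrib (substCoeff_finite F (k + 1) (l - 1) w)
      (substCoeff_finite F k l w))
    refine finsum_congr fun m => ?_
    rw [Ring.choose_succ_succ, add_smul, add_comm]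
    congr 4
    push_cast
    ring_nf

lemma shiftPoly_X_zero : shiftPoly (MvPolynomial.X 0) =
    IteratedLaurent.single 0 (HahnSeries.single 1 1) +
      IteratedLaurent.single 1 1 := by
  rw [shiftPoly, MvPolynomial.coe_eval₂Hom, MvPolynomial.eval₂_X]
  rfl

lemma shiftPoly_X_one : shiftPoly (MvPolynomial.X 1) =
    IteratedLaurent.single 0 (HahnSeries.single 1 1) := by
  rw [shiftPoly, MvPolynomial.coe_eval₂Hom, MvPolynomial.eval₂_X]
  rfl

lemma subst_polyAct (q : MvPolynomial (Fin 2) ℂ) (F : laurentTwo W) :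
    subst (polyAct q F) = shiftPoly q • subst F := by
  induction q using MvPolynomial.induction_on generalizing F with
  | C c => exact subst_C c F
  | add p q hp hq =>
    have h : polyAct (p + q) F = polyAct p F + polyAct q F :=
      Subtype.ext (polyMul_add_left p q F.1)
    rw [h, subst_add, hp, hq, ← add_smul, shiftPoly, shiftPoly, shiftPoly,
      map_add]
  | mul_X p i hp =>
    have h : polyAct (p * MvPolynomial.X i) F = polyAct p (polyAct (MvPolynomial.X i) F) :=
      Subtype.ext (polyMul_mul p _ F.1)
    have h2 : shiftPoly (p * MvPolynomial.X i) = shiftPoly p * shiftPoly (MvPolynomial.X i) := by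
      rw [shiftPoly, map_mul]
      rfl
    rw [h, hp, h2, mul_smul]
    congr 1
    fin_cases i
    · exact (subst_X_zero F).trans (by rw [← shiftPoly_X_zero]; rfl)
    · exact (subst_X_one F).trans (by rw [← shiftPoly_X_one]; rfl)

lemma shiftPoly_ne_zero {p : MvPolynomial (Fin 2) ℂ} (hp : p ≠ 0) : shiftPoly p ≠ 0 := by
  classical
  let T : MvPolynomial (Fin 2) ℂ →ₐ[ℂ] MvPolynomial (Fin 2) ℂ :=
    MvPolynomial.aeval ![MvPolynomial.X 1 + MvPolynomial.X 0, MvPolynomial.X 1]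
  let T' : MvPolynomial (Fin 2) ℂ →ₐ[ℂ] MvPolynomial (Fin 2) ℂ :=
    MvPolynomial.aeval ![MvPolynomial.X 0 - MvPolynomial.X 1, MvPolynomial.X 1]
  let E : MvPolynomial (Fin 2) ℂ →+* IteratedLaurent :=
    MvPolynomial.eval₂Hom IteratedLaurent.const
      ![IteratedLaurent.single 1 1, IteratedLaurent.single 0 (HahnSeries.single 1 1)]
  have hT : T'.comp T = AlgHom.id ℂ _ := by
    refine MvPolynomial.algHom_ext fun i => ?_
    fin_cases i <;> simp [T, T']
  have hE : ∀ q, E (T q) = shiftPoly q := by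
    intro q
    have : E.comp T.toRingHom = MvPolynomial.eval₂Hom IteratedLaurent.const
        ![IteratedLaurent.single 0 (HahnSeries.single 1 1) + IteratedLaurent.single 1 1,
          IteratedLaurent.single 0 (HahnSeries.single 1 1)] := by
      refine MvPolynomial.ringHom_ext (fun c => ?_) fun i => ?_
      · simp [T, E]
      · fin_cases i <;> simp [T, E]
    exact DFunLike.congr_fun this q
  have hcoeff : ∀ (q : MvPolynomial (Fin 2) ℂ) (s : Fin 2 →₀ ℕ),
      ((E q : HahnSeries ℤ (LaurentSeries ℂ)).coeff (s 0)).coeff (s 1) = q.coeff s := by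
    intro q s
    induction q using MvPolynomial.induction_on' with
    | add q₁ q₂ h₁ h₂ =>
      rw [map_add, MvPolynomial.coeff_add, ← h₁, ← h₂]
      rfl
    | monomial t c =>
      have h1 : E (MvPolynomial.monomial t c) =
          IteratedLaurent.single (t 0) (HahnSeries.single (t 1 : ℤ) c) := by
        simp only [E, MvPolynomial.coe_eval₂Hom, MvPolynomial.eval₂_monomial]
        rw [Finsupp.prod_fintype _ _ (by simp), Fin.prod_univ_two]
        change (HahnSeries.single (0 : ℤ) (HahnSeries.single (0 : ℤ) c) *
          ((HahnSeries.single (1 : ℤ) (1 : LaurentSeries ℂ)) ^ (t 0) *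
            (HahnSeries.single (0 : ℤ) (HahnSeries.single (1 : ℤ) (1 : ℂ))) ^ (t 1)) :
            HahnSeries ℤ (LaurentSeries ℂ)) = HahnSeries.single (t 0 : ℤ) _
        simp [HahnSeries.single_pow, HahnSeries.single_mul_single]
      rw [h1, MvPolynomial.coeff_monomial, IteratedLaurent.single]
      by_cases h : t = s
      · subst h
        simp
      · rw [if_neg h]
        by_cases h0 : t 0 = s 0
        · have h3 : t 1 ≠ s 1 := fun h4 => h (by ext i; fin_cases i <;> assumption)
          rw [h0, HahnSeries.coeff_single_same, HahnSeries.coeff_single_of_ne]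
          exact_mod_cast h3.symm
        · rw [HahnSeries.coeff_single_of_ne (by exact_mod_cast (Ne.symm h0))]
          rfl
  intro h0
  have hTp : T p = 0 := by
    ext s
    rw [← hcoeff, hE, h0]
    rfl
  refine hp ?_
  have := DFunLike.congr_fun hT p
  rw [AlgHom.comp_apply, hTp, map_zero] at this
  exact this.symm

lemma YEWith_eq {p q : MvPolynomial (Fin 2) ℂ} {a b : VertexOperator ℂ W} (hp : p ≠ 0)
    (hq : q ≠ 0) (h : CommuteUpTo p a b) (h' : CommuteUpTo q a b) :
    YEWith p a b h = YEWith q a b h' := by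
  have key : shiftPoly q • subst ⟨polyMul p (prodAB a b), h.mem_laurentTwo⟩ =
      shiftPoly p • subst ⟨polyMul q (prodAB a b), h'.mem_laurentTwo⟩ := by
    rw [← subst_polyAct, ← subst_polyAct]
    congr 1
    refine Subtype.ext ?_
    change polyMul q (polyMul p _) = polyMul p (polyMul q _)
    rw [← polyMul_mul, ← polyMul_mul, mul_comm]
  have hp' := shiftPoly_ne_zero hp
  have hq' := shiftPoly_ne_zero hq
  rw [YEWith, YEWith, inv_smul_eq_iff₀ hp', smul_comm, ← key, inv_smul_smul₀ hq']

open Classical in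
/-- `Y_ℰ(a(x), x₀) b(x)` for a quasi-local pair `a(x)`, `b(x)` (and zero for other pairs). The
choice of `p` does not matter, see `YE_eq`. -/
def YE (a b : VertexOperator ℂ W) : FieldSeries W :=
  if h : QuasiLocalPair a b then YEWith h.choose a b h.choose_spec.2 else 0

lemma YE_eq {p : MvPolynomial (Fin 2) ℂ} {a b : VertexOperator ℂ W} (hp : p ≠ 0)
    (h : CommuteUpTo p a b) : YE a b = YEWith p a b h := by
  have hq : QuasiLocalPair a b := ⟨p, hp, h⟩
  rw [YE, dif_pos hq]
  exact YEWith_eq hq.choose_spec.1 hp _ h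

/-- The product `a(x)_n b(x)`, the coefficient of `x₀ ^ (-n - 1)` in `Y_ℰ(a(x), x₀) b(x)`. -/
def nthProd (a b : VertexOperator ℂ W) (n : ℤ) : VertexOperator ℂ W :=
  (YE a b).coeff (-n - 1)

/-- A subspace of `Hom(W, W((x)))` is closed if it is quasi-local and closed under all the
products `a(x)_n b(x)`. -/
def ClosedSubspace (U : Submodule ℂ (VertexOperator ℂ W)) : Prop :=
  QuasiLocal (U : Set (VertexOperator ℂ W)) ∧
    ∀ a ∈ U, ∀ b ∈ U, ∀ n : ℤ, nthProd a b n ∈ U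

end Fields

/-! ### Vertex algebras, `Γ`-vertex algebras and quasimodules -/

section Algebras

/-- The coefficient of `x₀ ^ (-n - 1) x₁ ^ j x₂ ^ k` in
`x₀⁻¹ δ((x₁ - x₂) / x₀) a(x₁) b(x₂) w`, where
`x₀⁻¹ δ((x₁ - x₂) / x₀) = ∑_n x₀ ^ (-n - 1) (x₁ - x₂) ^ n` and `(x₁ - x₂) ^ n` is expanded in
nonnegative powers of `x₂`. The sum is finite. -/
def jacobiOne {W : Type*} [AddCommGroup W] [Module ℂ W] (a b : VertexOperator ℂ W) (w : W)
    (n : ℤ) : ℤ → ℤ → W := fun j k =>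
  ∑ᶠ s : ℕ, ((-1) ^ s * Ring.choose n s : ℤ) • coeff a (j - n + s) (coeff b (k - s) w)

/-- The coefficient of `x₀ ^ (-n - 1) x₁ ^ j x₂ ^ k` in
`x₀⁻¹ δ((x₂ - x₁) / (-x₀)) b(x₂) a(x₁) w`, where
`x₀⁻¹ δ((x₂ - x₁) / (-x₀)) = ∑_n (-1) ^ n x₀ ^ (-n - 1) (x₂ - x₁) ^ n` and `(x₂ - x₁) ^ n` is
expanded in nonnegative powers of `x₁`. The sum is finite. -/
def jacobiTwo {W : Type*} [AddCommGroup W] [Module ℂ W] (a b : VertexOperator ℂ W) (w : W)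
    (n : ℤ) : ℤ → ℤ → W := fun j k =>
  ∑ᶠ s : ℕ, ((n.negOnePow : ℤ) * ((-1) ^ s * Ring.choose n s)) •
    coeff b (k - n + s) (coeff a (j - s) w)

/-- The coefficient of `x₀ ^ (-n - 1) x₁ ^ j x₂ ^ k` in
`x₂⁻¹ δ((x₁ - x₀) / x₂) Y_W(Y(u, x₀) v, x₂) w`, where
`x₂⁻¹ δ((x₁ - x₀) / x₂) = ∑_r x₂ ^ (-r - 1) (x₁ - x₀) ^ r` and `(x₁ - x₀) ^ r` is expanded in
nonnegative powers of `x₀`. The sum is finite. -/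
def jacobiThree {V W : Type*} [AddCommGroup V] [Module ℂ V] [AddCommGroup W] [Module ℂ W]
    (Y : V →ₗ[ℂ] VertexOperator ℂ V) (YW : V →ₗ[ℂ] VertexOperator ℂ W) (u v : V) (w : W)
    (n : ℤ) : ℤ → ℤ → W := fun j k =>
  ∑ᶠ s : ℕ, ((-1) ^ s * Ring.choose (j + s) s : ℤ) •
    coeff (YW (VertexOperator.ncoeff (Y u) (n + s) v)) (j + k + s + 1) w

/-- The Jacobi identity for `u`, `v`, with the factor `p(x₁, x₂)` on all three terms. -/
def QuasiJacobi {V W : Type*} [AddCommGroup V] [Module ℂ V] [AddCommGroup W] [Module ℂ W]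
    (Y : V →ₗ[ℂ] VertexOperator ℂ V) (YW : V →ₗ[ℂ] VertexOperator ℂ W)
    (p : MvPolynomial (Fin 2) ℂ) (u v : V) : Prop :=
  ∀ (w : W) (n : ℤ),
    polyMul p (jacobiOne (YW u) (YW v) w n) - polyMul p (jacobiTwo (YW u) (YW v) w n) =
      polyMul p (jacobiThree Y YW u v w n)

/-- A vertex algebra structure on a complex vector space `V`: a vacuum vector and a linear map
`Y : V → Hom(V, V((x)))` with the vacuum, creation and Jacobi properties. -/
structure VertexAlgebra (V : Type*) [AddCommGroup V] [Module ℂ V] where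
  vac : V
  Y : V →ₗ[ℂ] VertexOperator ℂ V
  Y_vac : Y vac = idField V
  creation_regular : ∀ (v : V) (n : ℤ), n < 0 → coeff (Y v) n vac = 0
  creation_limit : ∀ v : V, coeff (Y v) 0 vac = v
  jacobi : ∀ (u v w : V) (n j k : ℤ),
    jacobiOne (Y u) (Y v) w n j k - jacobiTwo (Y u) (Y v) w n j k = jacobiThree Y Y u v w n j k

/-- A quasimodule structure on `W` for a vertex algebra. -/
structure VertexAlgebra.Quasimodule {V : Type*} [AddCommGroup V] [Module ℂ V]
    (A : VertexAlgebra V) (W : Type*) [AddCommGroup W] [Module ℂ W] where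
  YW : V →ₗ[ℂ] VertexOperator ℂ W
  YW_vac : YW A.vac = idField W
  quasiJacobi : ∀ u v : V, ∃ p : MvPolynomial (Fin 2) ℂ, p ≠ 0 ∧ QuasiJacobi A.Y YW p u v

/-- A `G`-vertex algebra structure on `V`: a vertex algebra with homomorphisms `R : G → GL(V)` and
`φ : G → ℂˣ` such that `R_g 1 = 1` and `R_g Y(v, x) R_g⁻¹ = Y(R_g v, φ(g)⁻¹ x)`. -/
structure GammaVertexAlgebra (G : Type*) [Group G] (V : Type*) [AddCommGroup V] [Module ℂ V]
    extends VertexAlgebra V where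
  R : G →* LinearMap.GeneralLinearGroup ℂ V
  φ : G →* ℂˣ
  R_vac : ∀ g : G, (R g : V →ₗ[ℂ] V) vac = vac
  R_conj : ∀ (g : G) (v : V) (n : ℤ),
    (R g : Module.End ℂ V) * coeff (Y v) n * ((R g)⁻¹ : LinearMap.GeneralLinearGroup ℂ V) =
      coeff (rescale (φ g)⁻¹ (Y ((R g : V →ₗ[ℂ] V) v))) n

/-- A quasimodule structure on `W` for a `G`-vertex algebra. -/
structure GammaVertexAlgebra.Quasimodule {G : Type*} [Group G] {V : Type*} [AddCommGroup V]
    [Module ℂ V] (A : GammaVertexAlgebra G V) (W : Type*) [AddCommGroup W] [Module ℂ W]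
    extends A.toVertexAlgebra.Quasimodule W where
  equivariant : ∀ (g : G) (v : V), YW ((A.R g : V →ₗ[ℂ] V) v) = rescale (A.φ g) (YW v)
  gammaLocal : ∀ u v : V, GammaLocalPair A.φ.range (YW u) (YW v)

end Algebras

end

end GammaVA

/-! `Y_ℰ(a, x₀) b` is the substitution `x₁ = x + x₀` in `a(x₁) b(x)`, which makes sense once a
product of linear forms has truncated the series. `IsSubst F Z` records this relation, and it
determines `Z`: a nonzero linear form annihilates no nonzero series whose exponents of `x₀` are
bounded below. Hence identities for `Y_ℰ` follow by multiplying with enough linear forms, comparing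
substitutions in a truncated series, and cancelling (`isSubst_YE`, `YE_coeff_eq`).

Closed spaces come from Zorn's lemma. Sums, multiples, `1_W`, rescalings and, by Dong's lemma
(`GammaLocalPair.YE_coeff_left`), the products `a_n b` remain `Γ`-local with every field that the
original fields are `Γ`-local with. A maximal `Γ`-local set therefore contains them all. The
smallest closed space is an intersection.

For the vertex algebra, `a(x₁) b(x₂) c(x₃) w` times the locality factors of all three pairs is a
series `A` truncated in all variables. Up to the shifted factors, `Y(a, x₁) Y(b, x₂) c` and `Y(b,
x₂) Y(a, x₁) c` are both `A(x + x₁, x + x₂, x)`, and `Y(Y(a, x₀) b, x₂) c` is `A(x + x₂ + x₀, x +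
x₂, x)`. A factor `x₁ - α x₂` turns into `x₁ - α x₂ + (1 - α) x`, which cancels unless `α = 1`. So
the operators `Y(a, x)` on `V` are local in the ordinary sense, although the fields on `W` are only
`Γ`-local (`op3_iterYE_eq_swap`). In the comparison with the iterate every factor cancels, and `a ↦
Y(a, x)` carries the products of `V` to those of `ℰ(V)` (`eq_nestedYE`, `FieldAlgebra.YE_Y_coeff`).

The Jacobi identity comes from the delta function identity for truncated series
(`deltaOne_sub_deltaTwo`), which yields it up to the locality factors (`op2_jacobi`). On `W` this is
the quasimodule axiom. On `V` all factors are `x₁ - x₂`, which merely shift the power of `x₀`, and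
so they can be removed. -/

namespace GammaVA

open HVertexOperator

noncomputable section

set_option linter.unusedSectionVars false

/-! ### Two variables: linear forms and the substitution `x₁ = x + x₀`. -/

section TwoVariables

variable {M M' : Type*} [AddCommGroup M] [Module ℂ M] [AddCommGroup M'] [Module ℂ M']

/-- Multiplication of a formal series in two variables by the linear form `c x₁ + d x₂`. -/
def lin2 (c : ℂ × ℂ) : Module.End ℂ (ℤ → ℤ → M) where
  toFun F m n := c.1 • F (m - 1) n + c.2 • F m (n - 1)
  map_add' F G := by
    funext m n
    simp only [Pi.add_apply]
    module
  map_smul' r F := by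
    funext m n
    simp only [Pi.smul_apply, RingHom.id_apply]
    module

lemma lin2_apply (c : ℂ × ℂ) (F : ℤ → ℤ → M) (m n : ℤ) :
    lin2 c F m n = c.1 • F (m - 1) n + c.2 • F m (n - 1) := rfl

lemma lin2_comm (c d : ℂ × ℂ) : Commute (lin2 c : Module.End ℂ (ℤ → ℤ → M)) (lin2 d) := by
  refine LinearMap.ext fun F => ?_
  funext m n
  simp only [Module.End.mul_apply, lin2_apply]
  module

/-- Multiplication of a formal series in two variables by a product of linear forms. -/
def op2 (L : List (ℂ × ℂ)) : Module.End ℂ (ℤ → ℤ → M) := (L.map lin2).prod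

@[simp] lemma op2_nil (F : ℤ → ℤ → M) : op2 [] F = F := rfl

lemma op2_cons (c : ℂ × ℂ) (L : List (ℂ × ℂ)) (F : ℤ → ℤ → M) :
    op2 (c :: L) F = lin2 c (op2 L F) := by
  simp [op2]

lemma op2_append (L L' : List (ℂ × ℂ)) (F : ℤ → ℤ → M) :
    op2 (L ++ L') F = op2 L (op2 L' F) := by
  simp [op2]

lemma lin2_op2 (c : ℂ × ℂ) (L : List (ℂ × ℂ)) (F : ℤ → ℤ → M) :
    lin2 c (op2 L F) = op2 L (lin2 c F) := by
  induction L with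
  | nil => rfl
  | cons d L ih =>
    rw [op2_cons, op2_cons, ← ih]
    exact LinearMap.congr_fun (lin2_comm c d) _

lemma op2_comm (L L' : List (ℂ × ℂ)) (F : ℤ → ℤ → M) :
    op2 L (op2 L' F) = op2 L' (op2 L F) := by
  induction L with
  | nil => rfl
  | cons d L ih => rw [op2_cons, op2_cons, ih, lin2_op2]

lemma op2_map (f : M →ₗ[ℂ] M') (L : List (ℂ × ℂ)) (F : ℤ → ℤ → M) :
    op2 L (fun m n => f (F m n)) = fun m n => f (op2 L F m n) := by
  induction L with
  | nil => rfl
  | cons d L ih =>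
    rw [op2_cons, op2_cons, ih]
    funext m n
    simp [lin2_apply]

/-- Both exponents are bounded below. -/
def Truncated (F : ℤ → ℤ → M) : Prop := ∃ N : ℤ, ∀ m n, m < N ∨ n < N → F m n = 0

lemma Truncated.add {F G : ℤ → ℤ → M} (hF : Truncated F) (hG : Truncated G) :
    Truncated (F + G) := by
  obtain ⟨N, hN⟩ := hF
  obtain ⟨N', hN'⟩ := hG
  refine ⟨min N N', fun m n h => ?_⟩
  rw [Pi.add_apply, Pi.add_apply, hN m n (by omega), hN' m n (by omega), add_zero]

lemma Truncated.smul {F : ℤ → ℤ → M} (c : ℂ) (hF : Truncated F) : Truncated (c • F) := by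
  obtain ⟨N, hN⟩ := hF
  exact ⟨N, fun m n h => by rw [Pi.smul_apply, Pi.smul_apply, hN m n h, smul_zero]⟩

lemma Truncated.map {F : ℤ → ℤ → M} (f : M →ₗ[ℂ] M') (hF : Truncated F) :
    Truncated fun m n => f (F m n) := by
  obtain ⟨N, hN⟩ := hF
  exact ⟨N, fun m n h => by simp only [hN m n h, map_zero]⟩

lemma Truncated.lin2 {F : ℤ → ℤ → M} (c : ℂ × ℂ) (hF : Truncated F) : Truncated (lin2 c F) := by
  obtain ⟨N, hN⟩ := hF
  refine ⟨N, fun m n h => ?_⟩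
  rw [lin2_apply, hN _ _ (by omega), hN _ _ (by omega), smul_zero, smul_zero, add_zero]

lemma Truncated.op2 {F : ℤ → ℤ → M} (L : List (ℂ × ℂ)) (hF : Truncated F) :
    Truncated (op2 L F) := by
  induction L with
  | nil => exact hF
  | cons d L ih => rw [op2_cons]; exact ih.lin2 d

/-- The binomial coefficient with integer lower entry, which vanishes for negative ones. -/
def ichoose (m k : ℤ) : ℤ := if 0 ≤ k then Ring.choose m k.toNat else 0

lemma ichoose_natCast (m : ℤ) (k : ℕ) : ichoose m k = Ring.choose m k := by
  simp [ichoose]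

lemma ichoose_of_neg (m : ℤ) {k : ℤ} (hk : k < 0) : ichoose m k = 0 := if_neg (by omega)

lemma ichoose_zero_right (m : ℤ) : ichoose m 0 = 1 := by simp [ichoose]

lemma ichoose_succ (m k : ℤ) : ichoose (m + 1) k = ichoose m k + ichoose m (k - 1) := by
  rcases lt_trichotomy k 0 with hk | rfl | hk
  · rw [ichoose_of_neg _ hk, ichoose_of_neg _ hk, ichoose_of_neg _ (by omega), add_zero]
  · rw [ichoose_zero_right, ichoose_zero_right, ichoose_of_neg _ (by omega), add_zero]
  · obtain ⟨k, rfl⟩ : ∃ r : ℕ, k = r + 1 := ⟨(k - 1).toNat, by omega⟩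
    rw [add_sub_cancel_right, ← Nat.cast_succ, ichoose_natCast, ichoose_natCast, ichoose_natCast,
      Ring.choose_succ_succ, add_comm]

/-- The coefficient of `x₀ ^ k x ^ l` in `F(x + x₀, x)`. -/
def taylorSubst (F : ℤ → ℤ → M) (k l : ℤ) : M := ∑ᶠ m : ℤ, ichoose m k • F m (l + k - m)

lemma taylorSubst_eq_sum {F : ℤ → ℤ → M} {k l : ℤ} {s : Finset ℤ}
    (hs : ∀ m ∉ s, F m (l + k - m) = 0) :
    taylorSubst F k l = ∑ m ∈ s, ichoose m k • F m (l + k - m) := by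
  refine finsum_eq_sum_of_support_subset _ fun m hm => ?_
  by_contra h
  refine hm ?_
  change ichoose m k • F m (l + k - m) = 0
  rw [hs m h, smul_zero]

lemma taylorSubst_of_neg (F : ℤ → ℤ → M) {k : ℤ} (hk : k < 0) (l : ℤ) : taylorSubst F k l = 0 := by
  simp [taylorSubst, ichoose_of_neg _ hk]

lemma taylorSubst_finite {F : ℤ → ℤ → M} (hF : Truncated F) (k l : ℤ) :
    (Function.support fun m : ℤ => ichoose m k • F m (l + k - m)).Finite := by
  obtain ⟨N, hN⟩ := hF
  refine (Set.finite_Icc N (l + k - N)).subset fun m hm => ?_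
  by_contra h
  refine hm ?_
  rw [Set.mem_Icc] at h
  change ichoose m k • F m (l + k - m) = 0
  rw [hN _ _ (by omega), smul_zero]

lemma taylorSubst_add {F G : ℤ → ℤ → M} (hF : Truncated F) (hG : Truncated G) :
    taylorSubst (F + G) = taylorSubst F + taylorSubst G := by
  funext k l
  refine Eq.trans (finsum_congr fun m => ?_)
    (finsum_add_distrib (taylorSubst_finite hF k l) (taylorSubst_finite hG k l))
  rw [← smul_add]
  rfl

lemma taylorSubst_smul (c : ℂ) (F : ℤ → ℤ → M) :
    taylorSubst (c • F) = c • taylorSubst F := by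
  funext k l
  refine Eq.trans (finsum_congr fun m => ?_) (smul_finsum c _).symm
  rw [smul_comm c]
  rfl

lemma taylorSubst_map (f : M →ₗ[ℂ] M') {F : ℤ → ℤ → M} (hF : Truncated F) :
    taylorSubst (fun m n => f (F m n)) = fun k l => f (taylorSubst F k l) := by
  funext k l
  rw [taylorSubst, taylorSubst, ← LinearMap.toAddMonoidHom_coe,
    AddMonoidHom.map_finsum _ (taylorSubst_finite hF k l)]
  simp

lemma taylorSubst_shift_snd (F : ℤ → ℤ → M) (k l : ℤ) :
    taylorSubst (fun m n => F m (n - 1)) k l = taylorSubst F k (l - 1) := by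
  refine finsum_congr fun m => ?_
  rw [show l - 1 + k - m = l + k - m - 1 by ring]

/-- Pascal's rule, in the form that `x₁` becomes `x + x₀`. -/
lemma taylorSubst_shift_fst {F : ℤ → ℤ → M} (hF : Truncated F) (k l : ℤ) :
    taylorSubst (fun m n => F (m - 1) n) k l =
      taylorSubst F (k - 1) l + taylorSubst F k (l - 1) := by
  refine Eq.trans (finsum_comp_equiv (Equiv.addRight (1 : ℤ))).symm ?_
  refine Eq.trans (finsum_congr fun m => ?_)
    (finsum_add_distrib (taylorSubst_finite hF (k - 1) l) (taylorSubst_finite hF k (l - 1)))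
  simp only [Equiv.coe_addRight, add_sub_cancel_right, ichoose_succ, add_smul]
  rw [add_comm]
  congr 3 <;> omega

/-- The effect of `x₁ ↦ x + x₀`, `x₂ ↦ x` on linear forms; the variables of the result are
`x₀`, `x`. -/
def shiftForm (c : ℂ × ℂ) : ℂ × ℂ := (c.1, c.1 + c.2)

lemma shiftForm_ne_zero {c : ℂ × ℂ} (hc : c ≠ 0) : shiftForm c ≠ 0 := by
  intro h
  simp only [shiftForm, Prod.mk_eq_zero] at h
  exact hc (Prod.ext h.1 (by simpa [h.1] using h.2))

lemma taylorSubst_lin2 (c : ℂ × ℂ) {F : ℤ → ℤ → M} (hF : Truncated F) :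
    taylorSubst (lin2 c F) = lin2 (shiftForm c) (taylorSubst F) := by
  have h1 : Truncated fun m n => F (m - 1) n := by
    obtain ⟨N, hN⟩ := hF
    exact ⟨N, fun m n h => hN _ _ (by omega)⟩
  have h2 : Truncated fun m n => F m (n - 1) := by
    obtain ⟨N, hN⟩ := hF
    exact ⟨N, fun m n h => hN _ _ (by omega)⟩
  have h3 : lin2 c F = c.1 • (fun m n => F (m - 1) n) + c.2 • fun m n => F m (n - 1) := rfl
  rw [h3, taylorSubst_add (h1.smul _) (h2.smul _), taylorSubst_smul, taylorSubst_smul]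
  funext k l
  simp only [Pi.add_apply, Pi.smul_apply, taylorSubst_shift_fst hF, taylorSubst_shift_snd,
    lin2_apply, shiftForm]
  module

lemma taylorSubst_op2 (L : List (ℂ × ℂ)) {F : ℤ → ℤ → M} (hF : Truncated F) :
    taylorSubst (op2 L F) = op2 (L.map shiftForm) (taylorSubst F) := by
  induction L with
  | nil => rfl
  | cons c L ih => rw [List.map_cons, op2_cons, op2_cons, taylorSubst_lin2 c (hF.op2 L), ih]

/-- The exponents of the first variable are bounded below. -/
def FstBounded (Z : ℤ → ℤ → M) : Prop := ∃ N : ℤ, ∀ k < N, Z k = 0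

lemma FstBounded.add {F G : ℤ → ℤ → M} (hF : FstBounded F) (hG : FstBounded G) :
    FstBounded (F + G) := by
  obtain ⟨N, hN⟩ := hF
  obtain ⟨N', hN'⟩ := hG
  exact ⟨min N N', fun m h => by
    rw [Pi.add_apply, hN m (by omega), hN' m (by omega), add_zero]⟩

lemma FstBounded.smul {F : ℤ → ℤ → M} (c : ℂ) (hF : FstBounded F) : FstBounded (c • F) := by
  obtain ⟨N, hN⟩ := hF
  exact ⟨N, fun m h => by rw [Pi.smul_apply, hN m h, smul_zero]⟩

lemma FstBounded.lin2 {F : ℤ → ℤ → M} (c : ℂ × ℂ) (hF : FstBounded F) :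
    FstBounded (lin2 c F) := by
  obtain ⟨N, hN⟩ := hF
  refine ⟨N, fun m h => funext fun n => ?_⟩
  rw [lin2_apply, hN _ h, hN (m - 1) (by omega)]
  simp

lemma FstBounded.op2 {F : ℤ → ℤ → M} (L : List (ℂ × ℂ)) (hF : FstBounded F) :
    FstBounded (op2 L F) := by
  induction L with
  | nil => exact hF
  | cons d L ih => rw [op2_cons]; exact ih.lin2 d

/-- If the form involves the second variable, vanishing of `Z (k - 1)` forces that of `Z k`, and
induction starts below the lowest exponent. Otherwise the form is a multiple of the first variable,
whose action is an invertible shift. -/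
lemma FstBounded.eq_zero_of_lin2 {Z : ℤ → ℤ → M} (hZ : FstBounded Z) {c : ℂ × ℂ} (hc : c ≠ 0)
    (h : GammaVA.lin2 c Z = 0) : Z = 0 := by
  obtain ⟨N, hN⟩ := hZ
  have h' : ∀ k l, c.1 • Z (k - 1) l + c.2 • Z k (l - 1) = 0 := fun k l =>
    congrFun (congrFun h k) l
  by_cases h2 : c.2 = 0
  · have h1 : c.1 ≠ 0 := fun h1 => hc (Prod.ext h1 h2)
    funext k l
    have := h' (k + 1) l
    rw [h2, zero_smul, add_zero, add_sub_cancel_right] at this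
    exact (smul_eq_zero.mp this).resolve_left h1
  · have key : ∀ r : ℕ, ∀ k < N + r, Z k = 0 := by
      intro r
      induction r with
      | zero => simpa using hN
      | succ r ih =>
        intro k hk
        funext l
        have := h' k (l + 1)
        rw [ih (k - 1) (by push_cast at hk; omega), add_sub_cancel_right] at this
        simpa [h2] using this
    funext k
    exact key (k - N + 1).toNat k (by omega)

lemma FstBounded.eq_zero_of_op2 {Z : ℤ → ℤ → M} (hZ : FstBounded Z) {L : List (ℂ × ℂ)}
    (hL : ∀ c ∈ L, c ≠ 0) (h : GammaVA.op2 L Z = 0) : Z = 0 := by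
  induction L with
  | nil => exact h
  | cons c L ih =>
    rw [op2_cons] at h
    exact ih (fun d hd => hL d (List.mem_cons_of_mem _ hd))
      ((hZ.op2 L).eq_zero_of_lin2 (hL c List.mem_cons_self) h)

lemma fstBounded_taylorSubst (F : ℤ → ℤ → M) : FstBounded (taylorSubst F) :=
  ⟨0, fun _ hk => funext fun l => taylorSubst_of_neg F hk l⟩

/-- `Z(x₀, x)` is the expansion of `F(x + x₀, x)`, where `F(x₁, x₂)` becomes truncated after
multiplication by a product of linear forms. -/
def IsSubst (F Z : ℤ → ℤ → M) : Prop :=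
  FstBounded Z ∧ ∃ L : List (ℂ × ℂ), (∀ c ∈ L, c ≠ 0) ∧ Truncated (op2 L F) ∧
    op2 (L.map shiftForm) Z = taylorSubst (op2 L F)

namespace IsSubst

/-- The witnessing lists `L` and `L'` may differ. After multiplication by both, `Z` and `Z'` become
the expansion of the same truncated series, and the forms cancel from `Z - Z'`. -/
lemma unique {F Z Z' : ℤ → ℤ → M} (h : IsSubst F Z) (h' : IsSubst F Z') : Z = Z' := by
  obtain ⟨hb, L, hL, ht, he⟩ := h
  obtain ⟨hb', L', hL', ht', he'⟩ := h'
  have hd : FstBounded (Z - Z') := by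
    rw [sub_eq_add_neg, ← neg_one_smul ℂ Z']
    exact hb.add (hb'.smul _)
  refine sub_eq_zero.mp (hd.eq_zero_of_op2 (L := (L ++ L').map shiftForm) ?_ ?_)
  · intro c hc
    obtain ⟨d, hd, rfl⟩ := List.mem_map.mp hc
    refine shiftForm_ne_zero ?_
    rcases List.mem_append.mp hd with hd | hd
    exacts [hL d hd, hL' d hd]
  · rw [List.map_append, op2_append, map_sub, map_sub, he',
      op2_comm _ _ Z, he, ← taylorSubst_op2 L ht', ← taylorSubst_op2 L' ht, op2_comm, sub_self]

lemma of_truncated {F : ℤ → ℤ → M} (hF : Truncated F) : IsSubst F (taylorSubst F) :=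
  ⟨fstBounded_taylorSubst F, [], by simp, hF, rfl⟩

lemma add {F Z F' Z' : ℤ → ℤ → M} (h : IsSubst F Z) (h' : IsSubst F' Z') :
    IsSubst (F + F') (Z + Z') := by
  obtain ⟨hb, L, hL, ht, he⟩ := h
  obtain ⟨hb', L', hL', ht', he'⟩ := h'
  have e : op2 (L ++ L') (F + F') = op2 L' (op2 L F) + op2 L (op2 L' F') := by
    rw [op2_append, map_add, map_add, op2_comm L L' F]
  refine ⟨hb.add hb', L ++ L', fun c hc => ?_, ?_, ?_⟩
  · rcases List.mem_append.mp hc with hd | hd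
    exacts [hL c hd, hL' c hd]
  · rw [e]
    exact (ht.op2 _).add (ht'.op2 _)
  · rw [e, taylorSubst_add (ht.op2 _) (ht'.op2 _), taylorSubst_op2 _ ht, taylorSubst_op2 _ ht',
      ← he, ← he', List.map_append, op2_append, map_add, map_add]
    congr 1
    exact op2_comm _ _ _

lemma zero : IsSubst (0 : ℤ → ℤ → M) 0 :=
  ⟨⟨0, fun _ _ => rfl⟩, [], by simp, ⟨0, fun _ _ _ => rfl⟩, by
    funext k l
    simp [taylorSubst]⟩

lemma smul {F Z : ℤ → ℤ → M} (r : ℂ) (h : IsSubst F Z) : IsSubst (r • F) (r • Z) := by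
  obtain ⟨hb, L, hL, ht, he⟩ := h
  refine ⟨hb.smul r, L, hL, ?_, ?_⟩
  · rw [map_smul]
    exact ht.smul r
  · rw [map_smul, map_smul, taylorSubst_smul, he]

lemma lin2 {F Z : ℤ → ℤ → M} (c : ℂ × ℂ) (h : IsSubst F Z) :
    IsSubst (lin2 c F) (lin2 (shiftForm c) Z) := by
  obtain ⟨hb, L, hL, ht, he⟩ := h
  refine ⟨hb.lin2 _, L, hL, ?_, ?_⟩
  · rw [← lin2_op2]
    exact ht.lin2 c
  · rw [← lin2_op2, ← lin2_op2, taylorSubst_lin2 c ht, he]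

lemma map {F Z : ℤ → ℤ → M} (f : M →ₗ[ℂ] M') (h : IsSubst F Z) :
    IsSubst (fun m n => f (F m n)) (fun k l => f (Z k l)) := by
  obtain ⟨⟨N, hN⟩, L, hL, ht, he⟩ := h
  refine ⟨⟨N, fun k hk => funext fun l => by simp [hN k hk]⟩, L, hL, ?_, ?_⟩
  · rw [op2_map]
    exact ht.map f
  · rw [op2_map, op2_map, taylorSubst_map f ht, he]

lemma sub {F Z F' Z' : ℤ → ℤ → M} (h : IsSubst F Z) (h' : IsSubst F' Z') :
    IsSubst (F - F') (Z - Z') := by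
  have := h.add (h'.smul (-1))
  rwa [neg_one_smul, neg_one_smul, ← sub_eq_add_neg, ← sub_eq_add_neg] at this

/-- The list inside `IsSubst` is only a witness: by uniqueness, any list that truncates `F` computes
the expansion. -/
lemma op2_eq {F Z : ℤ → ℤ → M} (h : IsSubst F Z) (L : List (ℂ × ℂ)) (hF : Truncated (op2 L F)) :
    op2 (L.map shiftForm) Z = taylorSubst (op2 L F) := by
  refine IsSubst.unique (F := op2 L F) ?_ (of_truncated hF)
  clear hF
  induction L with
  | nil => exact h
  | cons c L ih => rw [List.map_cons, op2_cons, op2_cons]; exact ih.lin2 c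

end IsSubst

end TwoVariables

/-! ### Three variables: substitutions in slices and their compositions. -/

section ThreeVariables

variable {M M' : Type*} [AddCommGroup M] [Module ℂ M] [AddCommGroup M'] [Module ℂ M']

/-- Multiplication of a formal series in three variables by the linear form
`c₁ x₁ + c₂ x₂ + c₃ x₃`. -/
def lin3 (c : ℂ × ℂ × ℂ) : Module.End ℂ (ℤ → ℤ → ℤ → M) where
  toFun F i j k := c.1 • F (i - 1) j k + c.2.1 • F i (j - 1) k + c.2.2 • F i j (k - 1)
  map_add' F G := by
    funext i j k
    simp only [Pi.add_apply]
    module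
  map_smul' r F := by
    funext i j k
    simp only [Pi.smul_apply, RingHom.id_apply]
    module

lemma lin3_apply (c : ℂ × ℂ × ℂ) (F : ℤ → ℤ → ℤ → M) (i j k : ℤ) :
    lin3 c F i j k =
      c.1 • F (i - 1) j k + c.2.1 • F i (j - 1) k + c.2.2 • F i j (k - 1) := rfl

lemma lin3_comm (c d : ℂ × ℂ × ℂ) :
    Commute (lin3 c : Module.End ℂ (ℤ → ℤ → ℤ → M)) (lin3 d) := by
  refine LinearMap.ext fun F => ?_
  funext i j k
  simp only [Module.End.mul_apply, lin3_apply]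
  module

/-- Multiplication of a formal series in three variables by a product of linear forms. -/
def op3 (T : List (ℂ × ℂ × ℂ)) : Module.End ℂ (ℤ → ℤ → ℤ → M) := (T.map lin3).prod

@[simp] lemma op3_nil (F : ℤ → ℤ → ℤ → M) : op3 [] F = F := rfl

lemma op3_cons (c : ℂ × ℂ × ℂ) (T : List (ℂ × ℂ × ℂ)) (F : ℤ → ℤ → ℤ → M) :
    op3 (c :: T) F = lin3 c (op3 T F) := by
  simp [op3]

lemma op3_append (T T' : List (ℂ × ℂ × ℂ)) (F : ℤ → ℤ → ℤ → M) :
    op3 (T ++ T') F = op3 T (op3 T' F) := by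
  simp [op3]

lemma lin3_op3 (c : ℂ × ℂ × ℂ) (T : List (ℂ × ℂ × ℂ)) (F : ℤ → ℤ → ℤ → M) :
    lin3 c (op3 T F) = op3 T (lin3 c F) := by
  induction T with
  | nil => rfl
  | cons d T ih =>
    rw [op3_cons, op3_cons, ← ih]
    exact LinearMap.congr_fun (lin3_comm c d) _

lemma op3_comm (T T' : List (ℂ × ℂ × ℂ)) (F : ℤ → ℤ → ℤ → M) :
    op3 T (op3 T' F) = op3 T' (op3 T F) := by
  induction T with
  | nil => rfl
  | cons d T ih => rw [op3_cons, op3_cons, ih, lin3_op3]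

/-- Linear forms in `x₁`, `x₂` as linear forms in three variables. -/
def embed12 (c : ℂ × ℂ) : ℂ × ℂ × ℂ := (c.1, c.2, 0)

/-- Linear forms in `x₁`, `x₃` as linear forms in three variables. -/
def embed13 (c : ℂ × ℂ) : ℂ × ℂ × ℂ := (c.1, 0, c.2)

/-- Linear forms in `x₂`, `x₃` as linear forms in three variables. -/
def embed23 (c : ℂ × ℂ) : ℂ × ℂ × ℂ := (0, c.1, c.2)

lemma op3_embed12 (L : List (ℂ × ℂ)) (F : ℤ → ℤ → ℤ → M) (k : ℤ) :
    (fun i j => op3 (L.map embed12) F i j k) = op2 L fun i j => F i j k := by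
  induction L with
  | nil => rfl
  | cons c L ih =>
    rw [op2_cons, ← ih, List.map_cons, op3_cons]
    funext i j
    simp [lin3_apply, lin2_apply, embed12]

lemma op3_embed13 (L : List (ℂ × ℂ)) (F : ℤ → ℤ → ℤ → M) (j : ℤ) :
    (fun i k => op3 (L.map embed13) F i j k) = op2 L fun i k => F i j k := by
  induction L with
  | nil => rfl
  | cons c L ih =>
    rw [op2_cons, ← ih, List.map_cons, op3_cons]
    funext i k
    simp [lin3_apply, lin2_apply, embed13]

lemma op3_embed23 (L : List (ℂ × ℂ)) (F : ℤ → ℤ → ℤ → M) (i : ℤ) :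
    op3 (L.map embed23) F i = op2 L (F i) := by
  induction L with
  | nil => rfl
  | cons c L ih =>
    rw [op2_cons, ← ih, List.map_cons, op3_cons]
    funext j k
    simp [lin3_apply, lin2_apply, embed23]

/-- The effect of `x₁ ↦ x₂ + x₁` on linear forms. -/
def shift12 (c : ℂ × ℂ × ℂ) : ℂ × ℂ × ℂ := (c.1, c.1 + c.2.1, c.2.2)

/-- The effect of `x₁ ↦ x₃ + x₁` on linear forms. -/
def shift13 (c : ℂ × ℂ × ℂ) : ℂ × ℂ × ℂ := (c.1, c.2.1, c.1 + c.2.2)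

/-- The effect of `x₂ ↦ x₃ + x₂` on linear forms. -/
def shift23 (c : ℂ × ℂ × ℂ) : ℂ × ℂ × ℂ := (c.1, c.2.1, c.2.1 + c.2.2)

/-- `A(x₂ + x₁, x₂, x₃)`. -/
def taylor12 (A : ℤ → ℤ → ℤ → M) : ℤ → ℤ → ℤ → M :=
  fun i j k => taylorSubst (fun i j => A i j k) i j

/-- `A(x₃ + x₁, x₂, x₃)`. -/
def taylor13 (A : ℤ → ℤ → ℤ → M) : ℤ → ℤ → ℤ → M :=
  fun i j k => taylorSubst (fun i k => A i j k) i k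

/-- `A(x₁, x₃ + x₂, x₃)`. -/
def taylor23 (A : ℤ → ℤ → ℤ → M) : ℤ → ℤ → ℤ → M :=
  fun i j k => taylorSubst (A i) j k

section Families

variable {F Z : ℤ → ℤ → ℤ → M}

/-- Multiplication by the third variable only shifts the slices, so it is covered by the linearity
of `IsSubst`. -/
lemma IsSubst.op3_12 (h : ∀ k, IsSubst (fun i j => F i j k) fun i j => Z i j k)
    (T : List (ℂ × ℂ × ℂ)) (k : ℤ) :
    IsSubst (fun i j => op3 T F i j k) fun i j => op3 (T.map shift12) Z i j k := by
  induction T generalizing k with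
  | nil => exact h k
  | cons c T ih =>
    rw [List.map_cons, op3_cons, op3_cons]
    convert ((ih k).lin2 (c.1, c.2.1)).add ((ih (k - 1)).smul c.2.2) using 1 <;>
    · funext i j
      simp only [lin3_apply, lin2_apply, Pi.add_apply, Pi.smul_apply, shift12, shiftForm]

lemma IsSubst.op3_13 (h : ∀ j, IsSubst (fun i k => F i j k) fun i k => Z i j k)
    (T : List (ℂ × ℂ × ℂ)) (j : ℤ) :
    IsSubst (fun i k => op3 T F i j k) fun i k => op3 (T.map shift13) Z i j k := by
  induction T generalizing j with
  | nil => exact h j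
  | cons c T ih =>
    rw [List.map_cons, op3_cons, op3_cons]
    convert ((ih j).lin2 (c.1, c.2.2)).add ((ih (j - 1)).smul c.2.1) using 1 <;>
    · funext i k
      simp only [lin3_apply, lin2_apply, Pi.add_apply, Pi.smul_apply, shift13, shiftForm]
      abel

lemma IsSubst.op3_23 (h : ∀ i, IsSubst (F i) (Z i)) (T : List (ℂ × ℂ × ℂ)) (i : ℤ) :
    IsSubst (op3 T F i) (op3 (T.map shift23) Z i) := by
  induction T generalizing i with
  | nil => exact h i
  | cons c T ih =>
    rw [List.map_cons, op3_cons, op3_cons]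
    convert ((ih i).lin2 (c.2.1, c.2.2)).add ((ih (i - 1)).smul c.1) using 1 <;>
    · funext j k
      simp only [lin3_apply, lin2_apply, Pi.add_apply, Pi.smul_apply, shift23, shiftForm]
      abel

/-- The slices in `h` may each need a different list of linear forms, with no bound on its length;
uniqueness replaces all of them by the common list `T`. -/
lemma op3_eq_taylor12 (h : ∀ k, IsSubst (fun i j => F i j k) fun i j => Z i j k)
    (T : List (ℂ × ℂ × ℂ)) (hT : ∀ k, Truncated fun i j => op3 T F i j k) :
    op3 (T.map shift12) Z = taylor12 (op3 T F) := by
  funext i j k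
  exact congrFun₂ ((IsSubst.op3_12 h T k).unique (.of_truncated (hT k))) i j

lemma op3_eq_taylor13 (h : ∀ j, IsSubst (fun i k => F i j k) fun i k => Z i j k)
    (T : List (ℂ × ℂ × ℂ)) (hT : ∀ j, Truncated fun i k => op3 T F i j k) :
    op3 (T.map shift13) Z = taylor13 (op3 T F) := by
  funext i j k
  exact congrFun₂ ((IsSubst.op3_13 h T j).unique (.of_truncated (hT j))) i k

lemma op3_eq_taylor23 (h : ∀ i, IsSubst (F i) (Z i))
    (T : List (ℂ × ℂ × ℂ)) (hT : ∀ i, Truncated (op3 T F i)) :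
    op3 (T.map shift23) Z = taylor23 (op3 T F) := by
  funext i j k
  exact congrFun₂ ((IsSubst.op3_23 h T i).unique (.of_truncated (hT i))) j k

end Families

/-- All three exponents are bounded below. -/
def Truncated3 (A : ℤ → ℤ → ℤ → M) : Prop :=
  ∃ N : ℤ, ∀ i j k, i < N ∨ j < N ∨ k < N → A i j k = 0

section Composition

variable {A : ℤ → ℤ → ℤ → M}

lemma Truncated3.slice1 (hA : Truncated3 A) (i : ℤ) : Truncated (A i) := by
  obtain ⟨N, hN⟩ := hA
  exact ⟨N, fun j k h => hN _ _ _ (by omega)⟩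

lemma Truncated3.slice2 (hA : Truncated3 A) (j : ℤ) : Truncated fun i k => A i j k := by
  obtain ⟨N, hN⟩ := hA
  exact ⟨N, fun i k h => hN _ _ _ (by omega)⟩

lemma Truncated3.slice3 (hA : Truncated3 A) (k : ℤ) : Truncated fun i j => A i j k := by
  obtain ⟨N, hN⟩ := hA
  exact ⟨N, fun i j h => hN _ _ _ (by omega)⟩

lemma taylorSubst_eq_zero {F : ℤ → ℤ → M} {k l : ℤ} (h : ∀ m, F m (l + k - m) = 0) :
    taylorSubst F k l = 0 := by
  rw [taylorSubst_eq_sum (s := ∅) fun m _ => h m, Finset.sum_empty]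

lemma Truncated3.taylor23_slice2 (hA : Truncated3 A) (j : ℤ) :
    Truncated fun i k => taylor23 A i j k := by
  obtain ⟨N, hN⟩ := hA
  refine ⟨min N (2 * N - j), fun i k h => taylorSubst_eq_zero fun m => hN _ _ _ (by omega)⟩

lemma Truncated3.taylor13_slice1 (hA : Truncated3 A) (i : ℤ) : Truncated (taylor13 A i) := by
  obtain ⟨N, hN⟩ := hA
  refine ⟨min N (2 * N - i), fun j k h => taylorSubst_eq_zero fun m => hN _ _ _ (by omega)⟩

lemma Truncated3.taylor12_slice1 (hA : Truncated3 A) (i : ℤ) : Truncated (taylor12 A i) := by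
  obtain ⟨N, hN⟩ := hA
  refine ⟨min N (2 * N - i), fun j k h => taylorSubst_eq_zero fun m => hN _ _ _ (by omega)⟩

/-- The three exponents of `A` add up to `i + j + k` and matter only when all are at least `N`,
which bounds each of the first two. With the same box for both orders of substitution, commutation
is an exchange of finite sums. -/
lemma taylor13_taylor23_eq_sum {N : ℤ} (hN : ∀ i j k, i < N ∨ j < N ∨ k < N → A i j k = 0)
    (i j k : ℤ) :
    taylor13 (taylor23 A) i j k = ∑ m ∈ Finset.Icc N (i + j + k - 2 * N),
      ∑ n ∈ Finset.Icc N (i + j + k - 2 * N),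
        (ichoose m i * ichoose n j) • A m n (i + j + k - m - n) := by
  have h1 : ∀ m, N ≤ m → taylor23 A m j (k + i - m) = ∑ n ∈ Finset.Icc N (i + j + k - 2 * N),
      ichoose n j • A m n (i + j + k - m - n) := by
    intro m hm
    rw [taylor23, taylorSubst_eq_sum (s := Finset.Icc N (i + j + k - 2 * N))]
    · refine Finset.sum_congr rfl fun n _ => ?_
      rw [show k + i - m + j - n = i + j + k - m - n by ring]
    · intro n hn
      rw [Finset.mem_Icc] at hn
      exact hN _ _ _ (by omega)
  rw [taylor13, taylorSubst_eq_sum (s := Finset.Icc N (i + j + k - 2 * N))]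
  · refine Finset.sum_congr rfl fun m hm => ?_
    rw [Finset.mem_Icc] at hm
    rw [h1 m hm.1, Finset.smul_sum]
    simp only [mul_smul]
  · intro m hm
    rw [Finset.mem_Icc] at hm
    exact taylorSubst_eq_zero fun n => hN _ _ _ (by omega)

lemma taylor23_taylor13_eq_sum {N : ℤ} (hN : ∀ i j k, i < N ∨ j < N ∨ k < N → A i j k = 0)
    (i j k : ℤ) :
    taylor23 (taylor13 A) i j k = ∑ n ∈ Finset.Icc N (i + j + k - 2 * N),
      ∑ m ∈ Finset.Icc N (i + j + k - 2 * N),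
        (ichoose m i * ichoose n j) • A m n (i + j + k - m - n) := by
  have h1 : ∀ n, N ≤ n → taylor13 A i n (k + j - n) = ∑ m ∈ Finset.Icc N (i + j + k - 2 * N),
      ichoose m i • A m n (i + j + k - m - n) := by
    intro n hn
    rw [taylor13, taylorSubst_eq_sum (s := Finset.Icc N (i + j + k - 2 * N))]
    · refine Finset.sum_congr rfl fun m _ => ?_
      rw [show k + j - n + i - m = i + j + k - m - n by ring]
    · intro m hm
      rw [Finset.mem_Icc] at hm
      exact hN _ _ _ (by omega)
  rw [taylor23, taylorSubst_eq_sum (s := Finset.Icc N (i + j + k - 2 * N))]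
  · refine Finset.sum_congr rfl fun n hn => ?_
    rw [Finset.mem_Icc] at hn
    rw [h1 n hn.1, Finset.smul_sum]
    simp only [mul_comm, mul_smul]
  · intro n hn
    rw [Finset.mem_Icc] at hn
    exact taylorSubst_eq_zero fun m => hN _ _ _ (by omega)

lemma taylor13_taylor23_comm (hA : Truncated3 A) :
    taylor13 (taylor23 A) = taylor23 (taylor13 A) := by
  obtain ⟨N, hN⟩ := hA
  funext i j k
  rw [taylor13_taylor23_eq_sum hN, taylor23_taylor13_eq_sum hN, Finset.sum_comm]

/-- Trinomial revision, with binomials extended by zero to negative lower entries. -/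
lemma ichoose_mul_ichoose (i m k : ℤ) (hm : 0 ≤ m) :
    ichoose m k * ichoose i m = ichoose i k * ichoose (i - k) (m - k) := by
  rcases lt_or_ge k 0 with hk | hk
  · rw [ichoose_of_neg _ hk, ichoose_of_neg _ hk, zero_mul, zero_mul]
  lift k to ℕ using hk
  lift m to ℕ using hm
  rcases lt_or_ge m k with h | h
  · rw [ichoose_of_neg (i - k) (by omega), ichoose_natCast, Ring.choose_natCast,
      Nat.choose_eq_zero_of_lt h]
    simp
  · obtain ⟨r, rfl⟩ := Nat.exists_eq_add_of_le' h
    have := Ring.choose_smul_choose i (Nat.le_add_left k r)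
    rw [show ((r + k : ℕ) : ℤ) - k = r by push_cast; ring]
    simp only [ichoose_natCast]
    rw [Ring.choose_natCast]
    simpa using this

/-- Vandermonde's identity. -/
lemma ichoose_add (a b q : ℤ) : ichoose (a + b) q =
    ∑ m ∈ Finset.Icc 0 q, ichoose a m * ichoose b (q - m) := by
  rcases lt_or_ge q 0 with hq | hq
  · rw [ichoose_of_neg _ hq, Finset.Icc_eq_empty (by omega), Finset.sum_empty]
  lift q to ℕ using hq
  rw [ichoose_natCast, Ring.add_choose_eq q (Commute.all a b),
    Finset.Nat.sum_antidiagonal_eq_sum_range_succ_mk]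
  refine Finset.sum_bij (fun m _ => (m : ℤ)) ?_ ?_ ?_ ?_
  · intro m hm
    simp only [Finset.mem_range, Finset.mem_Icc] at *
    omega
  · intro m _ n _ h
    exact_mod_cast h
  · intro m hm
    rw [Finset.mem_Icc] at hm
    exact ⟨m.toNat, by rw [Finset.mem_range]; omega, by omega⟩
  · intro m hm
    rw [Finset.mem_range] at hm
    rw [ichoose_natCast, ← Nat.cast_sub (by omega), ichoose_natCast]

/-- Trinomial revision extracts `ichoose i k`, which is independent of `m`, and Vandermonde's
identity sums the rest. This is the numerical content of `x + (x₂ + x₀) = (x + x₂) + x₀`. -/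
lemma sum_ichoose_mul (i j k q : ℤ) :
    ∑ m ∈ Finset.Icc 0 (q + k), ichoose m k * (ichoose i m * ichoose j (q + k - m)) =
      ichoose i k * ichoose (i + j - k) q := by
  rcases lt_or_ge k 0 with hk | hk
  · simp [ichoose_of_neg _ hk]
  have h1 : ∀ m ∈ Finset.Icc 0 (q + k), ichoose m k * (ichoose i m * ichoose j (q + k - m)) =
      ichoose i k * (ichoose (i - k) (m - k) * ichoose j (q - (m - k))) := by
    intro m hm
    rw [Finset.mem_Icc] at hm
    rw [← mul_assoc, ichoose_mul_ichoose i m k hm.1, mul_assoc,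
      show q + k - m = q - (m - k) by ring]
  rw [Finset.sum_congr rfl h1, ← Finset.mul_sum, show i + j - k = i - k + j by ring, ichoose_add]
  congr 1
  have h2 : Finset.Icc k (q + k) ⊆ Finset.Icc 0 (q + k) := Finset.Icc_subset_Icc hk le_rfl
  rw [← Finset.sum_subset h2]
  · refine Finset.sum_bij (fun m _ => m - k) ?_ ?_ ?_ ?_
    · intro m hm
      rw [Finset.mem_Icc] at *
      omega
    · intro m _ n _ h
      exact sub_left_inj.mp h
    · intro m hm
      rw [Finset.mem_Icc] at hm
      exact ⟨m + k, by rw [Finset.mem_Icc]; omega, by ring⟩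
    · intros
      rfl
  · intro m hm hm'
    rw [Finset.mem_Icc] at hm hm'
    rw [ichoose_of_neg (i - k) (by omega), zero_mul]

/-- Expanding `A(x + (x₂ + x₀), x + x₂, x)` and `A((x + x₂) + x₀, x + x₂, x)`. -/
lemma taylor12_taylor13_taylor23 (hA : Truncated3 A) :
    taylor12 (taylor13 (taylor23 A)) = taylor23 (taylor12 A) := by
  obtain ⟨N, hN⟩ := hA
  funext k q l
  have hleft : taylor12 (taylor13 (taylor23 A)) k q l =
      ∑ i ∈ Finset.Icc N (k + q + l - 2 * N), ∑ j ∈ Finset.Icc N (k + q + l - 2 * N),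
        (ichoose i k * ichoose (i + j - k) q) • A i j (k + q + l - i - j) := by
    -- The inner expansion has the exponents `m` and `q + k - m` in its first two variables, and
    -- both must be nonnegative.
    rw [taylor12, taylorSubst_eq_sum (s := Finset.Icc 0 (q + k))]
    · simp only [taylor13_taylor23_eq_sum hN, ← sum_ichoose_mul, Finset.sum_smul, Finset.smul_sum]
      rw [Finset.sum_comm' (t' := Finset.Icc N (k + q + l - 2 * N))
        (s' := fun _ => Finset.Icc 0 (q + k))]
      · refine Finset.sum_congr rfl fun i _ => ?_
        rw [Finset.sum_comm' (t' := Finset.Icc N (k + q + l - 2 * N))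
          (s' := fun _ => Finset.Icc 0 (q + k))]
        · refine Finset.sum_congr rfl fun j _ => Finset.sum_congr rfl fun m _ => ?_
          rw [smul_smul, show m + (q + k - m) + l = k + q + l by ring]
        · intro m j
          rw [show m + (q + k - m) + l = k + q + l by ring, and_comm]
      · intro m i
        rw [show m + (q + k - m) + l = k + q + l by ring, and_comm]
    · intro m hm
      rw [Finset.mem_Icc] at hm
      rcases lt_or_ge m 0 with h | h
      · exact taylorSubst_of_neg _ h _
      · exact taylorSubst_eq_zero fun i => taylorSubst_of_neg _ (by omega) _
  have hright : taylor23 (taylor12 A) k q l =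
      ∑ i ∈ Finset.Icc N (k + q + l - 2 * N), ∑ j ∈ Finset.Icc N (k + q + l - 2 * N),
        (ichoose i k * ichoose (i + j - k) q) • A i j (k + q + l - i - j) := by
    -- The exponents of `A` are `i`, `n + k - i` and `l + q - n`; that all are at least `N` confines
    -- `n` to this interval.
    rw [taylor23, taylorSubst_eq_sum (s := Finset.Icc (2 * N - k) (l + q - N))]
    · have h1 : ∀ n ∈ Finset.Icc (2 * N - k) (l + q - N),
          ichoose n q • taylor12 A k n (l + q - n) =
            ∑ i ∈ Finset.Icc N (k + q + l - 2 * N),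
              (ichoose i k * ichoose n q) • A i (n + k - i) (l + q - n) := by
        intro n hn
        rw [Finset.mem_Icc] at hn
        rw [taylor12, taylorSubst_eq_sum (s := Finset.Icc N (k + q + l - 2 * N)), Finset.smul_sum]
        · simp only [smul_smul, mul_comm]
        · intro i hi
          rw [Finset.mem_Icc] at hi
          exact hN _ _ _ (by omega)
      rw [Finset.sum_congr rfl h1, Finset.sum_comm]
      refine Finset.sum_congr rfl fun i hi => ?_
      rw [Finset.mem_Icc] at hi
      have e1 : ∑ n ∈ Finset.Icc (2 * N - k) (l + q - N),
          (ichoose i k * ichoose n q) • A i (n + k - i) (l + q - n) =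
          ∑ᶠ n : ℤ, (ichoose i k * ichoose n q) • A i (n + k - i) (l + q - n) := by
        refine (finsum_eq_sum_of_support_subset _ fun n hn => ?_).symm
        by_contra h
        refine hn ?_
        rw [Finset.mem_coe, Finset.mem_Icc] at h
        change (ichoose i k * ichoose n q) • A i (n + k - i) (l + q - n) = 0
        rw [hN _ _ _ (by omega), smul_zero]
      have e2 : ∑ j ∈ Finset.Icc N (k + q + l - 2 * N),
          (ichoose i k * ichoose (i + j - k) q) • A i j (k + q + l - i - j) =
          ∑ᶠ j : ℤ, (ichoose i k * ichoose (i + j - k) q) • A i j (k + q + l - i - j) := by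
        refine (finsum_eq_sum_of_support_subset _ fun j hj => ?_).symm
        by_contra h
        refine hj ?_
        rw [Finset.mem_coe, Finset.mem_Icc] at h
        change (ichoose i k * ichoose (i + j - k) q) • A i j (k + q + l - i - j) = 0
        rw [hN _ _ _ (by omega), smul_zero]
      -- The second exponent of `A` is `j = n + k - i`, so the reindexing is `n = j + (i - k)`.
      rw [e1, e2, ← finsum_comp_equiv (Equiv.addRight (i - k))]
      refine finsum_congr fun j => ?_
      simp only [Equiv.coe_addRight]
      rw [show j + (i - k) = i + j - k by ring, show i + j - k + k - i = j by ring,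
        show l + q - (i + j - k) = k + q + l - i - j by ring]
    · intro n hn
      rw [Finset.mem_Icc] at hn
      exact taylorSubst_eq_zero fun m => hN _ _ _ (by omega)
  rw [hleft, hright]

end Composition

end ThreeVariables

/-! ### `Y_ℰ` characterized by substitution. -/

section Products

variable {W : Type*} [AddCommGroup W] [Module ℂ W]

/-- The linear form `x₁ - α x₂`. -/
def rootForm (α : ℂˣ) : ℂ × ℂ := (1, -(α : ℂ))

lemma rootForm_ne_zero (α : ℂˣ) : rootForm α ≠ 0 := fun h => one_ne_zero (congrArg Prod.fst h)

lemma polyMul_C {M : Type*} [AddCommGroup M] [Module ℂ M] (c : ℂ) (F : ℤ → ℤ → M) :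
    polyMul (MvPolynomial.C c) F = c • F := by
  funext m n
  rw [← MvPolynomial.monomial_zero', polyMul_monomial]
  simp

lemma polyMul_X_zero {M : Type*} [AddCommGroup M] [Module ℂ M] (F : ℤ → ℤ → M) (m n : ℤ) :
    polyMul (MvPolynomial.X 0) F m n = F (m - 1) n := by
  rw [MvPolynomial.X, polyMul_monomial]
  simp

lemma polyMul_X_one {M : Type*} [AddCommGroup M] [Module ℂ M] (F : ℤ → ℤ → M) (m n : ℤ) :
    polyMul (MvPolynomial.X 1) F m n = F m (n - 1) := by
  rw [MvPolynomial.X, polyMul_monomial]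
  simp

lemma polyMul_linearFactor {M : Type*} [AddCommGroup M] [Module ℂ M] (α : ℂ) (F : ℤ → ℤ → M) :
    polyMul (MvPolynomial.X 0 - MvPolynomial.C α * MvPolynomial.X 1) F = lin2 (1, -α) F := by
  rw [sub_eq_add_neg, ← neg_mul, ← map_neg, polyMul_add_left, polyMul_mul, polyMul_C]
  funext m n
  simp only [Pi.add_apply, Pi.smul_apply, polyMul_X_zero, polyMul_X_one, lin2_apply, one_smul]

lemma linearProduct_cons (α : ℂˣ) (l : List ℂˣ) : linearProduct (α :: l) =
    (MvPolynomial.X 0 - MvPolynomial.C (α : ℂ) * MvPolynomial.X 1) * linearProduct l := by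
  simp [linearProduct]

lemma polyMul_linearProduct {M : Type*} [AddCommGroup M] [Module ℂ M] (l : List ℂˣ)
    (F : ℤ → ℤ → M) : polyMul (linearProduct l) F = op2 (l.map rootForm) F := by
  induction l with
  | nil =>
    have : linearProduct [] = MvPolynomial.C 1 := by simp [linearProduct]
    rw [this, polyMul_C, one_smul]
    rfl
  | cons α l ih =>
    rw [linearProduct_cons, polyMul_mul, ih, polyMul_linearFactor, List.map_cons, op2_cons]
    rfl

lemma linearProduct_ne_zero (l : List ℂˣ) : linearProduct l ≠ 0 := by
  induction l with
  | nil => simp [linearProduct]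
  | cons α l ih =>
    rw [linearProduct_cons]
    refine mul_ne_zero (fun h => ?_) ih
    have h1 := congrArg (MvPolynomial.eval ![(1 : ℂ), 0]) h
    simp at h1

lemma commuteUpTo_linearProduct_iff (l : List ℂˣ) (a b : VertexOperator ℂ W) :
    CommuteUpTo (linearProduct l) a b ↔ op2 (l.map rootForm) (prodAB a b - prodBA a b) = 0 := by
  rw [CommuteUpTo, polyMul_linearProduct, polyMul_linearProduct, map_sub, sub_eq_zero]

lemma GammaLocalPair.quasiLocalPair {Γ : Subgroup ℂˣ} {a b : VertexOperator ℂ W}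
    (h : GammaLocalPair Γ a b) : QuasiLocalPair a b := by
  obtain ⟨l, _, h⟩ := h
  exact ⟨_, linearProduct_ne_zero l, h⟩

/-- The coefficients of an element of `Hom(W, W((x)))((x₀))`. -/
def FieldSeries.series (G : FieldSeries W) : ℤ → ℤ → Module.End ℂ W :=
  fun k => HVertexOperator.coeff (G.coeff k)

lemma FieldSeries.fstBounded_coeff (G : FieldSeries W) : ∃ N : ℤ, ∀ k < N, G.coeff k = 0 :=
  ⟨_, fun _ hk => HahnSeries.coeff_eq_zero_of_lt_order hk⟩

lemma FieldSeries.series_linearFactor_smul (α : ℂˣ) (G : FieldSeries W) :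
    (shiftPoly (MvPolynomial.X 0 - MvPolynomial.C (α : ℂ) * MvPolynomial.X 1) • G).series =
      lin2 (shiftForm (rootForm α)) G.series := by
  have h : shiftPoly (MvPolynomial.X 0 - MvPolynomial.C (α : ℂ) * MvPolynomial.X 1) =
      IteratedLaurent.single 0 (HahnSeries.single 1 (1 + -(α : ℂ))) +
        IteratedLaurent.single 1 1 := by
    have hC : shiftPoly (MvPolynomial.C (α : ℂ)) =
        IteratedLaurent.single 0 (HahnSeries.single 0 (α : ℂ)) := by
      rw [shiftPoly, MvPolynomial.coe_eval₂Hom, MvPolynomial.eval₂_C]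
      rfl
    have hs : ∀ p q, shiftPoly (p - MvPolynomial.C (α : ℂ) * q) =
        shiftPoly p - shiftPoly (MvPolynomial.C (α : ℂ)) * shiftPoly q := fun p q => by
      simp only [shiftPoly, map_sub, map_mul]
    rw [hs, shiftPoly_X_zero, shiftPoly_X_one, hC]
    have e : IteratedLaurent.single 0 (HahnSeries.single 0 (α : ℂ)) *
        IteratedLaurent.single 0 (HahnSeries.single 1 1) =
        IteratedLaurent.single 0 (HahnSeries.single 1 (α : ℂ)) := by
      refine Eq.trans (HahnSeries.single_mul_single (Γ := ℤ) (R := LaurentSeries ℂ)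
        (a := 0) (b := 0)) ?_
      rw [HahnSeries.single_mul_single, zero_add, zero_add, mul_one]
      rfl
    have e2 : IteratedLaurent.single 0 (HahnSeries.single 1 (1 + -(α : ℂ))) =
        IteratedLaurent.single 0 (HahnSeries.single 1 1) -
        IteratedLaurent.single 0 (HahnSeries.single 1 (α : ℂ)) := by
      rw [← sub_eq_add_neg, HahnSeries.single_sub]
      exact HahnSeries.single_sub _ _ _
    rw [e, e2]
    ring
  rw [h, add_smul]
  funext k l
  change HVertexOperator.coeff (FieldSeries.coeff (_ + _) k) l = _
  rw [FieldSeries.coeff_add, FieldSeries.coeff_single_smul, FieldSeries.coeff_single_smul, map_add,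
    Pi.add_apply, GammaVA.coeff_single_smul, one_smul, sub_zero, lin2_apply]
  simp only [rootForm, shiftForm, FieldSeries.series, one_smul]
  rw [add_comm]

lemma FieldSeries.series_linearProduct_smul (l : List ℂˣ) (G : FieldSeries W) :
    (shiftPoly (linearProduct l) • G).series = op2 ((l.map rootForm).map shiftForm) G.series := by
  induction l with
  | nil =>
    have : shiftPoly (linearProduct []) = 1 := by simp [shiftPoly, linearProduct]
    rw [this, one_smul]
    rfl
  | cons α l ih =>
    have h : shiftPoly (linearProduct (α :: l)) =
        shiftPoly (MvPolynomial.X 0 - MvPolynomial.C (α : ℂ) * MvPolynomial.X 1) *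
          shiftPoly (linearProduct l) := by
      rw [linearProduct_cons, shiftPoly, map_mul]
      rfl
    rw [h, mul_smul, FieldSeries.series_linearFactor_smul, ih, List.map_cons, List.map_cons,
      op2_cons]

lemma series_subst_apply (F : laurentTwo W) (k l : ℤ) (w : W) :
    (subst F).series k l w = taylorSubst (fun m n => F.1 m n w) k l := by
  change HVertexOperator.coeff ((subst F).coeff k) l w = _
  rw [coeff_subst]
  split_ifs with h
  · lift k to ℕ using h
    refine finsum_congr fun m => ?_
    rw [ichoose_natCast]
    rfl
  · rw [taylorSubst_of_neg _ (by omega), map_zero]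
    rfl

lemma op2_apply (L : List (ℂ × ℂ)) (F : ℤ → ℤ → Module.End ℂ W) (w : W) :
    op2 L (fun m n => F m n w) = fun m n => op2 L F m n w :=
  op2_map (LinearMap.applyₗ (R := ℂ) (M := W) (M₂ := W) w) L F

/-- Multiplication by `shiftPoly (linearProduct l)` removes the inverse from the definition of
`Y_ℰ`, and on coefficients it acts through the shifted linear forms. -/
lemma isSubst_YE {a b : VertexOperator ℂ W} {l : List ℂˣ}
    (h : CommuteUpTo (linearProduct l) a b) (w : W) :
    IsSubst (fun m n => coeff a m (coeff b n w)) fun k l => coeff ((YE a b).coeff k) l w := by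
  obtain ⟨N, hN⟩ := (YE a b).fstBounded_coeff
  have hs : shiftPoly (linearProduct l) • YE a b = subst ⟨_, h.mem_laurentTwo⟩ := by
    rw [YE_eq (linearProduct_ne_zero l) h, YEWith,
      smul_inv_smul₀ (shiftPoly_ne_zero (linearProduct_ne_zero l))]
  have e : op2 (l.map rootForm) (fun m n => coeff a m (coeff b n w)) =
      fun m n => polyMul (linearProduct l) (prodAB a b) m n w := by
    rw [polyMul_linearProduct]
    exact op2_apply _ (prodAB a b) w
  refine ⟨⟨N, fun k hk => ?_⟩, l.map rootForm, fun c hc => ?_, ?_, ?_⟩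
  · funext l
    change coeff ((YE a b).coeff k) l w = 0
    rw [hN k hk, map_zero]
    rfl
  · obtain ⟨α, -, rfl⟩ := List.mem_map.mp hc
    exact rootForm_ne_zero α
  · rw [e]
    exact h.mem_laurentTwo w
  · refine (op2_apply _ (YE a b).series w).trans ?_
    rw [← FieldSeries.series_linearProduct_smul, hs, e]
    funext k l
    exact series_subst_apply _ k l w

/-- `Y_ℰ(a(x), x₀) b(x)` is determined by its expansion property. -/
lemma YE_coeff_eq {a b : VertexOperator ℂ W} {l : List ℂˣ}
    (h : CommuteUpTo (linearProduct l) a b) {Z : ℤ → VertexOperator ℂ W}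
    (hZ : ∀ w, IsSubst (fun m n => coeff a m (coeff b n w)) fun k l => coeff (Z k) l w) (k : ℤ) :
    (YE a b).coeff k = Z k := by
  refine HVertexOperator.coeff_inj (funext fun l => LinearMap.ext fun w => ?_)
  exact congrFun₂ ((isSubst_YE h w).unique (hZ w)) k l

end Products

/-! ### `Γ`-locality, Dong's lemma, and the smallest closed space. -/

section Locality

variable {W : Type*} [AddCommGroup W] [Module ℂ W] {Γ : Subgroup ℂˣ}

/-- Vanishing after multiplication by a product of factors `x₁ - α x₂` with `α ∈ Γ`. -/
def Killed {M : Type*} [AddCommGroup M] [Module ℂ M] (Γ : Subgroup ℂˣ) (F : ℤ → ℤ → M) : Prop :=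
  ∃ l : List ℂˣ, (∀ α ∈ l, α ∈ Γ) ∧ op2 (l.map rootForm) F = 0

namespace Killed

variable {M : Type*} [AddCommGroup M] [Module ℂ M] {F G : ℤ → ℤ → M}

lemma zero : Killed Γ (0 : ℤ → ℤ → M) := ⟨[], by simp, rfl⟩

lemma add (hF : Killed Γ F) (hG : Killed Γ G) : Killed Γ (F + G) := by
  obtain ⟨l, hl, h⟩ := hF
  obtain ⟨l', hl', h'⟩ := hG
  refine ⟨l ++ l', fun α hα => (List.mem_append.mp hα).elim (hl α) (hl' α), ?_⟩
  rw [List.map_append, op2_append, map_add, map_add, h', op2_comm, h, map_zero, map_zero, add_zero]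

lemma smul (c : ℂ) (hF : Killed Γ F) : Killed Γ (c • F) := by
  obtain ⟨l, hl, h⟩ := hF
  exact ⟨l, hl, by rw [map_smul, h, smul_zero]⟩

lemma sub (hF : Killed Γ F) (hG : Killed Γ G) : Killed Γ (F - G) := by
  rw [sub_eq_add_neg, ← neg_one_smul ℂ G]
  exact hF.add (hG.smul _)

lemma of_lin2 {α : ℂˣ} (hα : α ∈ Γ) (hF : Killed Γ (lin2 (rootForm α) F)) : Killed Γ F := by
  obtain ⟨l, hl, h⟩ := hF
  refine ⟨α :: l, fun β hβ => ?_, ?_⟩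
  · rcases List.mem_cons.mp hβ with rfl | hβ
    exacts [hα, hl β hβ]
  · rw [List.map_cons, op2_cons, lin2_op2, h]

/-- Reduction from a factor `(x + x₀) - α x₃`, for series in `x₀`, `x`, `x₃` in which the exponents
of `x₀` are bounded below. -/
lemma of_lin3 {D : ℤ → ℤ → ℤ → M} {N : ℤ} (hN : ∀ k < N, D k = 0) {α : ℂˣ} (hα : α ∈ Γ)
    (h : ∀ k, Killed Γ (lin3 (shift12 (embed13 (rootForm α))) D k)) (k : ℤ) : Killed Γ (D k) := by
  have key : ∀ r : ℕ, ∀ k < N + r, Killed Γ (D k) := by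
    intro r
    induction r with
    | zero =>
      intro k hk
      rw [hN k (by simpa using hk)]
      exact zero
    | succ r ih =>
      intro k hk
      refine of_lin2 hα ?_
      -- The coefficient of `x₀ ^ k` in `(x + x₀ - α x₃) D` is `D (k - 1) + (x - α x₃) D k`, and its
      -- first term is killed by induction.
      have := (h k).sub (ih (k - 1) (by push_cast at hk; omega))
      convert this using 1
      funext i j
      simp [lin3_apply, lin2_apply, shift12, embed13, rootForm]
      abel
  exact key (k - N + 1).toNat k (by omega)

lemma of_op3 {D : ℤ → ℤ → ℤ → M} {N : ℤ} (hN : ∀ k < N, D k = 0) {l : List ℂˣ}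
    (hl : ∀ α ∈ l, α ∈ Γ)
    (h : ∀ k, Killed Γ (op3 (((l.map rootForm).map embed13).map shift12) D k)) (k : ℤ) :
    Killed Γ (D k) := by
  induction l generalizing D k with
  | nil => exact h k
  | cons α l ih =>
    refine of_lin3 hN (hl α List.mem_cons_self)
      (fun k => ih (D := lin3 (shift12 (embed13 (rootForm α))) D) ?_
        (fun β hβ => hl β (List.mem_cons_of_mem _ hβ)) (fun k => ?_) k) k
    · intro k hk
      funext i j
      simp [lin3_apply, hN k hk, hN (k - 1) (by omega)]
    · rw [← lin3_op3, ← op3_cons]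
      exact h k

end Killed

lemma gammaLocalPair_iff (a b : VertexOperator ℂ W) :
    GammaLocalPair Γ a b ↔ Killed Γ (prodAB a b - prodBA a b) := by
  simp only [GammaLocalPair, commuteUpTo_linearProduct_iff, Killed]

/-- The commutator of two fields, as a series. -/
lemma commutator_swap (a b : VertexOperator ℂ W) :
    prodAB b a - prodBA b a = fun m n => -(prodAB a b - prodBA a b) n m := by
  funext m n
  simp [prodAB, prodBA]

/-- Because `x₁ - α⁻¹ x₂ = -α⁻¹ (x₂ - α x₁)`; the constants collect in `c`. -/
lemma op2_swap {M : Type*} [AddCommGroup M] [Module ℂ M] (l : List ℂˣ) (F : ℤ → ℤ → M) :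
    ∃ c : ℂ, op2 ((l.map fun α => α⁻¹).map rootForm) (fun m n => F n m) =
      c • fun m n => op2 (l.map rootForm) F n m := by
  induction l with
  | nil => exact ⟨1, by simp⟩
  | cons α l ih =>
    obtain ⟨c, hc⟩ := ih
    refine ⟨-(α : ℂ)⁻¹ * c, ?_⟩
    rw [List.map_cons, List.map_cons, List.map_cons, op2_cons, op2_cons, hc, map_smul, mul_comm,
      mul_smul]
    congr 1
    funext m n
    simp only [lin2_apply, rootForm, Pi.smul_apply, smul_add, smul_smul, Units.val_inv_eq_inv_val]
    rw [neg_mul_neg, inv_mul_cancel₀ α.ne_zero]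
    simp only [mul_one, one_smul]
    rw [add_comm]

namespace GammaLocalPair

variable {a b d : VertexOperator ℂ W}

lemma symm (h : GammaLocalPair Γ a b) : GammaLocalPair Γ b a := by
  rw [gammaLocalPair_iff] at h ⊢
  obtain ⟨l, hl, h⟩ := h
  obtain ⟨c, hc⟩ := op2_swap l (prodAB a b - prodBA a b)
  refine ⟨l.map fun α => α⁻¹, fun α hα => ?_, ?_⟩
  · obtain ⟨β, hβ, rfl⟩ := List.mem_map.mp hα
    exact inv_mem (hl β hβ)
  · have : prodAB b a - prodBA b a =
        (-1 : ℂ) • fun m n => (prodAB a b - prodBA a b) n m := by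
      rw [commutator_swap]
      funext m n
      simp
    rw [this, map_smul, hc, h]
    funext m n
    simp

lemma add_left (h : GammaLocalPair Γ a d) (h' : GammaLocalPair Γ b d) :
    GammaLocalPair Γ (a + b) d := by
  rw [gammaLocalPair_iff] at *
  convert h.add h' using 1
  funext m n
  simp only [prodAB, prodBA, Pi.sub_apply, Pi.add_apply, map_add, add_mul, mul_add]
  abel

lemma smul_left (c : ℂ) (h : GammaLocalPair Γ a d) : GammaLocalPair Γ (c • a) d := by
  rw [gammaLocalPair_iff] at *
  convert h.smul c using 1
  funext m n
  simp only [prodAB, prodBA, Pi.sub_apply, Pi.smul_apply, map_smul, smul_mul_assoc, mul_smul_comm,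
    smul_sub]

lemma zero_left : GammaLocalPair Γ 0 d := by
  rw [gammaLocalPair_iff]
  convert Killed.zero using 1
  funext m n
  simp [prodAB, prodBA]

lemma idField_left : GammaLocalPair Γ (idField W) d := by
  rw [gammaLocalPair_iff]
  convert Killed.zero using 1
  funext m n
  have : coeff (idField W) m = if m = 0 then 1 else 0 := rfl
  simp only [prodAB, prodBA, Pi.sub_apply, this]
  split_ifs <;> simp

/-- Since `x₁ - α⁻¹ β x₂ = α⁻¹ (α x₁ - β x₂)`, each root `β` is replaced by `α⁻¹ β`, again in `Γ`.
-/
lemma rescale_left {α : ℂˣ} (hα : α ∈ Γ) (h : GammaLocalPair Γ a d) :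
    GammaLocalPair Γ (rescale α a) d := by
  rw [gammaLocalPair_iff] at *
  obtain ⟨l, hl, h⟩ := h
  have e : prodAB (rescale α a) d - prodBA (rescale α a) d =
      fun m n => ((α ^ m : ℂˣ) : ℂ) • (prodAB a d - prodBA a d) m n := by
    funext m n
    have : coeff (rescale α a) m = ((α ^ m : ℂˣ) : ℂ) • coeff a m := rfl
    simp only [prodAB, prodBA, Pi.sub_apply, this, smul_mul_assoc, mul_smul_comm, smul_sub]
  have key : ∀ F : ℤ → ℤ → Module.End ℂ W, ∃ c : ℂ,
      op2 ((l.map fun β => α⁻¹ * β).map rootForm) (fun m n => ((α ^ m : ℂˣ) : ℂ) • F m n) =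
        c • fun m n => ((α ^ m : ℂˣ) : ℂ) • op2 (l.map rootForm) F m n := by
    intro F
    clear hl h
    induction l with
    | nil => exact ⟨1, by simp⟩
    | cons β l ih =>
      obtain ⟨c, hc⟩ := ih
      refine ⟨(α : ℂ)⁻¹ * c, ?_⟩
      rw [List.map_cons, List.map_cons, List.map_cons, op2_cons, op2_cons, hc, map_smul,
        mul_comm _ c, mul_smul]
      congr 1
      funext m n
      simp only [lin2_apply, rootForm, Pi.smul_apply, smul_add, smul_smul, zpow_sub_one,
        Units.val_mul, Units.val_inv_eq_inv_val]
      congr 2 <;> ring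
  obtain ⟨c, hc⟩ := key (prodAB a d - prodBA a d)
  refine ⟨l.map fun β => α⁻¹ * β, fun β hβ => ?_, ?_⟩
  · obtain ⟨γ, hγ, rfl⟩ := List.mem_map.mp hβ
    exact mul_mem (inv_mem hα) (hl γ hγ)
  · rw [e, hc, h]
    funext m n
    simp

/-- Dong's lemma for `Γ`-local fields. -/
lemma YE_coeff_left (hab : GammaLocalPair Γ a b) (had : GammaLocalPair Γ a d)
    (hbd : GammaLocalPair Γ b d) (k : ℤ) : GammaLocalPair Γ ((YE a b).coeff k) d := by
  obtain ⟨N, hN⟩ := (YE a b).fstBounded_coeff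
  obtain ⟨l, -, hl⟩ := hab
  rw [gammaLocalPair_iff] at had hbd ⊢
  obtain ⟨l₁, hl₁, h₁⟩ := had
  obtain ⟨l₂, hl₂, h₂⟩ := hbd
  -- `s` is the commutator of `a(x₁) b(x₂)` with `d(x₃)`. The substitution `x₁ = x + x₀`, `x₂ = x`
  -- turns it into `C`, the commutator of `Y_ℰ(a, x₀) b` with `d(x₃)`.
  let s : ℤ → ℤ → ℤ → Module.End ℂ W := fun m n j =>
    coeff a m * coeff b n * coeff d j - coeff d j * (coeff a m * coeff b n)
  let C : ℤ → ℤ → ℤ → Module.End ℂ W := fun k =>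
    prodAB ((YE a b).coeff k) d - prodBA ((YE a b).coeff k) d
  have hsC : ∀ w j, IsSubst (fun m n => s m n j w) fun k i => C k i j w := by
    intro w j
    exact (isSubst_YE hl (coeff d j w)).sub ((isSubst_YE hl w).map (coeff d j))
  let T := (l₁.map rootForm).map embed13 ++ (l₂.map rootForm).map embed23
  have hT : op3 T s = 0 := by
    -- `[ab, d] = [a, d] b + a [b, d]`, and `T` contains the factors that annihilate each summand.
    let s₁ : ℤ → ℤ → ℤ → Module.End ℂ W := fun m n j => (prodAB a d - prodBA a d) m j * coeff b n
    let s₂ : ℤ → ℤ → ℤ → Module.End ℂ W := fun m n j => coeff a m * (prodAB b d - prodBA b d) n j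
    have hs : s = s₁ + s₂ := by
      funext m n j
      simp only [s, s₁, s₂, prodAB, prodBA, Pi.add_apply, Pi.sub_apply, sub_mul, mul_sub, mul_assoc]
      abel
    have e₁ : op3 ((l₁.map rootForm).map embed13) s₁ = 0 := by
      funext m n j
      refine (congrFun₂ (op3_embed13 (l₁.map rootForm) s₁ n) m j).trans ?_
      have := op2_map (LinearMap.mulRight ℂ (coeff b n)) (l₁.map rootForm)
        (prodAB a d - prodBA a d)
      refine (congrFun₂ this m j).trans ?_
      rw [h₁]
      simp
    have e₂ : op3 ((l₂.map rootForm).map embed23) s₂ = 0 := by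
      funext m n j
      rw [op3_embed23]
      have := op2_map (LinearMap.mulLeft ℂ (coeff a m)) (l₂.map rootForm)
        (prodAB b d - prodBA b d)
      refine (congrFun₂ this n j).trans ?_
      rw [h₂]
      simp
    rw [hs, map_add, op3_append, op3_append, e₂, map_zero, op3_comm, e₁, map_zero, add_zero]
  have op3_apply : ∀ (T : List (ℂ × ℂ × ℂ)) (D : ℤ → ℤ → ℤ → Module.End ℂ W) (w : W),
      op3 T (fun i j k => D i j k w) = fun i j k => op3 T D i j k w := by
    intro T D w
    induction T with
    | nil => rfl
    | cons c T ih =>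
      rw [op3_cons, op3_cons, ih]
      rfl
  have hC : op3 (T.map shift12) C = 0 := by
    funext k i j
    ext w
    have h1 := (IsSubst.op3_12 (hsC w) T j)
    rw [op3_apply, op3_apply, hT] at h1
    exact congrFun₂ (h1.unique IsSubst.zero) k i
  -- `C` is annihilated by the factors `x + x₀ - α x₃` together with `x - β x₃`. The latter do not
  -- involve `x₀` and act on each coefficient; the former are traded for powers of `x - α x₃`.
  refine Killed.of_op3 (D := C) (N := N) (fun k hk => ?_) hl₁ (fun k => ⟨l₂, hl₂, ?_⟩) k
  · funext i j
    simp only [C, prodAB, prodBA, Pi.sub_apply, hN k hk, map_zero, Pi.zero_apply, zero_mul,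
      mul_zero, sub_self]
  · have : ((l₂.map rootForm).map embed23).map shift12 = (l₂.map rootForm).map embed23 := by
      rw [List.map_map]
      refine List.map_congr_left fun c _ => ?_
      simp [shift12, embed23]
    rw [← op3_embed23, op3_comm, ← this, ← op3_append, ← List.map_append, hC]
    rfl

end GammaLocalPair

/-- A maximal `Γ`-local set is a closed subspace that is stable under `Γ`. -/
lemma exists_closed_gammaLocal (S : Set (VertexOperator ℂ W)) (hS : GammaLocal Γ S) :
    ∃ U : Submodule ℂ (VertexOperator ℂ W),
      ClosedSubspace U ∧ GammaLocal Γ (U : Set (VertexOperator ℂ W)) ∧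
        idField W ∈ U ∧ S ⊆ U ∧ ∀ α ∈ Γ, ∀ a ∈ U, rescale α a ∈ U := by
  obtain ⟨U, hSU, hU⟩ := zorn_subset_nonempty {T : Set (VertexOperator ℂ W) | GammaLocal Γ T}
    (fun c hc hchain _ => ⟨⋃₀ c, fun a ha b hb => by
      obtain ⟨T, hT, ha⟩ := ha
      obtain ⟨T', hT', hb⟩ := hb
      rcases hchain.total hT hT' with h | h
      · exact hc hT' a (h ha) b hb
      · exact hc hT a ha b (h hb), fun T hT => Set.subset_sUnion_of_mem hT⟩) S hS
  have hloc : GammaLocal Γ U := hU.prop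
  -- Maximality of `U`, applied to `insert z U`.
  have hmem : ∀ z, (∀ d ∈ U, GammaLocalPair Γ z d) → GammaLocalPair Γ z z → z ∈ U := by
    intro z hz hzz
    refine hU.le_of_ge (y := insert z U) ?_ (Set.subset_insert z U) (Set.mem_insert z U)
    intro a ha b hb
    rcases Set.mem_insert_iff.mp ha with ha | ha <;> rcases Set.mem_insert_iff.mp hb with hb | hb
    · rw [ha, hb]
      exact hzz
    · rw [ha]
      exact hz b hb
    · rw [hb]
      exact (hz a ha).symm
    · exact hloc a ha b hb
  -- The test is used twice, with `d` in `U` and then, by symmetry, with `d = z`. Each closure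
  -- property thus reduces to preserving locality with one fixed `d`.
  have hmem' : ∀ z, (∀ d, (∀ u ∈ U, GammaLocalPair Γ u d) → GammaLocalPair Γ z d) → z ∈ U := by
    intro z hz
    have h1 : ∀ d ∈ U, GammaLocalPair Γ z d := fun d hd => hz d fun u hu => hloc u hu d hd
    exact hmem z h1 (hz z fun u hu => (h1 u hu).symm)
  refine ⟨{ carrier := U, add_mem' := ?_, zero_mem' := ?_, smul_mem' := ?_ }, ⟨?_, ?_⟩, hloc, ?_,
    hSU, ?_⟩
  · exact fun {a b} ha hb => hmem' _ fun d hd => (hd a ha).add_left (hd b hb)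
  · exact hmem' _ fun d _ => GammaLocalPair.zero_left
  · exact fun c a ha => hmem' _ fun d hd => (hd a ha).smul_left c
  · exact fun a ha b hb => (hloc a ha b hb).quasiLocalPair
  · exact fun a ha b hb n => hmem' _ fun d hd =>
      (hloc a ha b hb).YE_coeff_left (hd a ha) (hd b hb) _
  · exact hmem' _ fun d _ => GammaLocalPair.idField_left
  · exact fun α hα a ha => hmem' _ fun d hd => (hd a ha).rescale_left hα

/-- Locality passes to smaller subspaces, so one member of the family makes the intersection local;
the other conditions pass to intersections directly. -/
lemma exists_isLeast_closed_gammaLocal (S : Set (VertexOperator ℂ W)) (hS : GammaLocal Γ S) :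
    ∃ K : Submodule ℂ (VertexOperator ℂ W),
      IsLeast {U : Submodule ℂ (VertexOperator ℂ W) |
        ClosedSubspace U ∧ GammaLocal Γ (U : Set (VertexOperator ℂ W)) ∧
        idField W ∈ U ∧ S ⊆ U ∧ ∀ α ∈ Γ, ∀ a ∈ U, rescale α a ∈ U} K := by
  obtain ⟨U, hU⟩ := exists_closed_gammaLocal S hS
  set P := {U : Submodule ℂ (VertexOperator ℂ W) |
    ClosedSubspace U ∧ GammaLocal Γ (U : Set (VertexOperator ℂ W)) ∧
      idField W ∈ U ∧ S ⊆ U ∧ ∀ α ∈ Γ, ∀ a ∈ U, rescale α a ∈ U}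
  have hle : sInf P ≤ U := sInf_le hU
  refine ⟨sInf P, ⟨?_, fun T hT => sInf_le hT⟩⟩
  refine ⟨⟨fun a ha b hb => hU.1.1 a (hle ha) b (hle hb), fun a ha b hb n => ?_⟩,
    fun a ha b hb => hU.2.1 a (hle ha) b (hle hb), ?_, fun a ha => ?_, fun α hα a ha => ?_⟩
  · exact Submodule.mem_sInf.mpr fun T hT => hT.1.2 a (Submodule.mem_sInf.mp ha T hT) b
      (Submodule.mem_sInf.mp hb T hT) n
  · exact Submodule.mem_sInf.mpr fun T hT => hT.2.2.1
  · exact Submodule.mem_sInf.mpr fun T hT => hT.2.2.2.1 ha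
  · exact Submodule.mem_sInf.mpr fun T hT => hT.2.2.2.2 α hα a (Submodule.mem_sInf.mp ha T hT)

end Locality

/-! ### Cancelling linear forms in three variables. -/

section Cancellation

variable {M : Type*} [AddCommGroup M] [Module ℂ M] {D D' : ℤ → ℤ → ℤ → M}

/-- A property of the coefficients that passes to smaller exponents is stable under
multiplication by linear forms. -/
lemma op3_eq_zero_of {P : ℤ → ℤ → ℤ → Prop} (h₁ : ∀ i j k, P i j k → P (i - 1) j k)
    (h₂ : ∀ i j k, P i j k → P i (j - 1) k) (h₃ : ∀ i j k, P i j k → P i j (k - 1))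
    (hD : ∀ i j k, P i j k → D i j k = 0) (T : List (ℂ × ℂ × ℂ)) (i j k : ℤ) (h : P i j k) :
    op3 T D i j k = 0 := by
  induction T generalizing i j k with
  | nil => exact hD i j k h
  | cons c T ih =>
    rw [op3_cons, lin3_apply, ih _ _ _ (h₁ _ _ _ h), ih _ _ _ (h₂ _ _ _ h),
      ih _ _ _ (h₃ _ _ _ h)]
    simp

/-- In every quadrant `m ≤ m₀`, `n ≤ n₀`, the degrees `m + n` are bounded below. -/
def QuadrantBounded (D : ℤ → ℤ → ℤ → M) : Prop :=
  ∀ m₀ n₀ : ℤ, ∃ N : ℤ, ∀ m ≤ m₀, ∀ n ≤ n₀, m + n < N → D m n = 0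

namespace QuadrantBounded

lemma sub (h : QuadrantBounded D) (h' : QuadrantBounded D') : QuadrantBounded (D - D') := by
  intro m₀ n₀
  obtain ⟨N, hN⟩ := h m₀ n₀
  obtain ⟨N', hN'⟩ := h' m₀ n₀
  refine ⟨min N N', fun m hm n hn hmn => ?_⟩
  rw [Pi.sub_apply, Pi.sub_apply, hN m hm n hn (by omega), hN' m hm n hn (by omega), sub_zero]

lemma op3 (h : QuadrantBounded D) (T : List (ℂ × ℂ × ℂ)) : QuadrantBounded (op3 T D) := by
  intro m₀ n₀
  obtain ⟨N, hN⟩ := h m₀ n₀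
  refine ⟨N, fun m hm n hn hmn => funext fun l => ?_⟩
  refine op3_eq_zero_of (P := fun m n _ => m ≤ m₀ ∧ n ≤ n₀ ∧ m + n < N) ?_ ?_ ?_ ?_ T m n l
    ⟨hm, hn, hmn⟩
  · intro i j k hP
    omega
  · intro i j k hP
    omega
  · intro i j k hP
    exact hP
  · intro i j k hP
    rw [hN i hP.1 j hP.2.1 hP.2.2]
    rfl

/-- Only finitely many `n` lie between `N` and `n₀`, so their bounds have a common lower bound.
`Y(a, x₁) Y(b, x₂) c` is bounded in this way and the opposite product as in `of_fst`; quadrant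
boundedness is what survives for their difference. -/
lemma of_snd {N : ℤ} (hN : ∀ m n, n < N → D m n = 0)
    (h : ∀ n, ∃ B : ℤ, ∀ m < B, D m n = 0) : QuadrantBounded D := by
  intro m₀ n₀
  choose f hf using h
  obtain ⟨B, hB⟩ := ((Finset.Icc N n₀).image f).bddBelow
  refine ⟨B + N, fun m hm n hn hmn => ?_⟩
  rcases lt_or_ge n N with h | h
  · exact hN m n h
  · have := hB (Finset.mem_coe.mpr (Finset.mem_image_of_mem f (Finset.mem_Icc.mpr ⟨h, hn⟩)))
    exact hf n m (by omega)

lemma of_fst {N : ℤ} (hN : ∀ m n, m < N → D m n = 0)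
    (h : ∀ m, ∃ B : ℤ, ∀ n < B, D m n = 0) : QuadrantBounded D := by
  intro m₀ n₀
  obtain ⟨B, hB⟩ := of_snd (D := fun m n => D n m) (fun m n => hN n m) h n₀ m₀
  exact ⟨B, fun m hm n hn hmn => hB n hn m hm (by omega)⟩

/-- The coefficients at `(m, n)` are determined by those at `(m - 1, n)` and `(m, n - 1)`, which lie
in the same quadrant and have smaller degree. Forms without `x₃` escape this argument: `x₁ - x₂`
annihilates `x₂⁻¹ δ(x₁ / x₂)`, which is quadrant bounded. -/
lemma eq_zero_of_lin3 (h : QuadrantBounded D) {c : ℂ × ℂ × ℂ} (hc : c.2.2 ≠ 0)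
    (hD : lin3 c D = 0) : D = 0 := by
  have hD' : ∀ m n l,
      c.1 • D (m - 1) n l + c.2.1 • D m (n - 1) l + c.2.2 • D m n (l - 1) = 0 :=
    fun m n l => congrFun (congrFun₂ hD m n) l
  funext m₀ n₀
  obtain ⟨N, hN⟩ := h m₀ n₀
  have key : ∀ r : ℕ, ∀ m ≤ m₀, ∀ n ≤ n₀, m + n < N + r → D m n = 0 := by
    intro r
    induction r with
    | zero => simpa using hN
    | succ r ih =>
      intro m hm n hn hmn
      push_cast at hmn
      funext l
      have := hD' m n (l + 1)
      rw [ih (m - 1) (by omega) n hn (by omega), ih m hm (n - 1) (by omega) (by omega),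
        add_sub_cancel_right] at this
      simpa [hc] using this
  exact key (m₀ + n₀ - N + 1).toNat m₀ le_rfl n₀ le_rfl (by omega)

end QuadrantBounded

lemma eq_zero_of_lin3_fst {c : ℂ × ℂ × ℂ} (h₁ : c.1 ≠ 0) (h₂ : c.2.1 = 0) (h₃ : c.2.2 = 0)
    (hD : lin3 c D = 0) : D = 0 := by
  funext m n l
  have := congrFun (congrFun₂ hD (m + 1) n) l
  rw [lin3_apply, h₂, h₃, add_sub_cancel_right] at this
  simpa [h₁] using this

lemma eq_zero_of_lin3_snd {c : ℂ × ℂ × ℂ} (h₁ : c.1 = 0) (h₂ : c.2.1 ≠ 0) (h₃ : c.2.2 = 0)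
    (hD : lin3 c D = 0) : D = 0 := by
  funext m n l
  have := congrFun (congrFun₂ hD m (n + 1)) l
  rw [lin3_apply, h₁, h₃, add_sub_cancel_right] at this
  simpa [h₂] using this

/-- The exponents of the first variable are bounded below, and so are those of the second variable
for each exponent of the first. -/
def LexBounded (D : ℤ → ℤ → ℤ → M) : Prop :=
  (∃ N : ℤ, ∀ k < N, D k = 0) ∧ ∀ k, ∃ N : ℤ, ∀ n < N, D k n = 0

namespace LexBounded

lemma sub (h : LexBounded D) (h' : LexBounded D') : LexBounded (D - D') := by
  obtain ⟨⟨N, hN⟩, h⟩ := h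
  obtain ⟨⟨N', hN'⟩, h'⟩ := h'
  refine ⟨⟨min N N', fun k hk => ?_⟩, fun k => ?_⟩
  · rw [Pi.sub_apply, hN k (by omega), hN' k (by omega), sub_zero]
  · obtain ⟨B, hB⟩ := h k
    obtain ⟨B', hB'⟩ := h' k
    refine ⟨min B B', fun n hn => ?_⟩
    rw [Pi.sub_apply, Pi.sub_apply, hB n (by omega), hB' n (by omega), sub_zero]

lemma lin3 (h : LexBounded D) (c : ℂ × ℂ × ℂ) : LexBounded (lin3 c D) := by
  obtain ⟨⟨N, hN⟩, h⟩ := h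
  refine ⟨⟨N, fun k hk => ?_⟩, fun k => ?_⟩
  · funext n l
    simp [lin3_apply, hN k hk, hN (k - 1) (by omega)]
  · obtain ⟨B, hB⟩ := h k
    obtain ⟨B', hB'⟩ := h (k - 1)
    refine ⟨min B B', fun n hn => ?_⟩
    funext l
    simp [lin3_apply, hB n (by omega), hB (n - 1) (by omega), hB' n (by omega)]

lemma op3 (h : LexBounded D) (T : List (ℂ × ℂ × ℂ)) : LexBounded (op3 T D) := by
  induction T with
  | nil => exact h
  | cons c T ih => rw [op3_cons]; exact ih.lin3 c

/-- Induction on the first exponent leaves a form in the other two variables, to which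
`FstBounded.eq_zero_of_lin2` applies. Unlike in the quadrant bounded case, every nonzero form
cancels. -/
lemma eq_zero_of_lin3 (h : LexBounded D) {c : ℂ × ℂ × ℂ} (hc : c ≠ 0)
    (hD : GammaVA.lin3 c D = 0) : D = 0 := by
  by_cases hc2 : c.2 = 0
  · refine eq_zero_of_lin3_fst (fun h1 => hc (Prod.ext h1 hc2)) ?_ ?_ hD <;> rw [hc2] <;> rfl
  obtain ⟨⟨N, hN⟩, h⟩ := h
  have key : ∀ r : ℕ, ∀ k < N + r, D k = 0 := by
    intro r
    induction r with
    | zero => simpa using hN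
    | succ r ih =>
      intro k hk
      push_cast at hk
      refine FstBounded.eq_zero_of_lin2 (h k) hc2 ?_
      funext n l
      have := congrFun (congrFun₂ hD k n) l
      rw [lin3_apply, ih (k - 1) (by omega)] at this
      simpa [lin2_apply] using this
  funext k
  exact key (k - N + 1).toNat k (by omega)

lemma eq_zero_of_op3 (h : LexBounded D) {T : List (ℂ × ℂ × ℂ)} (hT : ∀ c ∈ T, c ≠ 0)
    (hD : GammaVA.op3 T D = 0) : D = 0 := by
  induction T with
  | nil => exact hD
  | cons c T ih =>
    rw [op3_cons] at hD
    exact ih (fun d hd => hT d (List.mem_cons_of_mem _ hd))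
      ((h.op3 T).eq_zero_of_lin3 (hT c List.mem_cons_self) hD)

end LexBounded

end Cancellation

/-! ### Triple products: locality and associativity of `Y_ℰ`. -/

section Triples

variable {W : Type*} [AddCommGroup W] [Module ℂ W]

/-- The product of the linear forms `x₁ - α x₂` for `α ∈ l₁₂`, `x₁ - α x₃` for `α ∈ l₁₃` and
`x₂ - α x₃` for `α ∈ l₂₃`. -/
def tripleForms (l₁₂ l₁₃ l₂₃ : List ℂˣ) : List (ℂ × ℂ × ℂ) :=
  (l₁₂.map rootForm).map embed12 ++
    ((l₁₃.map rootForm).map embed13 ++ (l₂₃.map rootForm).map embed23)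

lemma tripleForms_ne_zero {l₁₂ l₁₃ l₂₃ : List ℂˣ} {c : ℂ × ℂ × ℂ}
    (hc : c ∈ tripleForms l₁₂ l₁₃ l₂₃) : c ≠ 0 := by
  simp only [tripleForms, List.mem_append, List.mem_map, exists_exists_and_eq_and] at hc
  rcases hc with ⟨α, -, rfl⟩ | ⟨α, -, rfl⟩ | ⟨α, -, rfl⟩ <;>
    simp [embed12, embed13, embed23, rootForm]

lemma CommuteUpTo.op2_eq {a b : VertexOperator ℂ W} {l : List ℂˣ}
    (h : CommuteUpTo (linearProduct l) a b) (w : W) :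
    op2 (l.map rootForm) (fun m n => coeff a m (coeff b n w)) =
      op2 (l.map rootForm) fun m n => coeff b n (coeff a m w) := by
  refine (op2_apply _ (prodAB a b) w).trans (Eq.trans ?_ (op2_apply _ (prodBA a b) w).symm)
  rw [← polyMul_linearProduct, ← polyMul_linearProduct, h]

variable {a b c : VertexOperator ℂ W} {l₁₂ l₁₃ l₂₃ : List ℂˣ}

/-- The formal series `a(x₁) b(x₂) c(x₃) w`. -/
def prodABC (a b c : VertexOperator ℂ W) (w : W) : ℤ → ℤ → ℤ → W :=
  fun i j k => coeff a i (coeff b j (coeff c k w))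

/-- The formal series `b(x₂) a(x₁) c(x₃) w`. -/
def prodBAC (a b c : VertexOperator ℂ W) (w : W) : ℤ → ℤ → ℤ → W :=
  fun i j k => coeff b j (coeff a i (coeff c k w))

lemma op3_prodABC (hab : CommuteUpTo (linearProduct l₁₂) a b) (w : W) :
    op3 (tripleForms l₁₂ l₁₃ l₂₃) (prodABC a b c w) =
      op3 (tripleForms l₁₂ l₁₃ l₂₃) (prodBAC a b c w) := by
  have h : op3 ((l₁₂.map rootForm).map embed12) (prodABC a b c w) =
      op3 ((l₁₂.map rootForm).map embed12) (prodBAC a b c w) := by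
    funext i j k
    refine (congrFun₂ (op3_embed12 _ _ k) i j).trans
      (Eq.trans ?_ (congrFun₂ (op3_embed12 _ _ k) i j).symm)
    exact congrFun₂ (hab.op2_eq (coeff c k w)) i j
  rw [tripleForms, op3_append, op3_comm, h, op3_comm, ← op3_append]

/-- The locality factors allow each of the three fields to be moved next to `w`, where its exponents
are bounded below. -/
lemma truncated3_op3_prodABC (hab : CommuteUpTo (linearProduct l₁₂) a b)
    (hac : CommuteUpTo (linearProduct l₁₃) a c) (hbc : CommuteUpTo (linearProduct l₂₃) b c)
    (w : W) : Truncated3 (op3 (tripleForms l₁₂ l₁₃ l₂₃) (prodABC a b c w)) := by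
  have hb : op3 (tripleForms l₁₂ l₁₃ l₂₃) (prodABC a b c w) =
      op3 (tripleForms l₁₂ l₁₃ l₂₃)
        (fun i j k => coeff a i (coeff c k (coeff b j w))) := by
    have h : op3 ((l₂₃.map rootForm).map embed23) (prodABC a b c w) =
        op3 ((l₂₃.map rootForm).map embed23)
          (fun i j k => coeff a i (coeff c k (coeff b j w))) := by
      funext i
      rw [op3_embed23, op3_embed23]
      refine (op2_map (coeff a i) _ _).trans (Eq.trans ?_ (op2_map (coeff a i) _ _).symm)
      rw [hbc.op2_eq]
    rw [tripleForms, op3_append, op3_append, op3_append, op3_append, h]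
  have ha : op3 (tripleForms l₁₂ l₁₃ l₂₃) (prodABC a b c w) =
      op3 (tripleForms l₁₂ l₁₃ l₂₃)
        (fun i j k => coeff b j (coeff c k (coeff a i w))) := by
    have h : op3 ((l₁₃.map rootForm).map embed13) (prodBAC a b c w) =
        op3 ((l₁₃.map rootForm).map embed13)
          (fun i j k => coeff b j (coeff c k (coeff a i w))) := by
      funext i j k
      refine (congrFun₂ (op3_embed13 _ _ j) i k).trans
        (Eq.trans ?_ (congrFun₂ (op3_embed13 _ _ j) i k).symm)
      have e : op2 (l₁₃.map rootForm) (fun i k => coeff b j (coeff a i (coeff c k w))) =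
          op2 (l₁₃.map rootForm) fun i k => coeff b j (coeff c k (coeff a i w)) := by
        refine (op2_map (coeff b j) _ _).trans (Eq.trans ?_ (op2_map (coeff b j) _ _).symm)
        rw [hac.op2_eq]
      exact congrFun₂ e i k
    rw [op3_prodABC hab, tripleForms, op3_append, op3_append, op3_append, op3_append,
      op3_comm (List.map embed13 _), h, op3_comm (List.map embed13 _)]
  obtain ⟨Na, hNa⟩ := exists_coeff_eq_zero a w
  obtain ⟨Nb, hNb⟩ := exists_coeff_eq_zero b w
  obtain ⟨Nc, hNc⟩ := exists_coeff_eq_zero c w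
  refine ⟨min Na (min Nb Nc), fun i j k h => ?_⟩
  rcases h with h | h | h
  · rw [ha]
    refine op3_eq_zero_of (P := fun i _ _ => i < Na) ?_ ?_ ?_ ?_ _ i j k (by omega)
    · intros; omega
    · intros; assumption
    · intros; assumption
    · intro i j k hi
      simp only [hNa i hi, map_zero]
  · rw [hb]
    refine op3_eq_zero_of (P := fun _ j _ => j < Nb) ?_ ?_ ?_ ?_ _ i j k (by omega)
    · intros; assumption
    · intros; omega
    · intros; assumption
    · intro i j k hi
      simp only [hNb j hi, map_zero]
  · refine op3_eq_zero_of (P := fun _ _ k => k < Nc) ?_ ?_ ?_ ?_ _ i j k (by omega)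
    · intros; assumption
    · intros; assumption
    · intros; omega
    · intro i j k hi
      simp only [prodABC, hNc k hi, map_zero]

/-- `Y_ℰ(a, x₁) Y_ℰ(b, x₂) c(x) w`. -/
def iterYE (a b c : VertexOperator ℂ W) (w : W) : ℤ → ℤ → ℤ → W :=
  fun m n l => coeff ((YE a ((YE b c).coeff n)).coeff m) l w

/-- `Y_ℰ(b, x₂) Y_ℰ(a, x₁) c(x) w`. -/
def iterYESwap (a b c : VertexOperator ℂ W) (w : W) : ℤ → ℤ → ℤ → W :=
  fun m n l => coeff ((YE b ((YE a c).coeff m)).coeff n) l w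

/-- `Y_ℰ(Y_ℰ(a, x₀) b, x₂) c(x) w`. -/
def nestedYE (a b c : VertexOperator ℂ W) (w : W) : ℤ → ℤ → ℤ → W :=
  fun k n l => coeff ((YE ((YE a b).coeff k) c).coeff n) l w

/-- The inner product substitutes `x + x₂` for `x₂`, the outer one `x + x₁` for `x₁`. The list in
`h` may vary with `n`, yet a single multiplier serves for all `n`. -/
lemma op3_iterYE (hab : CommuteUpTo (linearProduct l₁₂) a b)
    (hac : CommuteUpTo (linearProduct l₁₃) a c) (hbc : CommuteUpTo (linearProduct l₂₃) b c)
    (h : ∀ n, ∃ l, CommuteUpTo (linearProduct l) a ((YE b c).coeff n)) (w : W) :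
    op3 (((tripleForms l₁₂ l₁₃ l₂₃).map shift23).map shift13) (iterYE a b c w) =
      taylor13 (taylor23 (op3 (tripleForms l₁₂ l₁₃ l₂₃) (prodABC a b c w))) := by
  have hA := truncated3_op3_prodABC hab hac hbc w
  have h1 : op3 ((tripleForms l₁₂ l₁₃ l₂₃).map shift23)
      (fun i n l => coeff a i (coeff ((YE b c).coeff n) l w)) =
      taylor23 (op3 (tripleForms l₁₂ l₁₃ l₂₃) (prodABC a b c w)) :=
    op3_eq_taylor23 (fun i => (isSubst_YE hbc w).map (coeff a i)) _ fun i => hA.slice1 i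
  rw [← h1]
  refine op3_eq_taylor13 (fun n => ?_) _ fun n => ?_
  · obtain ⟨l, hl⟩ := h n
    exact isSubst_YE hl w
  · rw [h1]
    exact hA.taylor23_slice2 n

lemma op3_iterYESwap (hab : CommuteUpTo (linearProduct l₁₂) a b)
    (hac : CommuteUpTo (linearProduct l₁₃) a c) (hbc : CommuteUpTo (linearProduct l₂₃) b c)
    (h : ∀ m, ∃ l, CommuteUpTo (linearProduct l) b ((YE a c).coeff m)) (w : W) :
    op3 (((tripleForms l₁₂ l₁₃ l₂₃).map shift13).map shift23) (iterYESwap a b c w) =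
      taylor23 (taylor13 (op3 (tripleForms l₁₂ l₁₃ l₂₃) (prodABC a b c w))) := by
  have hA := truncated3_op3_prodABC hab hac hbc w
  rw [op3_prodABC hab] at hA ⊢
  have h1 : op3 ((tripleForms l₁₂ l₁₃ l₂₃).map shift13)
      (fun m j l => coeff b j (coeff ((YE a c).coeff m) l w)) =
      taylor13 (op3 (tripleForms l₁₂ l₁₃ l₂₃) (prodBAC a b c w)) :=
    op3_eq_taylor13 (fun j => (isSubst_YE hac w).map (coeff b j)) _ fun j => hA.slice2 j
  rw [← h1]
  refine op3_eq_taylor23 (fun m => ?_) _ fun m => ?_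
  · obtain ⟨l, hl⟩ := h m
    exact isSubst_YE hl w
  · rw [h1]
    exact hA.taylor13_slice1 m

lemma op3_nestedYE (hab : CommuteUpTo (linearProduct l₁₂) a b)
    (hac : CommuteUpTo (linearProduct l₁₃) a c) (hbc : CommuteUpTo (linearProduct l₂₃) b c)
    (h : ∀ k, ∃ l, CommuteUpTo (linearProduct l) ((YE a b).coeff k) c) (w : W) :
    op3 (((tripleForms l₁₂ l₁₃ l₂₃).map shift12).map shift23) (nestedYE a b c w) =
      taylor23 (taylor12 (op3 (tripleForms l₁₂ l₁₃ l₂₃) (prodABC a b c w))) := by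
  have hA := truncated3_op3_prodABC hab hac hbc w
  have h1 : op3 ((tripleForms l₁₂ l₁₃ l₂₃).map shift12)
      (fun k j l => coeff ((YE a b).coeff k) j (coeff c l w)) =
      taylor12 (op3 (tripleForms l₁₂ l₁₃ l₂₃) (prodABC a b c w)) :=
    op3_eq_taylor12 (fun l => isSubst_YE hab (coeff c l w)) _ fun l => hA.slice3 l
  rw [← h1]
  refine op3_eq_taylor23 (fun k => ?_) _ fun k => ?_
  · obtain ⟨l, hl⟩ := h k
    exact isSubst_YE hl w
  · rw [h1]
    exact hA.taylor12_slice1 k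

lemma YE_zero_right (a : VertexOperator ℂ W) (k : ℤ) : (YE a 0).coeff k = 0 := by
  refine YE_coeff_eq (l := []) (Z := fun _ => 0) ?_ (fun w => ?_) k
  · rw [commuteUpTo_linearProduct_iff]
    funext m n
    simp [prodAB, prodBA]
  · simp only [map_zero, Pi.zero_apply, LinearMap.zero_apply]
    exact IsSubst.zero

lemma YE_zero_left (b : VertexOperator ℂ W) (k : ℤ) : (YE 0 b).coeff k = 0 := by
  refine YE_coeff_eq (l := []) (Z := fun _ => 0) ?_ (fun w => ?_) k
  · rw [commuteUpTo_linearProduct_iff]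
    funext m n
    simp [prodAB, prodBA]
  · simp only [map_zero, Pi.zero_apply, LinearMap.zero_apply]
    exact IsSubst.zero

lemma quadrantBounded_iterYE (a b c : VertexOperator ℂ W) (w : W) :
    QuadrantBounded (iterYE a b c w) := by
  obtain ⟨N, hN⟩ := (YE b c).fstBounded_coeff
  refine QuadrantBounded.of_snd (N := N) (fun m n hn => ?_) fun n => ?_
  · funext l
    simp only [iterYE]
    rw [hN n hn, YE_zero_right, map_zero]
    rfl
  · obtain ⟨B, hB⟩ := (YE a ((YE b c).coeff n)).fstBounded_coeff
    refine ⟨B, fun m hm => ?_⟩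
    funext l
    simp only [iterYE]
    rw [hB m hm, map_zero]
    rfl

lemma quadrantBounded_iterYESwap (a b c : VertexOperator ℂ W) (w : W) :
    QuadrantBounded (iterYESwap a b c w) := by
  obtain ⟨N, hN⟩ := (YE a c).fstBounded_coeff
  refine QuadrantBounded.of_fst (N := N) (fun m n hm => ?_) fun m => ?_
  · funext l
    simp only [iterYESwap]
    rw [hN m hm, YE_zero_right, map_zero]
    rfl
  · obtain ⟨B, hB⟩ := (YE b ((YE a c).coeff m)).fstBounded_coeff
    refine ⟨B, fun n hn => ?_⟩
    funext l
    simp only [iterYESwap]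
    rw [hB n hn, map_zero]
    rfl

lemma lexBounded_nestedYE (a b c : VertexOperator ℂ W) (w : W) :
    LexBounded (nestedYE a b c w) := by
  obtain ⟨N, hN⟩ := (YE a b).fstBounded_coeff
  refine ⟨⟨N, fun k hk => ?_⟩, fun k => ?_⟩
  · funext n l
    simp only [nestedYE]
    rw [hN k hk, YE_zero_left, map_zero]
    rfl
  · obtain ⟨B, hB⟩ := (YE ((YE a b).coeff k) c).fstBounded_coeff
    refine ⟨B, fun n hn => ?_⟩
    funext l
    simp only [nestedYE]
    rw [hB n hn, map_zero]
    rfl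

open Classical in
/-- The factors of `p(x + x₁, x + x₂)` that are not multiples of `x₁ - x₂` cancel. -/
lemma op3_filter_eq_zero {D : ℤ → ℤ → ℤ → W} (hD : QuadrantBounded D)
    (h : op3 (((tripleForms l₁₂ l₁₃ l₂₃).map shift23).map shift13) D = 0) :
    op3 (((l₁₂.filter fun α => α = 1).map rootForm).map embed12) D = 0 := by
  have h12 : ∀ (l : List ℂˣ) {D : ℤ → ℤ → ℤ → W}, QuadrantBounded D →
      op3 (((((l.map rootForm).map embed12)).map shift23).map shift13) D = 0 →
      op3 (((l.filter fun α => α = 1).map rootForm).map embed12) D = 0 := by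
    intro l
    induction l with
    | nil => exact fun _ h => h
    | cons α l ih =>
      intro D hD h
      simp only [List.map_cons, op3_cons] at h
      -- The shifted factor is `x₁ - α x₂ + (1 - α) x`. It is retained for `α = 1` and otherwise
      -- cancels, its coefficient of `x` being nonzero.
      by_cases hα : α = 1
      · rw [List.filter_cons_of_pos (by simpa using hα), List.map_cons, List.map_cons, op3_cons,
          lin3_op3]
        have e : shift13 (shift23 (embed12 (rootForm α))) = embed12 (rootForm α) := by
          simp [shift13, shift23, embed12, rootForm, hα]
        rw [e, lin3_op3] at h
        exact ih (by simpa [op3] using hD.op3 [embed12 (rootForm α)]) h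
      · rw [List.filter_cons_of_neg (by simpa using hα)]
        refine ih hD ((hD.op3 _).eq_zero_of_lin3 ?_ h)
        simp only [shift13, shift23, embed12, rootForm]
        intro h0
        refine hα (Units.ext ?_)
        rw [Units.val_one]
        linear_combination -h0
  have h13 : ∀ (l : List ℂˣ) {D : ℤ → ℤ → ℤ → W}, QuadrantBounded D →
      op3 (((((l.map rootForm).map embed13)).map shift23).map shift13) D = 0 → D = 0 := by
    intro l D hD h
    induction l with
    | nil => exact h
    | cons α l ih =>
      simp only [List.map_cons, op3_cons] at h
      -- The shifted factor is `x₁ + (1 - α) x`, which cancels in either case; for `α = 1` it is the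
      -- invertible monomial `x₁`.
      by_cases hα : α = 1
      · refine ih (eq_zero_of_lin3_fst ?_ ?_ ?_ h) <;>
          simp [shift13, shift23, embed13, rootForm, hα]
      · refine ih ((hD.op3 _).eq_zero_of_lin3 ?_ h)
        simp only [shift13, shift23, embed13, rootForm]
        intro h0
        refine hα (Units.ext ?_)
        rw [Units.val_one]
        linear_combination -h0
  have h23 : ∀ (l : List ℂˣ) {D : ℤ → ℤ → ℤ → W}, QuadrantBounded D →
      op3 (((((l.map rootForm).map embed23)).map shift23).map shift13) D = 0 → D = 0 := by
    intro l D hD h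
    induction l with
    | nil => exact h
    | cons α l ih =>
      simp only [List.map_cons, op3_cons] at h
      by_cases hα : α = 1
      · refine ih (eq_zero_of_lin3_snd ?_ ?_ ?_ h) <;>
          simp [shift13, shift23, embed23, rootForm, hα]
      · refine ih ((hD.op3 _).eq_zero_of_lin3 ?_ h)
        simp only [shift13, shift23, embed23, rootForm]
        intro h0
        refine hα (Units.ext ?_)
        rw [Units.val_one]
        linear_combination -h0
  simp only [tripleForms, List.map_append, op3_append] at h
  have h1 := h12 l₁₂ ((hD.op3 _).op3 _) h
  rw [op3_comm, op3_comm _ _ D] at h1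
  exact h23 l₂₃ (hD.op3 _) (h13 l₁₃ ((hD.op3 _).op3 _) h1)

lemma shift13_shift23 (T : List (ℂ × ℂ × ℂ)) :
    (T.map shift23).map shift13 = (T.map shift13).map shift23 := by
  rw [List.map_map, List.map_map]
  refine List.map_congr_left fun c _ => ?_
  simp only [Function.comp_apply, shift13, shift23]
  rw [add_left_comm]

lemma shift12_shift13_shift23 (T : List (ℂ × ℂ × ℂ)) :
    ((T.map shift23).map shift13).map shift12 = (T.map shift12).map shift23 := by
  rw [List.map_map, List.map_map, List.map_map]
  refine List.map_congr_left fun c _ => ?_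
  simp only [Function.comp_apply, shift12, shift13, shift23]
  rw [add_assoc]

open Classical in
/-- Locality of `Y_ℰ(a, x₁)` and `Y_ℰ(b, x₂)`. -/
lemma op3_iterYE_eq_swap (hab : CommuteUpTo (linearProduct l₁₂) a b)
    (hac : CommuteUpTo (linearProduct l₁₃) a c) (hbc : CommuteUpTo (linearProduct l₂₃) b c)
    (h : ∀ n, ∃ l, CommuteUpTo (linearProduct l) a ((YE b c).coeff n))
    (h' : ∀ m, ∃ l, CommuteUpTo (linearProduct l) b ((YE a c).coeff m)) (w : W) :
    op3 (((l₁₂.filter fun α => α = 1).map rootForm).map embed12)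
      (iterYE a b c w - iterYESwap a b c w) = 0 := by
  refine op3_filter_eq_zero (l₁₃ := l₁₃) (l₂₃ := l₂₃)
    ((quadrantBounded_iterYE a b c w).sub (quadrantBounded_iterYESwap a b c w)) ?_
  rw [map_sub, op3_iterYE hab hac hbc h, shift13_shift23, op3_iterYESwap hab hac hbc h',
    taylor13_taylor23_comm (truncated3_op3_prodABC hab hac hbc w), sub_self]

/-- Weak associativity of `Y_ℰ`. -/
lemma eq_nestedYE (hab : CommuteUpTo (linearProduct l₁₂) a b)
    (hac : CommuteUpTo (linearProduct l₁₃) a c) (hbc : CommuteUpTo (linearProduct l₂₃) b c)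
    (h : ∀ n, ∃ l, CommuteUpTo (linearProduct l) a ((YE b c).coeff n))
    (h' : ∀ k, ∃ l, CommuteUpTo (linearProduct l) ((YE a b).coeff k) c) (w : W)
    {S : ℤ → ℤ → ℤ → W} (hS : LexBounded S)
    (hS' : ∀ l, IsSubst (fun m n => iterYE a b c w m n l) fun k n => S k n l) :
    S = nestedYE a b c w := by
  have hA := truncated3_op3_prodABC hab hac hbc w
  have h1 := op3_eq_taylor12 hS' (((tripleForms l₁₂ l₁₃ l₂₃).map shift23).map shift13)
    -- After both substitutions only nonnegative powers of `x₁` and `x₂` remain.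
    (fun l => by
      rw [op3_iterYE hab hac hbc h]
      refine ⟨0, fun m n hmn => ?_⟩
      rcases hmn with hm | hn
      · exact taylorSubst_of_neg _ hm _
      · exact taylorSubst_eq_zero fun i => taylorSubst_of_neg _ hn _)
  rw [op3_iterYE hab hac hbc h, taylor12_taylor13_taylor23 hA, shift12_shift13_shift23,
    ← op3_nestedYE hab hac hbc h', ← sub_eq_zero, ← map_sub] at h1
  refine sub_eq_zero.mp ((hS.sub (lexBounded_nestedYE a b c w)).eq_zero_of_op3 (fun d hd => ?_) h1)
  simp only [List.mem_map, exists_exists_and_eq_and] at hd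
  obtain ⟨e, he, rfl⟩ := hd
  -- The combined shift of linear forms is unitriangular, hence injective.
  have := tripleForms_ne_zero he
  intro h0
  simp only [shift12, shift23, Prod.mk_eq_zero] at h0
  obtain ⟨h0, h1, h2⟩ := h0
  rw [h0, zero_add] at h1
  rw [h0, h1, zero_add, zero_add] at h2
  exact this (Prod.ext h0 (Prod.ext h1 h2))

end Triples

/-! ### Bilinearity, vacuum and rescaling for `Y_ℰ`. -/

section ClosedSubspaces

variable {W : Type*} [AddCommGroup W] [Module ℂ W]

/-- `YE` takes the value zero on pairs that are not quasi-local, so additivity needs a locality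
relation for each of the three pairs. -/
lemma YE_coeff_add_right {a b b' : VertexOperator ℂ W} {l l' l'' : List ℂˣ}
    (h : CommuteUpTo (linearProduct l) a b) (h' : CommuteUpTo (linearProduct l') a b')
    (h'' : CommuteUpTo (linearProduct l'') a (b + b')) (k : ℤ) :
    (YE a (b + b')).coeff k = (YE a b).coeff k + (YE a b').coeff k := by
  refine YE_coeff_eq h'' (Z := fun k => (YE a b).coeff k + (YE a b').coeff k) (fun w => ?_) k
  simp only [map_add, Pi.add_apply, LinearMap.add_apply]
  exact (isSubst_YE h w).add (isSubst_YE h' w)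

lemma YE_coeff_add_left {a a' b : VertexOperator ℂ W} {l l' l'' : List ℂˣ}
    (h : CommuteUpTo (linearProduct l) a b) (h' : CommuteUpTo (linearProduct l') a' b)
    (h'' : CommuteUpTo (linearProduct l'') (a + a') b) (k : ℤ) :
    (YE (a + a') b).coeff k = (YE a b).coeff k + (YE a' b).coeff k := by
  refine YE_coeff_eq h'' (Z := fun k => (YE a b).coeff k + (YE a' b).coeff k) (fun w => ?_) k
  simp only [map_add, Pi.add_apply, LinearMap.add_apply]
  exact (isSubst_YE h w).add (isSubst_YE h' w)

lemma YE_coeff_smul_right {a b : VertexOperator ℂ W} {l l' : List ℂˣ} (r : ℂ)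
    (h : CommuteUpTo (linearProduct l) a b) (h' : CommuteUpTo (linearProduct l') a (r • b))
    (k : ℤ) : (YE a (r • b)).coeff k = r • (YE a b).coeff k := by
  refine YE_coeff_eq h' (Z := fun k => r • (YE a b).coeff k) (fun w => ?_) k
  simp only [map_smul, Pi.smul_apply, LinearMap.smul_apply]
  exact (isSubst_YE h w).smul r

lemma YE_coeff_smul_left {a b : VertexOperator ℂ W} {l l' : List ℂˣ} (r : ℂ)
    (h : CommuteUpTo (linearProduct l) a b) (h' : CommuteUpTo (linearProduct l') (r • a) b)
    (k : ℤ) : (YE (r • a) b).coeff k = r • (YE a b).coeff k := by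
  refine YE_coeff_eq h' (Z := fun k => r • (YE a b).coeff k) (fun w => ?_) k
  simp only [map_smul, Pi.smul_apply, LinearMap.smul_apply]
  exact (isSubst_YE h w).smul r

lemma coeff_idField (n : ℤ) : coeff (idField W) n = if n = 0 then LinearMap.id else 0 := rfl

lemma commuteUpTo_idField_left (a : VertexOperator ℂ W) :
    CommuteUpTo (linearProduct []) (idField W) a := by
  rw [commuteUpTo_linearProduct_iff]
  funext m n
  simp only [prodAB, prodBA, coeff_idField, List.map_nil, op2_nil, Pi.sub_apply]
  split_ifs
  · exact sub_self _
  · simp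

lemma commuteUpTo_idField_right (a : VertexOperator ℂ W) :
    CommuteUpTo (linearProduct []) a (idField W) := by
  rw [commuteUpTo_linearProduct_iff]
  funext m n
  simp only [prodAB, prodBA, coeff_idField, List.map_nil, op2_nil, Pi.sub_apply]
  split_ifs
  · exact sub_self _
  · simp

lemma ichoose_zero_left (k : ℤ) : ichoose 0 k = if k = 0 then 1 else 0 := by
  rcases lt_or_ge k 0 with hk | hk
  · rw [ichoose_of_neg _ hk, if_neg (by omega)]
  · lift k to ℕ using hk
    rw [ichoose_natCast, Ring.choose_zero_ite]
    simp

lemma YE_idField_left (b : VertexOperator ℂ W) (k : ℤ) :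
    (YE (idField W) b).coeff k = if k = 0 then b else 0 := by
  refine YE_coeff_eq (commuteUpTo_idField_left b) (Z := fun k => if k = 0 then b else 0)
    (fun w => ?_) k
  have ht : Truncated fun m n => coeff (idField W) m (coeff b n w) := by
    obtain ⟨N, hN⟩ := exists_coeff_eq_zero b w
    refine ⟨min N 0, fun m n h => ?_⟩
    simp only [coeff_idField]
    split_ifs
    · exact hN n (by omega)
    · rfl
  convert IsSubst.of_truncated ht using 1
  funext k l
  rw [taylorSubst_eq_sum (s := {0})]
  · rw [Finset.sum_singleton, coeff_idField, if_pos rfl, ichoose_zero_left]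
    split_ifs with h
    · simp [h]
    · simp
  · intro m hm
    rw [coeff_idField, if_neg (by simpa using hm)]
    rfl

/-- These are the coefficients of `a(x + x₀)`. The creation property can be read off: no negative
powers of `x₀`, and constant term `a(x)`. -/
lemma coeff_YE_idField_right (a : VertexOperator ℂ W) (k l : ℤ) (w : W) :
    coeff ((YE a (idField W)).coeff k) l w = ichoose (l + k) k • coeff a (l + k) w := by
  have ht : Truncated fun m n => coeff a m (coeff (idField W) n w) := by
    obtain ⟨N, hN⟩ := exists_coeff_eq_zero a w
    refine ⟨min N 0, fun m n h => ?_⟩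
    simp only [coeff_idField]
    split_ifs
    · exact hN m (by omega)
    · exact map_zero _
  rw [congrFun₂ ((isSubst_YE (commuteUpTo_idField_right a) w).unique (.of_truncated ht)) k l,
    taylorSubst_eq_sum (s := {l + k})]
  · rw [Finset.sum_singleton, coeff_idField, if_pos (by omega)]
    rfl
  · intro m hm
    rw [Finset.mem_singleton] at hm
    rw [coeff_idField, if_neg (by omega)]
    exact map_zero _

lemma coeff_rescale (α : ℂˣ) (a : VertexOperator ℂ W) (n : ℤ) :
    coeff (rescale α a) n = ((α ^ n : ℂˣ) : ℂ) • coeff a n := rfl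

/-- The substitution is homogeneous, so scaling `x₁`, `x₂` scales `x₀`, `x`. Each linear form
contributes the same factor `α⁻¹` on both sides. -/
lemma isSubst_rescale (α : ℂˣ) {M : Type*} [AddCommGroup M] [Module ℂ M] {F Z : ℤ → ℤ → M}
    (h : IsSubst F Z) : IsSubst (fun m n => ((α ^ (m + n) : ℂˣ) : ℂ) • F m n)
      fun k l => ((α ^ (k + l) : ℂˣ) : ℂ) • Z k l := by
  have key : ∀ (L : List (ℂ × ℂ)) (G : ℤ → ℤ → M),
      op2 L (fun m n => ((α ^ (m + n) : ℂˣ) : ℂ) • G m n) =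
        ((α : ℂ)⁻¹ ^ L.length) • fun m n => ((α ^ (m + n) : ℂˣ) : ℂ) • op2 L G m n := by
    intro L G
    induction L with
    | nil => simp
    | cons c L ih =>
      rw [op2_cons, op2_cons, ih, map_smul, List.length_cons, pow_succ, mul_smul]
      congr 1
      funext m n
      simp only [lin2_apply, Pi.smul_apply, smul_add, smul_smul]
      rw [show m - 1 + n = m + n - 1 by ring, show m + (n - 1) = m + n - 1 by ring, zpow_sub_one,
        Units.val_mul, Units.val_inv_eq_inv_val]
      congr 2 <;> ring
  obtain ⟨⟨N, hN⟩, L, hL, ⟨B, hB⟩, he⟩ := h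
  refine ⟨⟨N, fun k hk => ?_⟩, L, hL, ⟨B, fun m n hmn => ?_⟩, ?_⟩
  · funext l
    simp only [hN k hk, Pi.zero_apply, smul_zero]
  · simp only [key, Pi.smul_apply, hB m n hmn, smul_zero]
  · rw [key, key, taylorSubst_smul, he, List.length_map]
    congr 1
    funext k l
    rw [taylorSubst, taylorSubst, smul_finsum]
    refine finsum_congr fun m => ?_
    rw [smul_comm, show m + (l + k - m) = k + l by ring]

/-- `R_α` is an automorphism of the products, up to the scaling of `x₀`. -/
lemma rescale_YE_coeff {α : ℂˣ} {a b : VertexOperator ℂ W} {l l' : List ℂˣ}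
    (h : CommuteUpTo (linearProduct l) a b)
    (h' : CommuteUpTo (linearProduct l') (rescale α a) (rescale α b)) (k : ℤ) :
    (YE (rescale α a) (rescale α b)).coeff k =
      ((α ^ k : ℂˣ) : ℂ) • rescale α ((YE a b).coeff k) := by
  refine YE_coeff_eq h'
    (Z := fun k => ((α ^ k : ℂˣ) : ℂ) • rescale α ((YE a b).coeff k)) (fun w => ?_) k
  convert isSubst_rescale α (isSubst_YE h w) using 1
  · funext m n
    rw [coeff_rescale, coeff_rescale, LinearMap.smul_apply, LinearMap.smul_apply, map_smul,
      smul_smul, zpow_add, Units.val_mul]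
  · funext m n
    rw [map_smul, Pi.smul_apply, coeff_rescale, LinearMap.smul_apply, LinearMap.smul_apply,
      smul_smul, zpow_add, Units.val_mul]

end ClosedSubspaces

/-! ### The operators `Y_ℰ(a, x₀)` as fields on the space itself. -/

/-- A closed `Γ`-local space of fields, containing the identity and stable under `Γ`, presented as
an abstract vector space with an embedding `ι` in `ℰ(W)`. -/
structure FieldAlgebra (Γ : Subgroup ℂˣ) (V W : Type*) [AddCommGroup V] [Module ℂ V]
    [AddCommGroup W] [Module ℂ W] where
  ι : V →ₗ[ℂ] VertexOperator ℂ W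
  ι_injective : Function.Injective ι
  isLocal : ∀ a b, GammaLocalPair Γ (ι a) (ι b)
  prod : V → V → ℤ → V
  ι_prod : ∀ a b k, ι (prod a b k) = (YE (ι a) (ι b)).coeff k
  vac : V
  ι_vac : ι vac = idField W
  act : Γ → V → V
  ι_act : ∀ α a, ι (act α a) = rescale α (ι a)

namespace FieldAlgebra

variable {Γ : Subgroup ℂˣ} {V W : Type*} [AddCommGroup V] [Module ℂ V]
    [AddCommGroup W] [Module ℂ W] (A : FieldAlgebra Γ V W)

lemma commute (a b : V) : ∃ l, CommuteUpTo (linearProduct l) (A.ι a) (A.ι b) :=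
  (A.isLocal a b).imp fun _ h => h.2

/-- The coefficient of `x₀ ^ k` in the operator `Y_ℰ(a, x₀)`. -/
def YCoeff (a : V) (k : ℤ) : Module.End ℂ V where
  toFun b := A.prod a b k
  map_add' b b' := by
    apply A.ι_injective
    obtain ⟨l, h⟩ := A.commute a b
    obtain ⟨l', h'⟩ := A.commute a b'
    obtain ⟨l'', h''⟩ := A.commute a (b + b')
    rw [map_add] at h''
    rw [map_add, A.ι_prod, A.ι_prod, A.ι_prod, map_add, YE_coeff_add_right h h' h'']
  map_smul' r b := by
    apply A.ι_injective
    obtain ⟨l, h⟩ := A.commute a b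
    obtain ⟨l', h'⟩ := A.commute a (r • b)
    rw [map_smul] at h'
    rw [RingHom.id_apply, map_smul, A.ι_prod, A.ι_prod, map_smul, YE_coeff_smul_right r h h']

lemma YCoeff_apply (a b : V) (k : ℤ) : A.YCoeff a k b = A.prod a b k := rfl

/-- The operator `Y_ℰ(a, x₀)`. -/
def YField (a : V) : VertexOperator ℂ V :=
  VertexOperator.of_coeff (A.YCoeff a) fun b => by
    obtain ⟨N, hN⟩ := (YE (A.ι a) (A.ι b)).fstBounded_coeff
    refine bddBelow_of_forall_lt ⟨N, fun k hk => A.ι_injective ?_⟩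
    rw [YCoeff_apply, A.ι_prod, hN k hk, map_zero]

lemma coeff_YField (a : V) : coeff (A.YField a) = A.YCoeff a := rfl

/-- The map `Y_ℰ`. -/
def Y : V →ₗ[ℂ] VertexOperator ℂ V where
  toFun := A.YField
  map_add' a a' := by
    refine HVertexOperator.coeff_inj (funext fun k => LinearMap.ext fun b => A.ι_injective ?_)
    obtain ⟨l, h⟩ := A.commute a b
    obtain ⟨l', h'⟩ := A.commute a' b
    obtain ⟨l'', h''⟩ := A.commute (a + a') b
    rw [map_add] at h''
    rw [map_add, Pi.add_apply, coeff_YField, coeff_YField, coeff_YField, LinearMap.add_apply,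
      YCoeff_apply, YCoeff_apply, YCoeff_apply, map_add, A.ι_prod, A.ι_prod, A.ι_prod, map_add,
      YE_coeff_add_left h h' h'']
  map_smul' r a := by
    refine HVertexOperator.coeff_inj (funext fun k => LinearMap.ext fun b => A.ι_injective ?_)
    obtain ⟨l, h⟩ := A.commute a b
    obtain ⟨l', h'⟩ := A.commute (r • a) b
    rw [map_smul] at h'
    rw [RingHom.id_apply, map_smul, Pi.smul_apply, coeff_YField, coeff_YField, LinearMap.smul_apply,
      YCoeff_apply, YCoeff_apply, map_smul, A.ι_prod, A.ι_prod, map_smul,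
      YE_coeff_smul_left r h h']

lemma ι_coeff_Y (a b : V) (k : ℤ) : A.ι (coeff (A.Y a) k b) = (YE (A.ι a) (A.ι b)).coeff k :=
  A.ι_prod a b k

/-- The coefficient functional `c(x) ↦ c_l w`. -/
def coeffEval (l : ℤ) (w : W) : V →ₗ[ℂ] W where
  toFun c := coeff (A.ι c) l w
  map_add' c c' := by simp only [map_add, Pi.add_apply, LinearMap.add_apply]
  map_smul' r c := by
    simp only [map_smul, Pi.smul_apply, LinearMap.smul_apply, RingHom.id_apply]

lemma coeffEval_apply (l : ℤ) (w : W) (c : V) : A.coeffEval l w c = coeff (A.ι c) l w := rfl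

lemma ext_coeffEval {c c' : V} (h : ∀ l w, A.coeffEval l w c = A.coeffEval l w c') : c = c' :=
  A.ι_injective (HVertexOperator.coeff_inj (funext fun l => LinearMap.ext fun w => h l w))

lemma coeffEval_Y_Y (a b c : V) (m n l : ℤ) (w : W) :
    A.coeffEval l w (coeff (A.Y a) m (coeff (A.Y b) n c)) =
      iterYE (A.ι a) (A.ι b) (A.ι c) w m n l := by
  rw [coeffEval_apply, ι_coeff_Y, ι_coeff_Y]
  rfl

lemma coeffEval_Y_Y_swap (a b c : V) (m n l : ℤ) (w : W) :
    A.coeffEval l w (coeff (A.Y b) n (coeff (A.Y a) m c)) =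
      iterYESwap (A.ι a) (A.ι b) (A.ι c) w m n l := by
  rw [coeffEval_apply, ι_coeff_Y, ι_coeff_Y]
  rfl

lemma commute_YE_right (a b c : V) (n : ℤ) :
    ∃ l, CommuteUpTo (linearProduct l) (A.ι a) ((YE (A.ι b) (A.ι c)).coeff n) := by
  rw [← A.ι_prod]
  exact A.commute _ _

lemma commute_YE_left (a b c : V) (n : ℤ) :
    ∃ l, CommuteUpTo (linearProduct l) ((YE (A.ι a) (A.ι b)).coeff n) (A.ι c) := by
  rw [← A.ι_prod]
  exact A.commute _ _

/-- The vertex operators on a `Γ`-local space of fields are local. -/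
lemma exists_commuteUpTo_Y (a b : V) : ∃ l : List ℂˣ, (∀ α ∈ l, α = 1) ∧
    CommuteUpTo (linearProduct l) (A.Y a) (A.Y b) := by
  classical
  obtain ⟨l₁₂, hab⟩ := A.commute a b
  -- The lists `l₁₃` and `l₂₃` chosen below depend on `c`, but they cancel; the surviving list
  -- depends only on `a` and `b`, so one power of `x₁ - x₂` works on all of `V`.
  refine ⟨l₁₂.filter fun α => α = 1, fun α hα => by simpa using (List.mem_filter.mp hα).2, ?_⟩
  rw [commuteUpTo_linearProduct_iff]
  funext m n
  refine LinearMap.ext fun c => A.ext_coeffEval fun l w => ?_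
  obtain ⟨l₁₃, hac⟩ := A.commute a c
  obtain ⟨l₂₃, hbc⟩ := A.commute b c
  have h := op3_iterYE_eq_swap hab hac hbc (A.commute_YE_right a b c) (A.commute_YE_right b a c) w
  have h1 := congrFun₂ (op3_embed12 ((l₁₂.filter fun α => α = 1).map rootForm)
    (iterYE (A.ι a) (A.ι b) (A.ι c) w - iterYESwap (A.ι a) (A.ι b) (A.ι c) w) l) m n
  rw [h] at h1
  have h2 := congrFun₂ (op2_apply ((l₁₂.filter fun α => α = 1).map rootForm)
    (prodAB (A.Y a) (A.Y b) - prodBA (A.Y a) (A.Y b)) c) m n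
  rw [← h2]
  have h3 := congrFun₂ (op2_map (A.coeffEval l w) ((l₁₂.filter fun α => α = 1).map rootForm)
    (fun m n => (prodAB (A.Y a) (A.Y b) - prodBA (A.Y a) (A.Y b)) m n c)) m n
  rw [← h3]
  refine Eq.trans (Eq.trans ?_ h1.symm) (map_zero (A.coeffEval l w)).symm
  have e : (fun m n => A.coeffEval l w ((prodAB (A.Y a) (A.Y b) - prodBA (A.Y a) (A.Y b)) m n c)) =
      fun m n => (iterYE (A.ι a) (A.ι b) (A.ι c) w - iterYESwap (A.ι a) (A.ι b) (A.ι c) w) m n l := by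
    funext m n
    rw [Pi.sub_apply, Pi.sub_apply, LinearMap.sub_apply, map_sub]
    exact congrArg₂ _ (A.coeffEval_Y_Y a b c m n l w) (A.coeffEval_Y_Y_swap a b c m n l w)
  rw [e]

/-- `Y_ℰ` is a homomorphism from the products on `V` to the products on `ℰ(V)`. -/
lemma YE_Y_coeff (a b : V) (k : ℤ) : (YE (A.Y a) (A.Y b)).coeff k = A.Y (A.prod a b k) := by
  obtain ⟨l, -, hl⟩ := A.exists_commuteUpTo_Y a b
  refine HVertexOperator.coeff_inj (funext fun n => LinearMap.ext fun c =>
    A.ext_coeffEval fun i w => ?_)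
  obtain ⟨l₁₂, hab⟩ := A.commute a b
  obtain ⟨l₁₃, hac⟩ := A.commute a c
  obtain ⟨l₂₃, hbc⟩ := A.commute b c
  -- The product is formed in `ℰ(V)`, which is meaningful because `Y a` and `Y b` are now known to
  -- be local. Its coefficients on `c`, evaluated at `w`, meet the hypotheses of `eq_nestedYE`.
  let S : ℤ → ℤ → ℤ → W := fun k n i =>
    A.coeffEval i w (coeff ((YE (A.Y a) (A.Y b)).coeff k) n c)
  have hS : LexBounded S := by
    obtain ⟨N, hN⟩ := (YE (A.Y a) (A.Y b)).fstBounded_coeff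
    refine ⟨⟨N, fun k hk => ?_⟩, fun k => ?_⟩
    · funext n i
      simp only [S, hN k hk, map_zero, Pi.zero_apply, LinearMap.zero_apply]
    · obtain ⟨B, hB⟩ := exists_coeff_eq_zero ((YE (A.Y a) (A.Y b)).coeff k) c
      refine ⟨B, fun n hn => ?_⟩
      funext i
      simp only [S, hB n hn, map_zero, Pi.zero_apply]
  have hS' : ∀ i, IsSubst (fun m n => iterYE (A.ι a) (A.ι b) (A.ι c) w m n i)
      fun k n => S k n i := by
    intro i
    have := (isSubst_YE hl c).map (A.coeffEval i w)
    simpa only [coeffEval_Y_Y] using this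
  have h := eq_nestedYE hab hac hbc (A.commute_YE_right a b c) (A.commute_YE_left a b c) w hS hS'
  have h1 : S k n i = nestedYE (A.ι a) (A.ι b) (A.ι c) w k n i := by rw [h]
  refine h1.trans ?_
  rw [coeffEval_apply, ι_coeff_Y, A.ι_prod]
  rfl

end FieldAlgebra

/-! ### Binomial identities behind the Jacobi identity. -/

section Binomial

lemma ichoose_neg (r s : ℤ) : ichoose (-r) s = s.negOnePow * ichoose (r + s - 1) s := by
  rcases lt_or_ge s 0 with hs | hs
  · rw [ichoose_of_neg _ hs, ichoose_of_neg _ hs, mul_zero]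
  · lift s to ℕ using hs
    rw [ichoose_natCast, ichoose_natCast, Ring.choose_neg]
    simp [Units.smul_def]

lemma ichoose_symm {n : ℤ} (hn : 0 ≤ n) (k : ℤ) : ichoose n (n - k) = ichoose n k := by
  rcases lt_or_ge k 0 with hk | hk
  · rw [ichoose_of_neg _ hk]
    lift n to ℕ using hn
    obtain ⟨r, hr⟩ : ∃ r : ℕ, (n : ℤ) - k = r := ⟨(n - k).toNat, by omega⟩
    rw [hr, ichoose_natCast, Ring.choose_natCast, Nat.choose_eq_zero_of_lt (by omega)]
    rfl
  · lift k to ℕ using hk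
    lift n to ℕ using hn
    rcases lt_or_ge n k with h | h
    · rw [ichoose_of_neg _ (by omega), ichoose_natCast, Ring.choose_natCast,
        Nat.choose_eq_zero_of_lt h]
      rfl
    · rw [← Nat.cast_sub h, ichoose_natCast, ichoose_natCast, Ring.choose_natCast,
        Ring.choose_natCast, Nat.choose_symm h]

lemma negOnePow_mul_self (n : ℤ) : (n.negOnePow : ℤ) * n.negOnePow = 1 := by
  rw [← Units.val_mul, ← Int.negOnePow_add, ← two_mul, Int.negOnePow_two_mul, Units.val_one]

/-- The coefficients of `(x₁ - x₂) ^ n` expanded in the two possible ways. -/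
lemma ichoose_sub_ichoose (n d : ℤ) :
    (d + n).negOnePow * (ichoose n (d + n) - ichoose n (-d)) = ichoose (d - 1) (-n - 1) := by
  rcases lt_or_ge n 0 with hn | hn
  · obtain ⟨N, rfl⟩ : ∃ N, n = -(N + 1) := ⟨-n - 1, by ring⟩
    have hN : 0 ≤ N := by omega
    rw [show -(-(N + 1)) - 1 = N by ring]
    -- The two expansions of a negative power have disjoint supports, `d ≥ -n` and `d ≤ 0`, so at
    -- most one term contributes.
    rcases lt_or_ge 0 d with hd | hd
    · rw [ichoose_of_neg _ (by omega : -d < 0), sub_zero, ichoose_neg, ← mul_assoc,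
        negOnePow_mul_self, one_mul, show N + 1 + (d + -(N + 1)) - 1 = d - 1 by ring,
        show d + -(N + 1) = d - 1 - N by ring, ichoose_symm (by omega)]
    · rw [ichoose_of_neg _ (by omega : d + -(N + 1) < 0), zero_sub, ichoose_neg,
        show d - 1 = -(1 - d) by ring, ichoose_neg, show N + 1 + -d - 1 = N - d by ring,
        show 1 - d + N - 1 = N - d by ring, show -d = N - d - N by ring,
        ichoose_symm (by omega : 0 ≤ N - d), mul_neg, ← mul_assoc, ← neg_mul]
      congr 1
      rw [← Units.val_mul, ← Int.negOnePow_add, show d + -(N + 1) + (N - d - N) = -(N + 1) by ring,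
        Int.negOnePow_neg, Int.negOnePow_succ]
      simp
  -- For `n ≥ 0` both expansions are the same polynomial.
  · rw [ichoose_of_neg _ (by omega : -n - 1 < 0), show d + n = n - -d by ring, ichoose_symm hn,
      sub_self, mul_zero]

/-- The delta function identity for the coefficient at `x₁ ^ i`. The sign turns `ichoose (j + s) s`
into `ichoose (-(j + 1)) s`, Vandermonde's identity sums over `s`, and the rest is
`ichoose_sub_ichoose`. -/
lemma sum_ichoose_jacobi (n i j : ℤ) :
    ∑ s ∈ Finset.Icc 0 (-n - 1), s.negOnePow * ichoose (j + s) s * ichoose i (-n - 1 - s) =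
      (i - j + n).negOnePow * ichoose n (i - j + n) -
        n.negOnePow * ((j - i).negOnePow * ichoose n (j - i)) := by
  have h := ichoose_sub_ichoose n (i - j)
  rw [mul_sub, show -(i - j) = j - i by ring, show i - j - 1 = -(j + 1) + i by ring,
    ichoose_add] at h
  have e : (n.negOnePow : ℤ) * (j - i).negOnePow = (i - j + n).negOnePow := by
    rw [← Units.val_mul, ← Int.negOnePow_add, show n + (j - i) = i - j + n - 2 * (i - j) by ring,
      Int.negOnePow_sub, Int.negOnePow_two_mul, mul_one]
  rw [← mul_assoc, e, h]
  refine Finset.sum_congr rfl fun s _ => ?_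
  rw [ichoose_neg, show j + 1 + s - 1 = j + s by ring]

end Binomial

/-! ### Delta functions multiplied by series in two variables. -/

section Delta

variable {M : Type*} [AddCommGroup M] [Module ℂ M]

/-- The coefficients of `x₀⁻¹ δ((x₁ - x₂) / x₀) F(x₁, x₂)`. -/
def deltaOne (F : ℤ → ℤ → M) (n : ℤ) : ℤ → ℤ → M := fun j k =>
  ∑ᶠ s : ℤ, (s.negOnePow * ichoose n s : ℤ) • F (j - n + s) (k - s)

/-- The coefficients of `x₀⁻¹ δ((x₂ - x₁) / (-x₀)) F(x₁, x₂)`. -/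
def deltaTwo (F : ℤ → ℤ → M) (n : ℤ) : ℤ → ℤ → M := fun j k =>
  ∑ᶠ s : ℤ, (n.negOnePow * (s.negOnePow * ichoose n s) : ℤ) • F (j - s) (k - n + s)

/-- The coefficients of `x₂⁻¹ δ((x₁ - x₀) / x₂) Z(x₀, x₂)`. -/
def deltaThree (Z : ℤ → ℤ → M) (n : ℤ) : ℤ → ℤ → M := fun j k =>
  ∑ᶠ s : ℤ, (s.negOnePow * ichoose (j + s) s : ℤ) • Z (-(n + s) - 1) (j + k + s + 1)

/-- With integer indices, shifts of the summation variable become bijections. -/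
lemma finsum_natCast {f : ℕ → M} {g : ℤ → M} (h : ∀ s : ℕ, f s = g s) (hg : ∀ s < 0, g s = 0) :
    ∑ᶠ s : ℕ, f s = ∑ᶠ s : ℤ, g s := by
  classical
  rw [finsum_congr h, ← finsum_mem_range (f := g) (g := fun s : ℕ => (s : ℤ)) Nat.cast_injective]
  refine finsum_congr fun s => ?_
  by_cases hs : s ∈ Set.range fun s : ℕ => (s : ℤ)
  · rw [finsum_eq_if, if_pos hs]
  · rw [finsum_eq_if, if_neg hs, hg s]
    by_contra h0
    exact hs ⟨s.toNat, by simp only; omega⟩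

lemma finsum_sub_one (f : ℤ → M) : ∑ᶠ s : ℤ, f (s - 1) = ∑ᶠ s : ℤ, f s :=
  finsum_comp_equiv (Equiv.subRight (1 : ℤ))

/-- The exponents of the second variable are bounded below. -/
def SndBounded (F : ℤ → ℤ → M) : Prop := ∃ N : ℤ, ∀ m, ∀ n < N, F m n = 0

lemma SndBounded.lin2 {F : ℤ → ℤ → M} (c : ℂ × ℂ) (hF : SndBounded F) :
    SndBounded (lin2 c F) := by
  obtain ⟨N, hN⟩ := hF
  refine ⟨N, fun m n h => ?_⟩
  rw [lin2_apply, hN _ _ h, hN _ (n - 1) (by omega)]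
  simp

lemma finite_support_of_forall {f : ℤ → M} {A B : ℤ} (h : ∀ s, s < A ∨ B < s → f s = 0) :
    (Function.support f).Finite := by
  refine (Set.finite_Icc A B).subset fun s hs => ?_
  by_contra h0
  rw [Set.mem_Icc] at h0
  exact hs (h s (by omega))

lemma finsum_smul_add_smul {f g : ℤ → M} (c d : ℂ) (hf : (Function.support f).Finite)
    (hg : (Function.support g).Finite) :
    c • ∑ᶠ s, f s + d • ∑ᶠ s, g s = ∑ᶠ s, (c • f s + d • g s) := by
  rw [smul_finsum, smul_finsum, finsum_add_distrib]
  · exact hf.subset (Function.support_const_smul_subset c f)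
  · exact hg.subset (Function.support_const_smul_subset d g)

lemma deltaOne_finite {F : ℤ → ℤ → M} (hF : SndBounded F) (n j k : ℤ) :
    (Function.support fun s : ℤ =>
      (s.negOnePow * ichoose n s : ℤ) • F (j - n + s) (k - s)).Finite := by
  obtain ⟨N, hN⟩ := hF
  refine finite_support_of_forall (A := 0) (B := k - N) fun s hs => ?_
  rcases hs with hs | hs
  · rw [ichoose_of_neg _ hs, mul_zero, zero_smul]
  · rw [hN _ _ (by omega), smul_zero]

lemma deltaTwo_finite {F : ℤ → ℤ → M} (hF : FstBounded F) (n j k : ℤ) :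
    (Function.support fun s : ℤ =>
      (n.negOnePow * (s.negOnePow * ichoose n s) : ℤ) • F (j - s) (k - n + s)).Finite := by
  obtain ⟨N, hN⟩ := hF
  refine finite_support_of_forall (A := 0) (B := j - N) fun s hs => ?_
  rcases hs with hs | hs
  · rw [ichoose_of_neg _ hs, mul_zero, mul_zero, zero_smul]
  · rw [hN _ (by omega), Pi.zero_apply, smul_zero]

lemma deltaThree_finite {Z : ℤ → ℤ → M} (hZ : FstBounded Z) (n j k l : ℤ) :
    (Function.support fun s : ℤ =>
      (s.negOnePow * ichoose (j + s) s : ℤ) • Z (-(n + s) - 1) (k + s + l)).Finite := by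
  obtain ⟨N, hN⟩ := hZ
  refine finite_support_of_forall (A := 0) (B := -n - 1 - N) fun s hs => ?_
  rcases hs with hs | hs
  · rw [ichoose_of_neg _ hs, mul_zero, zero_smul]
  · rw [hN _ (by omega), Pi.zero_apply, smul_zero]

lemma lin2_deltaOne (c : ℂ × ℂ) {F : ℤ → ℤ → M} (hF : SndBounded F) (n : ℤ) :
    lin2 c (deltaOne F n) = deltaOne (lin2 c F) n := by
  funext j k
  refine (finsum_smul_add_smul _ _ (deltaOne_finite hF n (j - 1) k)
    (deltaOne_finite hF n j (k - 1))).trans (finsum_congr fun s => ?_)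
  rw [lin2_apply, show j - 1 - n + s = j - n + s - 1 by ring, show k - 1 - s = k - s - 1 by ring]
  module

lemma lin2_deltaTwo (c : ℂ × ℂ) {F : ℤ → ℤ → M} (hF : FstBounded F) (n : ℤ) :
    lin2 c (deltaTwo F n) = deltaTwo (lin2 c F) n := by
  funext j k
  refine (finsum_smul_add_smul _ _ (deltaTwo_finite hF n (j - 1) k)
    (deltaTwo_finite hF n j (k - 1))).trans (finsum_congr fun s => ?_)
  rw [lin2_apply, show j - 1 - s = j - s - 1 by ring, show k - 1 - n + s = k - n + s - 1 by ring]
  module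

/-- Against this delta function `x₁` may be replaced by `x₂ + x₀`. -/
lemma lin2_deltaThree (c : ℂ × ℂ) {Z : ℤ → ℤ → M} (hZ : FstBounded Z) (n : ℤ) :
    lin2 c (deltaThree Z n) = deltaThree (lin2 (shiftForm c) Z) n := by
  funext j k
  -- Pascal's rule for `ichoose (j + s) s`; the second sum, shifted by one in `s`, supplies the term
  -- with lower entry `s - 1` and opposite sign.
  have h1 : deltaThree Z n (j - 1) k = ∑ᶠ s : ℤ, ((s.negOnePow * ichoose (j + s) s : ℤ) •
      Z (-(n + s) - 1) (j + k + s) + (s.negOnePow * ichoose (j + s) s : ℤ) •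
      Z (-(n + s) - 1 - 1) (j + k + s + 1)) := by
    have e : ∑ᶠ s : ℤ, (s.negOnePow * ichoose (j + s) s : ℤ) •
        Z (-(n + s) - 1 - 1) (j + k + s + 1) =
        ∑ᶠ s : ℤ, ((s - 1).negOnePow * ichoose (j + (s - 1)) (s - 1) : ℤ) •
          Z (-(n + s) - 1) (j + k + s) := by
      rw [← finsum_sub_one]
      refine finsum_congr fun s => ?_
      rw [show -(n + (s - 1)) - 1 - 1 = -(n + s) - 1 by ring,
        show j + k + (s - 1) + 1 = j + k + s by ring]
    have hfin := deltaThree_finite hZ (n + 1) j (j + k) 1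
    simp only [show ∀ s, -(n + 1 + s) - 1 = -(n + s) - 1 - 1 from fun s => by ring] at hfin
    have hfin' := deltaThree_finite hZ n j (j + k) 0
    have hfin'' : (Function.support fun s : ℤ =>
        ((s - 1).negOnePow * ichoose (j + (s - 1)) (s - 1) : ℤ) •
          Z (-(n + s) - 1) (j + k + s)).Finite := by
      obtain ⟨N, hN⟩ := hZ
      refine finite_support_of_forall (A := 0) (B := -n - 1 - N) fun s hs => ?_
      rcases hs with hs | hs
      · rw [ichoose_of_neg _ (by omega), mul_zero, zero_smul]
      · rw [hN _ (by omega), Pi.zero_apply, smul_zero]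
    simp only [add_zero] at hfin'
    rw [finsum_add_distrib hfin', e, ← finsum_add_distrib hfin' hfin'']
    · refine finsum_congr fun s => ?_
      rw [← add_smul, show j - 1 + k + s + 1 = j + k + s by ring]
      congr 1
      rw [show j + s = j - 1 + s + 1 by ring, ichoose_succ, show j + (s - 1) = j - 1 + s by ring,
        Int.negOnePow_sub, Int.negOnePow_one]
      simp
      ring
    · exact hfin
  have hfin := deltaThree_finite (hZ.lin2 (1, 1)) n j (j + k) 1
  have hfin' := deltaThree_finite hZ n j (j + k) 0
  simp only [add_zero] at hfin'
  have h2 : deltaThree Z n j (k - 1) = ∑ᶠ s : ℤ, (s.negOnePow * ichoose (j + s) s : ℤ) •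
      Z (-(n + s) - 1) (j + k + s) := by
    refine finsum_congr fun s => ?_
    rw [show j + (k - 1) + s + 1 = j + k + s by ring]
  have h1' : deltaThree Z n (j - 1) k = ∑ᶠ s : ℤ, (s.negOnePow * ichoose (j + s) s : ℤ) •
      lin2 (1, 1) Z (-(n + s) - 1) (j + k + s + 1) := by
    rw [h1]
    refine finsum_congr fun s => ?_
    rw [lin2_apply, add_sub_cancel_right, one_smul, one_smul, smul_add, add_comm]
  rw [lin2_apply, h1', h2]
  refine (finsum_smul_add_smul _ _ hfin hfin').trans (finsum_congr fun s => ?_)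
  rw [lin2_apply, lin2_apply, add_sub_cancel_right]
  simp only [shiftForm]
  module

/-- Truncation makes all sums finite. Indexed by the exponent `i` of `x₁` in `F`, the three terms
are compared coefficient by coefficient in `sum_ichoose_jacobi`. -/
lemma deltaOne_sub_deltaTwo {F : ℤ → ℤ → M} (hF : Truncated F) (n : ℤ) :
    deltaOne F n - deltaTwo F n = deltaThree (taylorSubst F) n := by
  obtain ⟨N, hN⟩ := hF
  funext j k
  have sum_eq : ∀ f : ℤ → M, (∀ i, i < N ∨ j + k - n - i < N → f i = 0) →
      ∑ᶠ i, f i = ∑ i ∈ Finset.Icc N (j + k - n - N), f i := by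
    intro f hf
    refine finsum_eq_sum_of_support_subset _ fun i hi => ?_
    by_contra h0
    rw [Finset.mem_coe, Finset.mem_Icc] at h0
    exact hi (hf i (by omega))
  have h1 : deltaOne F n j k = ∑ i ∈ Finset.Icc N (j + k - n - N),
      ((i - j + n).negOnePow * ichoose n (i - j + n) : ℤ) • F i (j + k - n - i) := by
    rw [← sum_eq _ fun i hi => by rw [hN _ _ hi, smul_zero], deltaOne,
      ← finsum_comp_equiv (Equiv.subRight (j - n))]
    refine finsum_congr fun i => ?_
    simp only [Equiv.subRight_apply]
    rw [show i - (j - n) = i - j + n by ring, show j - n + (i - j + n) = i by ring,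
      show k - (i - j + n) = j + k - n - i by ring]
  have h2 : deltaTwo F n j k = ∑ i ∈ Finset.Icc N (j + k - n - N),
      (n.negOnePow * ((j - i).negOnePow * ichoose n (j - i)) : ℤ) • F i (j + k - n - i) := by
    rw [← sum_eq _ fun i hi => by rw [hN _ _ hi, smul_zero], deltaTwo,
      ← finsum_comp_equiv (Equiv.subLeft j)]
    refine finsum_congr fun i => ?_
    simp only [Equiv.subLeft_apply]
    rw [show j - (j - i) = i by ring, show k - n + (j - i) = j + k - n - i by ring]
  have h3 : deltaThree (taylorSubst F) n j k = ∑ s ∈ Finset.Icc 0 (-n - 1),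
      ∑ i ∈ Finset.Icc N (j + k - n - N),
        (s.negOnePow * ichoose (j + s) s * ichoose i (-n - 1 - s) : ℤ) • F i (j + k - n - i) := by
    rw [deltaThree, finsum_eq_sum_of_support_subset (s := Finset.Icc 0 (-n - 1))]
    · refine Finset.sum_congr rfl fun s _ => ?_
      rw [← sum_eq _ fun i hi => by rw [hN _ _ hi, smul_zero], taylorSubst,
        smul_finsum' _ (taylorSubst_finite ⟨N, hN⟩ _ _)]
      refine finsum_congr fun i => ?_
      rw [mul_smul (_ * _), show -(n + s) - 1 = -n - 1 - s by ring,
        show j + k + s + 1 + (-n - 1 - s) - i = j + k - n - i by ring]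
    · intro s hs
      by_contra h0
      rw [Finset.mem_coe, Finset.mem_Icc] at h0
      refine hs ?_
      rcases lt_or_ge s 0 with h | h
      · simp only [ichoose_of_neg _ h, mul_zero, zero_smul]
      · simp only [taylorSubst_of_neg F (by omega : -(n + s) - 1 < 0), smul_zero]
  rw [Pi.sub_apply, Pi.sub_apply, h1, h2, h3, Finset.sum_comm, ← Finset.sum_sub_distrib]
  refine Finset.sum_congr rfl fun i _ => ?_
  rw [← Finset.sum_smul, sum_ichoose_jacobi, sub_smul]

lemma op2_deltaOne (L : List (ℂ × ℂ)) {F : ℤ → ℤ → M} (hF : SndBounded F) (n : ℤ) :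
    op2 L (deltaOne F n) = deltaOne (op2 L F) n := by
  induction L generalizing F with
  | nil => rfl
  | cons c L ih => rw [op2_cons, op2_cons, lin2_op2, lin2_deltaOne c hF, ih (hF.lin2 c), lin2_op2]

lemma op2_deltaTwo (L : List (ℂ × ℂ)) {F : ℤ → ℤ → M} (hF : FstBounded F) (n : ℤ) :
    op2 L (deltaTwo F n) = deltaTwo (op2 L F) n := by
  induction L generalizing F with
  | nil => rfl
  | cons c L ih => rw [op2_cons, op2_cons, lin2_op2, lin2_deltaTwo c hF, ih (hF.lin2 c), lin2_op2]

lemma op2_deltaThree (L : List (ℂ × ℂ)) {Z : ℤ → ℤ → M} (hZ : FstBounded Z) (n : ℤ) :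
    op2 L (deltaThree Z n) = deltaThree (op2 (L.map shiftForm) Z) n := by
  induction L generalizing Z with
  | nil => rfl
  | cons c L ih =>
    rw [List.map_cons, op2_cons, op2_cons, lin2_op2, lin2_deltaThree c hZ, ih (hZ.lin2 _), lin2_op2]

/-- Against the delta function `x₁ - x₂` equals `x₀`. The same shift of `n` in all three terms is
what allows powers of `x₁ - x₂` to be divided out of the Jacobi identity. -/
lemma lin2_sub_deltaOne {F : ℤ → ℤ → M} (hF : SndBounded F) (n : ℤ) :
    lin2 (1, -1) (deltaOne F n) = deltaOne F (n + 1) := by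
  funext j k
  have e : deltaOne F n j (k - 1) = ∑ᶠ s : ℤ,
      ((s - 1).negOnePow * ichoose n (s - 1) : ℤ) • F (j - n + (s - 1)) (k - 1 - (s - 1)) :=
    (finsum_sub_one _).symm
  have hfin := (deltaOne_finite hF n j (k - 1)).preimage
    (f := fun s : ℤ => s - 1) (sub_left_injective.injOn)
  rw [lin2_apply, e]
  refine (finsum_smul_add_smul _ _ (deltaOne_finite hF n (j - 1) k) hfin).trans
    (finsum_congr fun s => ?_)
  beta_reduce
  rw [ichoose_succ, show j - 1 - n + s = j - (n + 1) + s by ring,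
    show j - n + (s - 1) = j - (n + 1) + s by ring, show k - 1 - (s - 1) = k - s by ring,
    Int.negOnePow_sub, Int.negOnePow_one, mul_neg, mul_one, Units.val_neg]
  module

lemma lin2_sub_deltaTwo {F : ℤ → ℤ → M} (hF : FstBounded F) (n : ℤ) :
    lin2 (1, -1) (deltaTwo F n) = deltaTwo F (n + 1) := by
  funext j k
  have e : deltaTwo F n (j - 1) k = ∑ᶠ s : ℤ,
      (n.negOnePow * ((s - 1).negOnePow * ichoose n (s - 1)) : ℤ) •
        F (j - 1 - (s - 1)) (k - n + (s - 1)) :=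
    (finsum_sub_one _).symm
  have hfin := (deltaTwo_finite hF n (j - 1) k).preimage
    (f := fun s : ℤ => s - 1) (sub_left_injective.injOn)
  rw [lin2_apply, e]
  refine (finsum_smul_add_smul _ _ hfin (deltaTwo_finite hF n j (k - 1))).trans
    (finsum_congr fun s => ?_)
  beta_reduce
  rw [ichoose_succ, show j - 1 - (s - 1) = j - s by ring,
    show k - n + (s - 1) = k - (n + 1) + s by ring, show k - 1 - n + s = k - (n + 1) + s by ring,
    Int.negOnePow_sub, Int.negOnePow_one, mul_neg, mul_one, Units.val_neg, Int.negOnePow_succ,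
    Units.val_neg]
  module

lemma lin2_sub_deltaThree {Z : ℤ → ℤ → M} (hZ : FstBounded Z) (n : ℤ) :
    lin2 (1, -1) (deltaThree Z n) = deltaThree Z (n + 1) := by
  rw [lin2_deltaThree _ hZ]
  funext j k
  refine finsum_congr fun s => ?_
  rw [lin2_apply, show -(n + s) - 1 - 1 = -(n + 1 + s) - 1 by ring]
  simp [shiftForm]

lemma op2_eq_add_length {J : ℤ → ℤ → ℤ → M} (hJ : ∀ n, lin2 (1, -1) (J n) = J (n + 1))
    {l : List ℂˣ} (hl : ∀ α ∈ l, α = 1) (n : ℤ) :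
    op2 (l.map rootForm) (J n) = J (n + l.length) := by
  induction l with
  | nil => simp
  | cons α l ih =>
    have e : rootForm α = (1, -1) := by
      rw [hl α List.mem_cons_self]
      rfl
    rw [List.map_cons, op2_cons, ih fun β hβ => hl β (List.mem_cons_of_mem _ hβ), e, hJ,
      List.length_cons, Nat.cast_add, Nat.cast_one, add_assoc]

end Delta

/-! ### The Jacobi identity with and without locality factors. -/

section Jacobi

variable {W : Type*} [AddCommGroup W] [Module ℂ W]

lemma jacobiOne_eq (a b : VertexOperator ℂ W) (w : W) (n : ℤ) :
    jacobiOne a b w n = deltaOne (fun m n => coeff a m (coeff b n w)) n := by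
  funext j k
  refine finsum_natCast (fun s => ?_) fun s hs => ?_
  · rw [ichoose_natCast, Int.coe_negOnePow_natCast]
  · rw [ichoose_of_neg _ hs, mul_zero, zero_smul]

lemma jacobiTwo_eq (a b : VertexOperator ℂ W) (w : W) (n : ℤ) :
    jacobiTwo a b w n = deltaTwo (fun m n => coeff b n (coeff a m w)) n := by
  funext j k
  refine finsum_natCast (fun s => ?_) fun s hs => ?_
  · rw [ichoose_natCast, Int.coe_negOnePow_natCast]
  · rw [ichoose_of_neg _ hs, mul_zero, mul_zero, zero_smul]

lemma jacobiThree_eq {V : Type*} [AddCommGroup V] [Module ℂ V] (Y : V →ₗ[ℂ] VertexOperator ℂ V)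
    (YW : V →ₗ[ℂ] VertexOperator ℂ W) (u v : V) (w : W)
    (h : ∀ k, YW (coeff (Y u) k v) = (YE (YW u) (YW v)).coeff k) (n : ℤ) :
    jacobiThree Y YW u v w n =
      deltaThree (fun k l => coeff ((YE (YW u) (YW v)).coeff k) l w) n := by
  funext j k
  refine finsum_natCast (fun s => ?_) fun s hs => ?_
  · rw [ichoose_natCast, Int.coe_negOnePow_natCast, VertexOperator.ncoeff_apply, h]
  · rw [ichoose_of_neg _ hs, mul_zero, zero_smul]

lemma sndBounded_prod (a b : VertexOperator ℂ W) (w : W) :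
    SndBounded fun m n => coeff a m (coeff b n w) := by
  obtain ⟨N, hN⟩ := exists_coeff_eq_zero b w
  exact ⟨N, fun m n hn => by simp only [hN n hn, map_zero]⟩

lemma fstBounded_prod_swap (a b : VertexOperator ℂ W) (w : W) :
    FstBounded fun m n => coeff b n (coeff a m w) := by
  obtain ⟨N, hN⟩ := exists_coeff_eq_zero a w
  exact ⟨N, fun m hm => funext fun n => by simp only [hN m hm, map_zero, Pi.zero_apply]⟩

/-- The factors pass through the delta functions. They turn both orders of multiplication into one
truncated series and, in shifted form, turn `Y_ℰ(a, x₀) b` into its expansion, so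
`deltaOne_sub_deltaTwo` applies. -/
lemma op2_jacobi {a b : VertexOperator ℂ W} {l : List ℂˣ}
    (h : CommuteUpTo (linearProduct l) a b) (w : W) (n : ℤ) :
    op2 (l.map rootForm) (deltaOne (fun m n => coeff a m (coeff b n w)) n) -
        op2 (l.map rootForm) (deltaTwo (fun m n => coeff b n (coeff a m w)) n) =
      op2 (l.map rootForm) (deltaThree (fun k l => coeff ((YE a b).coeff k) l w) n) := by
  have ht : Truncated (op2 (l.map rootForm) fun m n => coeff a m (coeff b n w)) := by
    have e : op2 (l.map rootForm) (fun m n => coeff a m (coeff b n w)) =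
        fun m n => polyMul (linearProduct l) (prodAB a b) m n w := by
      rw [polyMul_linearProduct]
      exact op2_apply _ (prodAB a b) w
    rw [e]
    exact h.mem_laurentTwo w
  have hs := isSubst_YE h w
  rw [op2_deltaOne _ (sndBounded_prod a b w), op2_deltaTwo _ (fstBounded_prod_swap a b w),
    op2_deltaThree _ hs.1, hs.op2_eq _ ht, ← h.op2_eq, deltaOne_sub_deltaTwo ht]

lemma quasiJacobi_of_commuteUpTo {V : Type*} [AddCommGroup V] [Module ℂ V]
    (Y : V →ₗ[ℂ] VertexOperator ℂ V) (YW : V →ₗ[ℂ] VertexOperator ℂ W) (u v : V)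
    (hY : ∀ k, YW (coeff (Y u) k v) = (YE (YW u) (YW v)).coeff k) {l : List ℂˣ}
    (h : CommuteUpTo (linearProduct l) (YW u) (YW v)) :
    QuasiJacobi Y YW (linearProduct l) u v := by
  intro w n
  rw [polyMul_linearProduct, polyMul_linearProduct, polyMul_linearProduct, jacobiOne_eq,
    jacobiTwo_eq, jacobiThree_eq Y YW u v w hY, op2_jacobi h]

lemma jacobi_of_local {V : Type*} [AddCommGroup V] [Module ℂ V]
    (Y : V →ₗ[ℂ] VertexOperator ℂ V) (YW : V →ₗ[ℂ] VertexOperator ℂ W) (u v : V)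
    (hY : ∀ k, YW (coeff (Y u) k v) = (YE (YW u) (YW v)).coeff k) {l : List ℂˣ}
    (hl : ∀ α ∈ l, α = 1) (h : CommuteUpTo (linearProduct l) (YW u) (YW v)) (w : W) (n : ℤ) :
    jacobiOne (YW u) (YW v) w n - jacobiTwo (YW u) (YW v) w n = jacobiThree Y YW u v w n := by
  -- All factors are `x₁ - x₂`, each raising the index by one, so starting at `n - l.length` leads
  -- to `n`.
  have h1 := op2_jacobi h w (n - l.length)
  rw [op2_eq_add_length (lin2_sub_deltaOne (sndBounded_prod _ _ w)) hl,
    op2_eq_add_length (lin2_sub_deltaTwo (fstBounded_prod_swap _ _ w)) hl,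
    op2_eq_add_length (lin2_sub_deltaThree (isSubst_YE h w).1) hl, sub_add_cancel] at h1
  rw [jacobiOne_eq, jacobiTwo_eq, jacobiThree_eq Y YW u v w hY, h1]

end Jacobi

/-! ### The `Γ`-vertex algebra and its quasimodule. -/

namespace FieldAlgebra

variable {Γ : Subgroup ℂˣ} {V W : Type*} [AddCommGroup V] [Module ℂ V]
    [AddCommGroup W] [Module ℂ W] (A : FieldAlgebra Γ V W)

/-- The vertex algebra structure on a closed `Γ`-local space of fields. -/
def vertexAlgebra : VertexAlgebra V where
  vac := A.vac
  Y := A.Y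
  Y_vac := by
    refine HVertexOperator.coeff_inj (funext fun k => LinearMap.ext fun b => A.ι_injective ?_)
    rw [ι_coeff_Y, A.ι_vac, YE_idField_left, coeff_idField]
    split_ifs
    · rfl
    · exact (map_zero A.ι).symm
  creation_regular v n hn := A.ext_coeffEval fun l w => by
    rw [coeffEval_apply, ι_coeff_Y, A.ι_vac, coeff_YE_idField_right, ichoose_of_neg _ hn, zero_smul,
      map_zero]
  creation_limit v := A.ext_coeffEval fun l w => by
    rw [coeffEval_apply, ι_coeff_Y, A.ι_vac, coeff_YE_idField_right, ichoose_zero_right, one_smul,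
      add_zero]
    rfl
  jacobi u v w n j k := by
    obtain ⟨l, hl, h⟩ := A.exists_commuteUpTo_Y u v
    -- The argument for fields on `W` is applied to the fields `Y(u, x)` on `V`; `YE_Y_coeff` is the
    -- required compatibility of products.
    exact congrFun₂ (jacobi_of_local A.Y A.Y u v (fun k => (A.YE_Y_coeff u v k).symm) hl h w n) j k

lemma rescale_add (α : ℂˣ) (a b : VertexOperator ℂ W) :
    rescale α (a + b) = rescale α a + rescale α b := by
  refine HVertexOperator.coeff_inj (funext fun n => ?_)
  rw [map_add, Pi.add_apply, coeff_rescale, coeff_rescale, coeff_rescale, map_add, Pi.add_apply,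
    smul_add]

lemma rescale_smul (α : ℂˣ) (r : ℂ) (a : VertexOperator ℂ W) :
    rescale α (r • a) = r • rescale α a := by
  refine HVertexOperator.coeff_inj (funext fun n => ?_)
  rw [map_smul, Pi.smul_apply, coeff_rescale, coeff_rescale, map_smul, Pi.smul_apply, smul_comm]

lemma rescale_one (a : VertexOperator ℂ W) : rescale 1 a = a := by
  refine HVertexOperator.coeff_inj (funext fun n => ?_)
  rw [coeff_rescale, one_zpow, Units.val_one, one_smul]

lemma rescale_mul (α β : ℂˣ) (a : VertexOperator ℂ W) :
    rescale (α * β) a = rescale α (rescale β a) := by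
  refine HVertexOperator.coeff_inj (funext fun n => ?_)
  rw [coeff_rescale, coeff_rescale, coeff_rescale, smul_smul, mul_zpow, Units.val_mul]

lemma rescale_idField (α : ℂˣ) : rescale α (idField W) = idField W := by
  refine HVertexOperator.coeff_inj (funext fun n => ?_)
  rw [coeff_rescale, coeff_idField]
  split_ifs with h
  · rw [h, zpow_zero, Units.val_one, one_smul]
  · rw [smul_zero]

/-- The action of `Γ` by linear operators. -/
def actHom : Γ →* Module.End ℂ V where
  toFun α :=
    { toFun := A.act α
      map_add' := fun a b => A.ι_injective <| by
        rw [map_add, A.ι_act, A.ι_act, A.ι_act, map_add, rescale_add]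
      map_smul' := fun r a => A.ι_injective <| by
        rw [RingHom.id_apply, map_smul, A.ι_act, A.ι_act, map_smul, rescale_smul] }
  map_one' := LinearMap.ext fun a => A.ι_injective <|
    (A.ι_act 1 a).trans (rescale_one (A.ι a))
  map_mul' α β := LinearMap.ext fun a => A.ι_injective <| by
    refine (A.ι_act (α * β) a).trans ((rescale_mul (α : ℂˣ) β (A.ι a)).trans ?_)
    rw [← A.ι_act, ← A.ι_act]
    rfl

lemma ι_actHom (α : Γ) (a : V) : A.ι (A.actHom α a) = rescale α (A.ι a) := A.ι_act α a

/-- The `Γ`-vertex algebra structure on a closed `Γ`-local space of fields. -/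
def gammaVertexAlgebra : GammaVertexAlgebra Γ V where
  toVertexAlgebra := A.vertexAlgebra
  R := A.actHom.toHomUnits
  φ := Γ.subtype
  R_vac g := A.ι_injective <| by
    change A.ι (A.actHom g A.vac) = A.ι A.vac
    rw [ι_actHom, A.ι_vac, rescale_idField]
  R_conj g v n := by
    refine LinearMap.ext fun b => A.ι_injective ?_
    change A.ι (A.actHom g (coeff (A.Y v) n (A.actHom g⁻¹ b))) =
      A.ι (coeff (rescale ((g : ℂˣ)⁻¹) (A.Y (A.actHom g v))) n b)
    have hb : A.actHom g (A.actHom g⁻¹ b) = b := by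
      rw [← Module.End.mul_apply, ← map_mul, mul_inv_cancel, map_one, Module.End.one_apply]
    -- With `b = R_g c`, the right side is a product of two rescaled fields, as `rescale_YE_coeff`
    -- requires.
    generalize A.actHom g⁻¹ b = c at hb ⊢
    subst hb
    obtain ⟨l, h⟩ := A.commute v c
    obtain ⟨l', h'⟩ := A.commute (A.actHom g v) (A.actHom g c)
    rw [ι_actHom A g v, ι_actHom A g c] at h'
    rw [coeff_rescale, LinearMap.smul_apply, map_smul, ι_actHom, ι_coeff_Y, ι_coeff_Y,
      ι_actHom A g v, ι_actHom A g c, rescale_YE_coeff h h', smul_smul, inv_zpow,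
      ← Units.val_mul, inv_mul_cancel, Units.val_one, one_smul]

/-- The quasimodule structure on `W`. -/
def quasimodule : A.gammaVertexAlgebra.Quasimodule W where
  YW := A.ι
  YW_vac := A.ι_vac
  quasiJacobi u v := by
    obtain ⟨l, h⟩ := A.commute u v
    exact ⟨_, linearProduct_ne_zero l,
      quasiJacobi_of_commuteUpTo A.Y A.ι u v (A.ι_coeff_Y u v) h⟩
  equivariant g v := A.ι_actHom g v
  gammaLocal u v := by
    have h : A.gammaVertexAlgebra.φ.range = Γ := Γ.range_subtype
    rw [h]
    exact A.isLocal u v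

end FieldAlgebra

lemma ClosedSubspace.YE_coeff_mem {W : Type*} [AddCommGroup W] [Module ℂ W]
    {V : Submodule ℂ (VertexOperator ℂ W)} (hV : ClosedSubspace V) {a b : VertexOperator ℂ W}
    (ha : a ∈ V) (hb : b ∈ V) (k : ℤ) : (YE a b).coeff k ∈ V := by
  have := hV.2 a ha b hb (-k - 1)
  rwa [nthProd, show -(-k - 1) - 1 = k by ring] at this

/-- A closed `Γ`-local subspace as a `FieldAlgebra`. -/
def ClosedSubspace.fieldAlgebra {W : Type*} [AddCommGroup W] [Module ℂ W] {Γ : Subgroup ℂˣ}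
    {V : Submodule ℂ (VertexOperator ℂ W)} (hV : ClosedSubspace V)
    (hΓ : GammaLocal Γ (V : Set (VertexOperator ℂ W))) (h1 : idField W ∈ V)
    (hR : ∀ α ∈ Γ, ∀ a ∈ V, rescale α a ∈ V) : FieldAlgebra Γ V W where
  ι := V.subtype
  ι_injective := V.injective_subtype
  isLocal a b := hΓ a a.2 b b.2
  prod a b k := ⟨(YE (a : VertexOperator ℂ W) b).coeff k, hV.YE_coeff_mem a.2 b.2 k⟩
  ι_prod _ _ _ := rfl
  vac := ⟨idField W, h1⟩
  ι_vac := rfl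
  act α a := ⟨rescale α a, hR α α.2 a a.2⟩
  ι_act _ _ := rfl

end

end GammaVA

open GammaVA in
theorem theorem2p9 {W : Type*} [AddCommGroup W] [Module ℂ W] (Γ : Subgroup ℂˣ) :
    (∀ S : Set (VertexOperator ℂ W), GammaLocal Γ S →
      ∃ K : Submodule ℂ (VertexOperator ℂ W),
        IsLeast {U : Submodule ℂ (VertexOperator ℂ W) |
          ClosedSubspace U ∧ GammaLocal Γ (U : Set (VertexOperator ℂ W)) ∧
          idField W ∈ U ∧ S ⊆ U ∧ ∀ α ∈ Γ, ∀ a ∈ U, rescale α a ∈ U} K) ∧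
    (∀ V : Submodule ℂ (VertexOperator ℂ W),
      ClosedSubspace V → GammaLocal Γ (V : Set (VertexOperator ℂ W)) →
      idField W ∈ V → (∀ α ∈ Γ, ∀ a ∈ V, rescale α a ∈ V) →
      ∃ A : GammaVertexAlgebra Γ V,
        (A.vac : VertexOperator ℂ W) = idField W ∧
        (∀ (a b : V) (n : ℤ),
          (VertexOperator.ncoeff (A.Y a) n b : VertexOperator ℂ W) = nthProd (a : VertexOperator ℂ W) b n) ∧
        (∀ (α : Γ) (a : V),
          ((A.R α : V →ₗ[ℂ] V) a : VertexOperator ℂ W) = rescale (α : ℂˣ) a) ∧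
        A.φ = Γ.subtype ∧
        ∃ M : A.Quasimodule W, ∀ a : V, M.YW a = a) := by
  refine ⟨exists_isLeast_closed_gammaLocal, fun V hV hΓ h1 hR => ?_⟩
  let F := hV.fieldAlgebra hΓ h1 hR
  exact ⟨F.gammaVertexAlgebra, rfl, fun a b n => F.ι_coeff_Y a b (-n - 1),
    fun α a => F.ι_actHom α a, rfl, F.quasimodule, fun a => rfl⟩
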